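/- Setting. For labels $\sigma\in\{\pm1\}^n$ and $p\in[0,1]$, $\zeta\in(0,\tfrac12)$, $\mathsf{CBM}(\sigma,p,\zeta)$ is the law of a symmetric matrix $A$ with zero diagonal and independent entries $A_{ij}\in\{0,+1,-1\}$, $i<j$, equal to $\sigma_i\sigma_j$, $-\sigma_i\sigma_j$, $0$ with probabilities $p(1-\zeta)$, $p\zeta$, $1-p$. Graphs $A_1,A_2,\dots$ are independent, $A_t\sim\mathsf{CBM}(\sigma^{\rm pre},p,\zeta)$ for $t<\nu$ and $A_t\sim\mathsf{CBM}(\sigma^{\rm post},p,\zeta)$ for $t\ge\nu$. Each entry of $A_t$ is independently privatized by randomized response: the true value is kept with probability $e^\epsilon/(e^\epsilon+2)$ and each of the two other values is reported with probability $1/(e^\epsilon+2)$. This gives $\tilde A_t\sim\mathsf{CBM}(\sigma,\tilde p,\tilde\zeta)$ with $$\tilde p=\frac{2+p(e^\epsilon-1)}{e^\epsilon+2},\qquad \tilde\zeta=\frac{1+p\zeta(e^\epsilon-1)}{2+p(e^\epsilon-1)}.$$ Let $\Pr(\cdot;\sigma)$ be the probability mass function of $\mathsf{CBM}(\sigma,\tilde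 p,\tilde\zeta)$. Let $\hat\sigma_{t}$ be a label vector obtained from a solution $\hat Y$ of $\max\{\operatorname{tr}(\tilde A_{t}Y): Y\succeq0,\ Y_{ii}=1\ \forall i\}$, where $\hat\sigma_t=\pm\sigma$ whenever $\hat Y=\sigma\sigma^T$ with $\sigma\in\{\pm1\}^n$, and the rounding is arbitrary otherwise. Put $S_1=0$, $S_t=\max\{S_{t-1},0\}+\log\frac{\Pr(\tilde A_t;\hat\sigma_{t-1})}{\Pr(\tilde A_t;\sigma^{\rm pre})}$ for $t\ge2$, and $T_{\rm L}=\inf\{t\ge1:S_t\ge b\}$. For a filtration $(\mathcal F_k)_{k\ge0}$, let $\mathsf{WADD}(\tau)=\sup_{\nu\ge1}\operatorname{ess\,sup}\mathbb E_\nu[(\tau-\nu+1)^+\mid\mathcal F_{\nu-1}]$. Write $\mathbb E_\infty$ for the expectation when there is no change, and $$\tilde I_0=\tfrac12\Big(\log\tfrac{1-\tilde\zeta}{\tilde\zeta}\Big)\tilde p(1-2\tilde\zeta)\Big(\tbinom n2-\sum_{i<j}\sigma^{\rm pre}_i\sigma^{\rm pre}_j\sigma^{\rm post}_i\sigma^{\rm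 post}_j\Big).$$ Theorem. Fix $\zeta\in(0,\tfrac12)$. Consider a sequence of such problems in which $n\to\infty$ and $p,\epsilon,\sigma^{\rm pre},\sigma^{\rm post},\gamma$ may vary along the sequence, with $1\le\operatorname{Ham}(\sigma^{\rm pre},\sigma^{\rm post})\le n/2$. Assume that $\epsilon\ge c\log n$ for some constant $c>0$, that $p=a\frac{\log n}n$ with $a>\frac{2(n^{3/2}-n)}{(n-1)\log n}$ (where $a$ may vary along the sequence), and that $$a\big(\sqrt{1-\zeta}-\sqrt\zeta\big)^2>\frac{\sqrt n}{\sqrt n-1}\cdot\frac{e^\epsilon+1}{e^\epsilon-1}.$$ Let $b=\log\gamma$, $\gamma\to\infty$ and $\tilde I_0=o(\log\gamma)$. Then $$\mathsf{WADD}(T_{\rm L})=\frac{\log\gamma}{\tilde I_0}(1+o(1)),$$ both for $\mathcal F_k=\sigma(\tilde A_1,\dots,\tilde A_k)$ and for $\mathcal F_k=\sigma(A_1,\dots,A_k)$. Here $\tilde I_0$ is the Kullback–Leibler divergence of the law of $\tilde A$ under $\sigma^{\rm post}$ from its law under $\sigma^{\rm pre}$. Moreover the procedure is asymptotically optimal: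 eventually along the sequence $T_{\rm L}$ is a stopping time of the filtration $\sigma(\tilde A_1,\dots,\tilde A_k)$ with $\mathbb E_\infty[T_{\rm L}]\ge\gamma$; and for every $\delta>0$, eventually along the sequence, every stopping time $\tau$ of this filtration with $\mathbb E_\infty[\tau]\ge\gamma$ has $\mathsf{WADD}(\tau)\ge(1-\delta)\frac{\log\gamma}{\tilde I_0}$, where $\mathsf{WADD}$ is taken with respect to this filtration. -/

import Mathlib

open MeasureTheory Filter Topology
open scoped ENNReal

namespace PrivCBM

noncomputable section

/-! ### Graphs, labels, and the censored block model -/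

/-- Unordered pairs of distinct vertices, written as `(i, j)` with `i < j`. -/
abbrev Pair (n : ℕ) : Type := {e : Fin n × Fin n // e.1 < e.2}

/-- Community labels `σ ∈ {-1, +1}ⁿ`. -/
abbrev Labels (n : ℕ) : Type := Fin n → ℤˣ

/-- A signed graph on `n` vertices: every pair `i < j` carries a label in `{0, +1, -1}`. -/
abbrev SignedGraph (n : ℕ) : Type := Pair n → SignType

/-- The finite set `{0, +1, -1}` carries the discrete σ-algebra. -/
instance : MeasurableSpace SignType := ⊤

instance : DiscreteMeasurableSpace SignType := ⟨fun _ => trivial⟩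

/-- The symmetric adjacency matrix with zero diagonal. -/
def adjacency {n : ℕ} (A : SignedGraph n) : Matrix (Fin n) (Fin n) ℝ := fun i j =>
  if h : i < j then ((A ⟨(i, j), h⟩ : SignType) : ℝ)
  else if h : j < i then ((A ⟨(j, i), h⟩ : SignType) : ℝ)
  else 0

/-- `σ_i σ_j`, viewed as an edge label. -/
def agree {n : ℕ} (σ : Labels n) (e : Pair n) : SignType :=
  if σ e.1.1 = σ e.1.2 then 1 else -1

/-- Probability of the edge label `x` when `σ_i σ_j = s`. -/
def edgeProb (p ζ : ℝ) (s x : SignType) : ℝ :=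
  if x = 0 then 1 - p else if x = s then p * (1 - ζ) else p * ζ

/-- The probability mass function of `CBM(σ, p, ζ)` at the graph `A`, i.e. the likelihood. -/
def likelihood {n : ℕ} (p ζ : ℝ) (σ : Labels n) (A : SignedGraph n) : ℝ :=
  ∏ e, edgeProb p ζ (agree σ e) (A e)

/-- Ternary randomized response: the probability of reporting `y` for the true label `x`. -/
def rrProb (ε : ℝ) (x y : SignType) : ℝ :=
  if x = y then Real.exp ε / (Real.exp ε + 2) else 1 / (Real.exp ε + 2)

/-- The data of one detection problem: the pre- and post-change labels, the CBM
parameters `p, ζ ∈ [0, 1]` and the privacy budget `ε`. -/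
structure Model (n : ℕ) where
  pre : Labels n
  post : Labels n
  p : unitInterval
  ζ : unitInterval
  ε : ℝ

/-- One time step: the raw graph and the privatized graph. -/
abbrev Sample (n : ℕ) : Type := SignedGraph n × SignedGraph n

/-- A finite family of labels that are independent with the given edge distributions. -/
def indepEdges {n : ℕ} (q : Pair n → PMF SignType) : PMF (SignedGraph n) :=
  PMF.ofFintype (fun A => ∏ e, q e (A e)) (by
    have h : ∀ e, ∑ x, q e x = 1 := fun e => by
      have := (q e).tsum_coe
      rwa [tsum_fintype] at this
    rw [← Fintype.prod_sum (fun e x => q e x)]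
    simp [h])

lemma sum_signType {M : Type*} [AddCommMonoid M] (f : SignType → M) :
    ∑ x, f x = f 0 + f (-1) + f 1 := by
  have : (Finset.univ : Finset SignType) = {0, -1, 1} := by decide
  rw [this, Finset.sum_insert (by decide), Finset.sum_insert (by decide),
    Finset.sum_singleton, add_assoc]

/-- The distribution of a single edge of `CBM(σ, p, ζ)`; the sign `σ_i σ_j` is `1` or `-1`. -/
def edgePMF {n : ℕ} (p ζ : unitInterval) (σ : Labels n) (e : Pair n) : PMF SignType :=
  PMF.ofFintype (fun x => ENNReal.ofReal (edgeProb p ζ (agree σ e) x)) (by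
    have hp0 := p.2.1
    have hp1 := p.2.2
    have hz0 := ζ.2.1
    have hz1 := ζ.2.2
    have h1 : (0 : ℝ) ≤ 1 - p := by linarith
    have h2 : (0 : ℝ) ≤ p * ζ := mul_nonneg hp0 hz0
    have h3 : (0 : ℝ) ≤ p * (1 - ζ) := mul_nonneg hp0 (by linarith)
    have h0 : (1 : SignType) ≠ -1 := by decide
    have h0' : (-1 : SignType) ≠ 1 := by decide
    have hs : ∀ s : SignType, s = 1 ∨ s = -1 →
        edgeProb p ζ s 0 + edgeProb p ζ s (-1) + edgeProb p ζ s 1 = 1 ∧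
          ∀ x, 0 ≤ edgeProb p ζ s x := by
      rintro s (rfl | rfl) <;> refine ⟨?_, fun x => ?_⟩
      · simp [edgeProb, h0']; ring
      · unfold edgeProb; split_ifs <;> assumption
      · simp [edgeProb, h0]; ring
      · unfold edgeProb; split_ifs <;> assumption
    have ha : agree σ e = 1 ∨ agree σ e = -1 := by
      unfold agree; split_ifs <;> simp
    rw [← ENNReal.ofReal_sum_of_nonneg (fun x _ => (hs _ ha).2 x), ENNReal.ofReal_eq_one,
      sum_signType]
    exact (hs _ ha).1)

/-- The law of randomized response applied to the true edge label `x`. -/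
def rrPMF (ε : ℝ) (x : SignType) : PMF SignType :=
  PMF.ofFintype (fun y => ENNReal.ofReal (rrProb ε x y)) (by
    have hE : (0 : ℝ) < Real.exp ε := Real.exp_pos ε
    have h1 : (0 : ℝ) ≤ Real.exp ε / (Real.exp ε + 2) := by positivity
    have h2 : (0 : ℝ) ≤ 1 / (Real.exp ε + 2) := by positivity
    have hn : ∀ y, 0 ≤ rrProb ε x y := fun y => by
      unfold rrProb
      split_ifs <;> assumption
    rw [← ENNReal.ofReal_sum_of_nonneg (fun y _ => hn y), ENNReal.ofReal_eq_one, sum_signType]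
    unfold rrProb
    rcases x with _ | _ | _ <;> simp <;> field_simp <;> ring)

/-- The law `CBM(σ, p, ζ)` of a raw graph. -/
def cbm {n : ℕ} (p ζ : unitInterval) (σ : Labels n) : PMF (SignedGraph n) :=
  indepEdges (edgePMF p ζ σ)

/-- The graph perturbation mechanism: every edge is randomized independently. -/
def perturb {n : ℕ} (ε : ℝ) (A : SignedGraph n) : PMF (SignedGraph n) :=
  indepEdges (fun e => rrPMF ε (A e))

/-- The joint law of a raw graph with labels `σ` and its privatized version. -/
def Model.sampleLaw {n : ℕ} (M : Model n) (σ : Labels n) : PMF (Sample n) :=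
  (cbm M.p M.ζ σ).bind (fun A => (perturb M.ε A).map (fun B => (A, B)))

/-- The law of the privatized graph when the labels are `σ`. -/
def Model.privateLaw {n : ℕ} (M : Model n) (σ : Labels n) : Measure (SignedGraph n) :=
  ((cbm M.p M.ζ σ).bind (fun A => perturb M.ε A)).toMeasure

/-! ### The observation sequence -/

/-- Sample paths; coordinate `t ≥ 1` holds the observation at time `t`.
Coordinate `0` is never observed. -/
abbrev SamplePath (n : ℕ) : Type := ℕ → Sample n

/-- The labels in force at time `t` when the change-point is `ν` (`ν = ⊤`: no change). -/
def Model.labelsAt {n : ℕ} (M : Model n) (ν : ℕ∞) (t : ℕ) : Labels n :=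
  if (t : ℕ∞) < ν then M.pre else M.post

/-- The measure `Pr_ν` on sample paths: independent observations, with a change at `ν`. -/
def Model.pathLaw {n : ℕ} (M : Model n) (ν : ℕ∞) : Measure (SamplePath n) :=
  Measure.infinitePi (fun t => (M.sampleLaw (M.labelsAt ν t)).toMeasure)

/-- The filtration generated by `X_1, X_2, …`, where `X_t = f (ω t)`; it is trivial at time `0`. -/
def filtrationOf {n : ℕ} {β : Type*} [MeasurableSpace β] (f : Sample n → β) (hf : Measurable f) :
    Filtration ℕ (inferInstance : MeasurableSpace (SamplePath n)) where
  seq k := ⨆ (t : ℕ) (_ : 1 ≤ t ∧ t ≤ k),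
    MeasurableSpace.comap (fun ω : SamplePath n => f (ω t)) inferInstance
  mono' _ _ hkl := iSup₂_le fun t ht =>
    le_iSup₂_of_le t ⟨ht.1, ht.2.trans hkl⟩ le_rfl
  le' _ := iSup₂_le fun t _ => (hf.comp (measurable_pi_apply t)).comap_le

/-- `σ(A_1, …, A_k)`: the filtration of the raw graphs. -/
def rawFiltration (n : ℕ) : Filtration ℕ (inferInstance : MeasurableSpace (SamplePath n)) :=
  filtrationOf Prod.fst measurable_fst

/-- `σ(Ã_1, …, Ã_k)`: the filtration of the privatized graphs. -/
def privateFiltration (n : ℕ) : Filtration ℕ (inferInstance : MeasurableSpace (SamplePath n)) :=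
  filtrationOf Prod.snd measurable_snd

/-- The worst-case average detection delay
`sup_{ν ≥ 1} ess sup E_ν[(τ - ν + 1)⁺ | F_{ν-1}]` (subtraction in `ℝ≥0∞` is truncated at `0`). -/
def Model.wadd {n : ℕ} (M : Model n)
    (F : Filtration ℕ (inferInstance : MeasurableSpace (SamplePath n))) (τ : SamplePath n → ℕ∞) : ℝ≥0∞ :=
  ⨆ (ν : ℕ) (_ : 1 ≤ ν),
    essSup (condLExp (F (ν - 1)) (M.pathLaw ν) (fun ω => ((τ ω : ℕ∞) : ℝ≥0∞) + 1 - (ν : ℝ≥0∞)))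
      (M.pathLaw ν)

/-- The average run length `E_∞[τ]`. -/
def Model.arl {n : ℕ} (M : Model n) (τ : SamplePath n → ℕ∞) : ℝ≥0∞ :=
  ∫⁻ ω, ((τ ω : ℕ∞) : ℝ≥0∞) ∂(M.pathLaw ⊤)

/-! ### The community estimator -/

/-- `Y` maximizes `tr (B Y)` over positive semidefinite matrices with unit diagonal. -/
def IsSDPSolution {n : ℕ} (B Y : Matrix (Fin n) (Fin n) ℝ) : Prop :=
  Y.PosSemidef ∧ (∀ i, Y i i = 1) ∧
    ∀ Z : Matrix (Fin n) (Fin n) ℝ, Z.PosSemidef → (∀ i, Z i i = 1) →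
      (B * Z).trace ≤ (B * Y).trace

/-- `est` is a label estimator read off from a solution of the semidefinite relaxation: for each
graph a solution `Ŷ` is selected, and if `Ŷ = σ σᵀ` for a label vector `σ`, the estimate is `σ`
up to a global flip. If `Ŷ` is not of this form it may be rounded in any way. -/
def IsSDPEstimator {n : ℕ} (est : SignedGraph n → Labels n) : Prop :=
  ∃ Yhat : SignedGraph n → Matrix (Fin n) (Fin n) ℝ, ∀ A : SignedGraph n,
    IsSDPSolution (adjacency A) (Yhat A) ∧
      ∀ σ : Labels n, (∀ i j, Yhat A i j = ((σ i : ℤ) : ℝ) * ((σ j : ℤ) : ℝ)) →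
        est A = σ ∨ est A = -σ

/-! ### The private adaptive CUSUM procedure -/

/-- The edge probability `p̃` of the privatized graph. -/
def Model.pTilde {n : ℕ} (M : Model n) : ℝ :=
  (2 + (M.p : ℝ) * (Real.exp M.ε - 1)) / (Real.exp M.ε + 2)

/-- The flip probability `ζ̃` of the privatized graph. -/
def Model.zetaTilde {n : ℕ} (M : Model n) : ℝ :=
  (1 + (M.p : ℝ) * (M.ζ : ℝ) * (Real.exp M.ε - 1)) / (2 + (M.p : ℝ) * (Real.exp M.ε - 1))

/-- The detection statistic: `S_1 = 0` and
`S_t = (S_{t-1})⁺ + log (Pr(Ã_t; σ̂_{t-1}) / Pr(Ã_t; σ^pre))` for `t ≥ 2`,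
where `σ̂_{t-1}` is the estimate from `Ã_{t-1}`. -/
def Model.stat {n : ℕ} (M : Model n) (est : SignedGraph n → Labels n) (ω : SamplePath n) : ℕ → ℝ
  | 0 => 0
  | 1 => 0
  | t + 2 => max (M.stat est ω (t + 1)) 0 +
      Real.log (likelihood M.pTilde M.zetaTilde (est (ω (t + 1)).2) (ω (t + 2)).2 /
        likelihood M.pTilde M.zetaTilde M.pre (ω (t + 2)).2)

/-- The stopping rule `T_L = inf {t ≥ 1 : S_t ≥ b}`. -/
def Model.TL {n : ℕ} (M : Model n) (est : SignedGraph n → Labels n) (b : ℝ) (ω : SamplePath n) : ℕ∞ :=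
  ⨅ (t : ℕ) (_ : 1 ≤ t ∧ b ≤ M.stat est ω t), (t : ℕ∞)

/-- The information number `Ĩ₀` of the privatized observations. -/
def Model.infoTilde {n : ℕ} (M : Model n) : ℝ :=
  1 / 2 * Real.log ((1 - M.zetaTilde) / M.zetaTilde) * M.pTilde * (1 - 2 * M.zetaTilde) *
    ((n.choose 2 : ℝ) - ∑ e : Pair n,
      ((M.pre e.1.1 : ℤ) : ℝ) * ((M.pre e.1.2 : ℤ) : ℝ) *
        ((M.post e.1.1 : ℤ) : ℝ) * ((M.post e.1.2 : ℤ) : ℝ))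

/-- The Hamming distance between the pre- and post-change labels. -/
def Model.ham {n : ℕ} (M : Model n) : ℕ :=
  (Finset.univ.filter fun i => M.pre i ≠ M.post i).card

/-- The sufficient condition for exact recovery under graph perturbation (apart from the growth
of `ε`), where `a` is the scaling in `p = a log n / n`. -/
def Model.RecoveryCondition {n : ℕ} (M : Model n) (a : ℝ) : Prop :=
  (M.p : ℝ) = a * Real.log n / n ∧
  a > 2 * ((n : ℝ) ^ (3 / 2 : ℝ) - n) / (((n : ℝ) - 1) * Real.log n) ∧
  a * (√(1 - (M.ζ : ℝ)) - √(M.ζ : ℝ)) ^ 2 >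
    (√(n : ℝ) / (√(n : ℝ) - 1)) * ((Real.exp M.ε + 1) / (Real.exp M.ε - 1))

end

end PrivCBM

open PrivCBM

namespace PrivCBM

noncomputable section

/-! The quantity in control is `Model.snr`, that is (n-1)q²/p̃, where q = p̃(1-2ζ̃) is the mean of a
privatized edge in the direction of its label. The lower bound on `a` gives √n·p ≥ 1, and ε ≥ c log
n keeps the randomized-response noise small, so the ratio grows at least like a power of n
(`Model.le_snr`). The two label vectors disagree on at least n-1 edges, hence Ĩ₀ ≥ snr.

Recovery. If every label-weighted degree is at least half its mean and the noise matrix has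
quadratic form at most nq/8, a dual certificate forces the relaxation to return the rank-one matrix
of the labels. Degrees are handled by a Chernoff bound, the noise by a fixed high trace moment and
Markov's inequality. The failure probability is O(n·snr^(-2^j)) for each fixed j
(`Model.failProb_le`); a large j makes it o(n⁻²), which beats the crude bound n²Ĩ₀ on an increment
computed with a wrong estimate.

Upper bound on the delay. Before the alarm, the potential (b + L - S⁺)⁺ + K·1[estimate failed]
decreases in conditional mean by almost Ĩ₀ per step, where L = ηb truncates the increments
(`Model.lintegral_drift_step`, `Model.drift`). The history enters only through its independence of
the observations from ν on, so the bound holds for every past event and for both filtrations.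

False alarms. Without a change, a likelihood ratio with any label vector chosen from the past has
conditional mean one, so max(e^S, 1) grows in mean by at most one per step. This gives E_∞[T] ≥ e^b
and a probability at most m/e^b of an alarm by time m.

Lower bound on the delay. A rule with average run length at least γ has a window of length about
(1-d) log γ / Ĩ₀ in which it stops with conditional probability at most 2m/γ when there is no change
(`Model.exists_window`). Moving the change to the start of the window costs a factor at most
γ^(1-d/2), except on an event that is small by Chebyshev, since the log-likelihood ratio of one
graph has variance at most Ĩ₀². For T_L itself the window starting at time 1 suffices, so that bound
holds for any filtration. -/

/-! ### Expectations under finite product laws -/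

/-- The expectation of `f` under the product of the weights `w e` on a finite set. -/
def prodExp {ι α : Type*} [Fintype ι] [Fintype α] [DecidableEq ι] (w : ι → α → ℝ)
    (f : (ι → α) → ℝ) : ℝ :=
  ∑ A, (∏ e, w e (A e)) * f A

section ProdExp

variable {ι α : Type*} [Fintype ι] [Fintype α] [DecidableEq ι] {w : ι → α → ℝ}

lemma prodExp_prod (h : ι → α → ℝ) :
    prodExp w (fun A => ∏ e, h e (A e)) = ∏ e, ∑ x, w e x * h e x := by
  unfold prodExp
  rw [Fintype.prod_sum]
  exact Finset.sum_congr rfl fun A _ => Finset.prod_mul_distrib.symm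

lemma prodExp_sum {κ : Type*} (s : Finset κ) (f : κ → (ι → α) → ℝ) :
    prodExp w (fun A => ∑ k ∈ s, f k A) = ∑ k ∈ s, prodExp w (f k) := by
  unfold prodExp
  simp_rw [Finset.mul_sum]
  exact Finset.sum_comm

lemma prodExp_const_mul (c : ℝ) (f : (ι → α) → ℝ) :
    prodExp w (fun A => c * f A) = c * prodExp w f := by
  unfold prodExp
  rw [Finset.mul_sum]
  exact Finset.sum_congr rfl fun A _ => by ring

lemma prodExp_add (f g : (ι → α) → ℝ) :
    prodExp w (fun A => f A + g A) = prodExp w f + prodExp w g := by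
  unfold prodExp
  rw [← Finset.sum_add_distrib]
  exact Finset.sum_congr rfl fun A _ => by ring

lemma prodExp_sub (f g : (ι → α) → ℝ) :
    prodExp w (fun A => f A - g A) = prodExp w f - prodExp w g := by
  unfold prodExp
  rw [← Finset.sum_sub_distrib]
  exact Finset.sum_congr rfl fun A _ => by ring

lemma prodExp_mono (hw : ∀ e x, 0 ≤ w e x) {f g : (ι → α) → ℝ} (h : ∀ A, f A ≤ g A) :
    prodExp w f ≤ prodExp w g :=
  Finset.sum_le_sum fun A _ =>
    mul_le_mul_of_nonneg_left (h A) (Finset.prod_nonneg fun e _ => hw e _)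

lemma prodExp_nonneg (hw : ∀ e x, 0 ≤ w e x) {f : (ι → α) → ℝ} (h : ∀ A, 0 ≤ f A) :
    0 ≤ prodExp w f :=
  Finset.sum_nonneg fun A _ => mul_nonneg (Finset.prod_nonneg fun e _ => hw e _) (h A)

lemma prodExp_const (h1 : ∀ e, ∑ x, w e x = 1) (c : ℝ) : prodExp w (fun _ => c) = c := by
  have := prodExp_prod (w := w) (fun _ _ => (1 : ℝ))
  simp only [Finset.prod_const_one, mul_one, h1] at this
  have h2 := prodExp_const_mul (w := w) c (fun _ => 1)
  rw [this] at h2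
  simpa using h2

/-- Markov's inequality. -/
lemma mul_prodExp_indicator_le (hw : ∀ e x, 0 ≤ w e x) {f : (ι → α) → ℝ} (hf : ∀ A, 0 ≤ f A)
    {t : ℝ} {s : (ι → α) → Prop} [DecidablePred s] (hs : ∀ A, s A → t ≤ f A) :
    t * prodExp w (fun A => if s A then 1 else 0) ≤ prodExp w f := by
  rw [← prodExp_const_mul]
  refine prodExp_mono hw fun A => ?_
  by_cases h : s A
  · simpa [h] using hs A h
  · simpa [h] using hf A

lemma prodExp_monomial {κ : Type*} [Fintype κ] (g : ι → α → ℝ) (v : κ → ι) :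
    prodExp w (fun A => ∏ l, g (v l) (A (v l))) =
      ∏ e, ∑ x, w e x * g e x ^ (Finset.univ.filter fun l => v l = e).card := by
  rw [← prodExp_prod (fun e x => g e x ^ (Finset.univ.filter fun l => v l = e).card)]
  congr 1
  ext A
  rw [← Finset.prod_fiberwise (s := Finset.univ) (g := v)]
  refine Finset.prod_congr rfl fun e _ => ?_
  rw [Finset.prod_congr rfl (g := fun _ => g e (A e))]
  · simp
  · intro l hl
    rw [(Finset.mem_filter.1 hl).2]

/-- Mixed moments of independent centred variables bounded by `2` with variance at most `P`:
they vanish as soon as one variable occurs only once. -/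
lemma abs_prodExp_monomial_le (hw : ∀ e x, 0 ≤ w e x) (h1 : ∀ e, ∑ x, w e x = 1)
    {g : ι → α → ℝ} (hg : ∀ e x, |g e x| ≤ 2) (h0 : ∀ e, ∑ x, w e x * g e x = 0)
    {P : ℝ} (hP : ∀ e, ∑ x, w e x * g e x ^ 2 ≤ P) {κ : Type*} [Fintype κ] (v : κ → ι) :
    |prodExp w (fun A => ∏ l, g (v l) (A (v l)))| ≤
      if 2 * (Finset.univ.image v).card ≤ Fintype.card κ then
        2 ^ Fintype.card κ * P ^ (Finset.univ.image v).card else 0 := by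
  set m : ι → ℕ := fun e => (Finset.univ.filter fun l => v l = e).card with hm
  rw [prodExp_monomial, Finset.abs_prod]
  have hsum : ∑ e, m e = Fintype.card κ := by
    rw [hm, ← Finset.card_univ (α := κ)]
    exact (Finset.card_eq_sum_card_fiberwise (f := v) (fun _ _ => by simp)).symm
  have hmem : ∀ e, e ∈ Finset.univ.image v ↔ m e ≠ 0 := fun e => by
    simp [hm, Finset.filter_eq_empty_iff]
  -- A coordinate of multiplicity one contributes its mean, which is zero.
  by_cases hone : ∃ e, m e = 1
  · obtain ⟨e, he⟩ := hone
    have : ∏ e, |∑ x, w e x * g e x ^ m e| = 0 :=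
      Finset.prod_eq_zero (Finset.mem_univ e) (by rw [he]; simp [h0])
    rw [this]
    split_ifs with h
    · by_cases hP0 : 0 ≤ P
      · positivity
      · exact absurd ((Finset.sum_nonneg fun x _ => mul_nonneg (hw e x) (sq_nonneg _)).trans (hP e))
          hP0
    · exact le_rfl
  · push Not at hone
    have hbound : ∀ e, |∑ x, w e x * g e x ^ m e| ≤
        2 ^ m e * (if e ∈ Finset.univ.image v then P else 1) := fun e => by
      by_cases h : m e = 0
      · have : e ∉ Finset.univ.image v := fun h' => (hmem e).1 h' h
        simp [h, h1, this]
      · rw [if_pos ((hmem e).2 h)]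
        -- From multiplicity two on, a square is kept for the variance and each remaining factor is
        -- bounded by 2.
        have h2 : 2 ≤ m e := by have := hone e; omega
        have hPe : 0 ≤ P :=
          (Finset.sum_nonneg fun x _ => mul_nonneg (hw e x) (sq_nonneg _)).trans (hP e)
        calc |∑ x, w e x * g e x ^ m e| ≤ ∑ x, |w e x * g e x ^ m e| := Finset.abs_sum_le_sum_abs _ _
          _ ≤ ∑ x, 2 ^ (m e - 2) * (w e x * g e x ^ 2) := by
            refine Finset.sum_le_sum fun x _ => ?_
            rw [abs_mul, abs_of_nonneg (hw e x), abs_pow]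
            have : |g e x| ^ m e ≤ 2 ^ (m e - 2) * g e x ^ 2 := by
              rw [← sq_abs (g e x)]
              calc |g e x| ^ m e = |g e x| ^ (m e - 2) * |g e x| ^ 2 := by
                    rw [← pow_add]; congr 1; omega
                _ ≤ _ := by gcongr; exact hg e x
            calc w e x * |g e x| ^ m e ≤ w e x * (2 ^ (m e - 2) * g e x ^ 2) :=
                  mul_le_mul_of_nonneg_left this (hw e x)
              _ = _ := by ring
          _ = 2 ^ (m e - 2) * ∑ x, w e x * g e x ^ 2 := by rw [Finset.mul_sum]
          _ ≤ 2 ^ m e * P :=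
            mul_le_mul (pow_le_pow_right₀ (by norm_num) (Nat.sub_le _ _)) (hP e)
              (Finset.sum_nonneg fun x _ => mul_nonneg (hw e x) (sq_nonneg _)) (by positivity)
    -- Every index that occurs now occurs at least twice.
    have hcard : 2 * (Finset.univ.image v).card ≤ Fintype.card κ := by
      rw [← hsum, mul_comm, ← smul_eq_mul, ← Finset.sum_const]
      calc ∑ _e ∈ Finset.univ.image v, 2 ≤ ∑ e ∈ Finset.univ.image v, m e :=
            Finset.sum_le_sum fun e he => by
              have := (hmem e).1 he; have := hone e; omega
        _ ≤ ∑ e, m e := Finset.sum_le_univ_sum_of_nonneg fun _ => Nat.zero_le _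
    rw [if_pos hcard]
    calc ∏ e, |∑ x, w e x * g e x ^ m e| ≤
          ∏ e, (2 ^ m e * (if e ∈ Finset.univ.image v then P else 1)) :=
        Finset.prod_le_prod (fun _ _ => abs_nonneg _) fun e _ => hbound e
      _ = _ := by
        rw [Finset.prod_mul_distrib, Finset.prod_pow_eq_pow_sum, hsum, Finset.prod_ite_mem]
        simp

end ProdExp

/-! ### Walks and matrix powers -/

section Walks

/-- A walk traces a connected graph, which has at most one vertex more than it has edges. By
induction on the length: a last vertex not seen before comes with an edge not seen before. -/
lemma card_image_vertices_le {V : Type*} [DecidableEq V] {m : ℕ} (v : Fin (m + 1) → V) :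
    (Finset.univ.image v).card ≤
      (Finset.univ.image fun l : Fin m => s(v l.castSucc, v l.succ)).card + 1 := by
  induction m with
  | zero =>
    refine Finset.card_image_le.trans ?_
    simp
  | succ m ih =>
    have h1 : Finset.univ.image v =
        insert (v (Fin.last _)) (Finset.univ.image fun i : Fin (m + 1) => v i.castSucc) := by
      ext x
      simp only [Finset.mem_image, Finset.mem_univ, true_and, Finset.mem_insert]
      constructor
      · rintro ⟨i, rfl⟩
        refine Fin.lastCases ?_ (fun j => ?_) i
        · exact Or.inl rfl
        · exact Or.inr ⟨j, rfl⟩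
      · rintro (rfl | ⟨i, rfl⟩)
        exacts [⟨_, rfl⟩, ⟨_, rfl⟩]
    set E := Finset.univ.image fun l : Fin m => s(v l.castSucc.castSucc, v l.succ.castSucc) with hE
    have h2 : Finset.univ.image (fun l : Fin (m + 1) => s(v l.castSucc, v l.succ)) =
        insert s(v (Fin.last m).castSucc, v (Fin.last (m + 1))) E := by
      ext x
      simp only [Finset.mem_image, Finset.mem_univ, true_and, Finset.mem_insert, hE]
      constructor
      · rintro ⟨i, rfl⟩
        refine Fin.lastCases ?_ (fun j => ?_) i
        · exact Or.inl rfl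
        · exact Or.inr ⟨j, rfl⟩
      · rintro (rfl | ⟨i, rfl⟩)
        exacts [⟨Fin.last m, rfl⟩, ⟨i.castSucc, rfl⟩]
    have ih' : (Finset.univ.image fun i : Fin (m + 1) => v i.castSucc).card ≤ E.card + 1 :=
      ih (fun i => v i.castSucc)
    rw [h1, h2]
    by_cases hx : v (Fin.last _) ∈ Finset.univ.image fun i : Fin (m + 1) => v i.castSucc
    · rw [Finset.insert_eq_of_mem hx]
      exact ih'.trans (Nat.add_le_add_right (Finset.card_le_card (Finset.subset_insert _ _)) 1)
    -- An old edge would have the new vertex as an endpoint, and endpoints of old edges were already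
    -- visited.
    · have hnew : s(v (Fin.last m).castSucc, v (Fin.last (m + 1))) ∉ E := by
        intro h
        simp only [hE, Finset.mem_image, Finset.mem_univ, true_and] at h
        obtain ⟨l, hl⟩ := h
        have : v (Fin.last (m + 1)) ∈ s(v l.castSucc.castSucc, v l.succ.castSucc) := by
          rw [hl]; exact Sym2.mem_mk_right _ _
        rw [Sym2.mem_iff] at this
        apply hx
        rcases this with h | h <;> rw [h] <;> exact Finset.mem_image_of_mem _ (Finset.mem_univ _)
      rw [Finset.card_insert_of_notMem hx, Finset.card_insert_of_notMem hnew]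
      omega

variable {V : Type*} [Fintype V] [DecidableEq V]

/-- Prepending a letter either repeats one of at most m letters, leaving the weight unchanged, or
uses one of at most |V| new letters at the cost of a factor 1/|V|. The sum therefore grows by a
factor at most m + 1, and no walk shapes need to be enumerated. -/
lemma sum_inv_pow_card_image_le [Nonempty V] (m : ℕ) :
    ∑ v : Fin m → V, ((Fintype.card V : ℝ)⁻¹) ^ (Finset.univ.image v).card ≤ m.factorial := by
  set c : ℝ := (Fintype.card V : ℝ)⁻¹ with hc
  have hV : (0 : ℝ) < Fintype.card V := by exact_mod_cast Fintype.card_pos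
  have hc0 : 0 ≤ c := by positivity
  induction m with
  | zero => simp
  | succ m ih =>
    rw [← (Fin.consEquiv fun _ : Fin (m + 1) => V).sum_comp, Fintype.sum_prod_type_right]
    have himg : ∀ (x : V) (v : Fin m → V), Finset.univ.image
        ((Fin.consEquiv fun _ : Fin (m + 1) => V) (x, v)) = insert x (Finset.univ.image v) := by
      intro x v
      ext y
      simp only [Fin.consEquiv, Equiv.coe_fn_mk, Finset.mem_image, Finset.mem_univ, true_and,
        Finset.mem_insert, Fin.exists_fin_succ, Fin.cons_zero, Fin.cons_succ]
      constructor <;> (rintro (h | h) <;> simp_all)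
    simp_rw [himg]
    have key : ∀ v : Fin m → V, ∑ x, c ^ (insert x (Finset.univ.image v)).card ≤
        (m + 1) * c ^ (Finset.univ.image v).card := by
      intro v
      set S := Finset.univ.image v with hS
      have hSm : (S.card : ℝ) ≤ m := by
        have : S.card ≤ m := Finset.card_image_le.trans (by simp)
        exact_mod_cast this
      calc ∑ x, c ^ (insert x S).card ≤
            ∑ x, ((if x ∈ S then c ^ S.card else 0) + c * c ^ S.card) := by
              refine Finset.sum_le_sum fun x _ => ?_
              by_cases hx : x ∈ S
              · simp only [Finset.insert_eq_of_mem hx, hx, if_true]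
                have : 0 ≤ c * c ^ S.card := by positivity
                linarith
              · rw [Finset.card_insert_of_notMem hx]
                simp [hx, pow_succ, mul_comm]
        _ = S.card * c ^ S.card + (Fintype.card V * c) * c ^ S.card := by
              rw [Finset.sum_add_distrib, ← Finset.sum_filter]
              simp [mul_assoc]
        _ = (S.card + 1) * c ^ S.card := by rw [hc, mul_inv_cancel₀ hV.ne']; ring
        _ ≤ _ := by gcongr
    calc _ ≤ ∑ v : Fin m → V, (m + 1) * c ^ (Finset.univ.image v).card :=
          Finset.sum_le_sum fun v _ => key v
      _ ≤ (m + 1) * m.factorial := by rw [← Finset.mul_sum]; gcongr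
      _ = _ := by rw [Nat.factorial_succ]; push_cast; ring

/-- The end-point conditions are indicator weights rather than a restricted index set, so that
expectations pass through a sum over all vertex sequences. -/
lemma matrix_pow_apply_eq_sum_walks (W : Matrix V V ℝ) (m : ℕ) (i j : V) :
    (W ^ m) i j = ∑ v : Fin (m + 1) → V,
      (if v 0 = i ∧ v (Fin.last m) = j then (1 : ℝ) else 0) *
        ∏ l : Fin m, W (v l.castSucc) (v l.succ) := by
  induction m generalizing i with
  | zero =>
    rw [← (Equiv.funUnique (Fin 1) V).symm.sum_comp]
    simp only [pow_zero, Matrix.one_apply, Equiv.funUnique_symm_apply, uniqueElim_const,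
      Finset.univ_eq_empty, Finset.prod_empty, mul_one]
    by_cases h : i = j
    · subst h; simp
    · rw [if_neg h, Finset.sum_eq_zero]
      intro x _
      rw [if_neg]
      rintro ⟨rfl, rfl⟩
      exact h rfl
  | succ m ih =>
    rw [pow_succ', Matrix.mul_apply, ← (Fin.consEquiv fun _ : Fin (m + 2) => V).sum_comp,
      Fintype.sum_prod_type]
    have hprod : ∀ (x : V) (v : Fin (m + 1) → V), ∏ l : Fin (m + 1),
        W ((Fin.cons x v : Fin (m + 2) → V) l.castSucc) ((Fin.cons x v : Fin (m + 2) → V) l.succ) =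
        W x (v 0) * ∏ l : Fin m, W (v l.castSucc) (v l.succ) := by
      intro x v
      rw [Fin.prod_univ_succ]
      congr 1
    have hlast : ∀ (x : V) (v : Fin (m + 1) → V),
        (Fin.cons x v : Fin (m + 2) → V) (Fin.last (m + 1)) = v (Fin.last m) := fun x v => rfl
    simp only [Fin.consEquiv, Equiv.coe_fn_mk]
    simp_rw [hprod, hlast, Fin.cons_zero]
    symm
    rw [Finset.sum_eq_single i]
    · simp_rw [ih, Finset.mul_sum]
      symm
      rw [Finset.sum_comm]
      refine Finset.sum_congr rfl fun v _ => ?_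
      rw [Finset.sum_eq_single (v 0)]
      · by_cases h : v (Fin.last m) = j <;> simp [h]
      · intro b _ hb
        simp [hb.symm]
      · simp
    · intro b _ hb
      simp [hb]
    · simp

lemma trace_pow_eq_sum_walks (W : Matrix V V ℝ) (m : ℕ) :
    (W ^ m).trace = ∑ v : Fin (m + 1) → V,
      (if v (Fin.last m) = v 0 then (1 : ℝ) else 0) *
        ∏ l : Fin m, W (v l.castSucc) (v l.succ) := by
  unfold Matrix.trace
  simp only [Matrix.diag_apply, matrix_pow_apply_eq_sum_walks]
  rw [Finset.sum_comm]
  refine Finset.sum_congr rfl fun v _ => ?_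
  rw [← Finset.sum_mul, Finset.sum_eq_single (v 0)]
  · simp
  · intro b _ hb
    rw [if_neg]
    rintro ⟨h, -⟩
    exact hb h.symm
  · simp

open Matrix in
/-- The quadratic form of a symmetric matrix is controlled by the trace of a high power. -/
lemma quadForm_le_of_trace_pow_le {W : Matrix V V ℝ} (hW : W.IsSymm) {j : ℕ} {t : ℝ}
    (ht : 0 ≤ t) (h : (W ^ 2 ^ (j + 1)).trace ≤ t ^ 2 ^ (j + 1)) (x : V → ℝ) :
    x ⬝ᵥ (W *ᵥ x) ≤ t * (x ⬝ᵥ x) := by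
  have hsymm : ∀ m, (W ^ m)ᵀ = W ^ m := fun m => by rw [Matrix.transpose_pow, hW.eq]
  have hxx : 0 ≤ x ⬝ᵥ x := Finset.sum_nonneg fun i _ => mul_self_nonneg _
  have hdouble : ∀ m, x ⬝ᵥ ((W ^ (m + m)) *ᵥ x) = ((W ^ m) *ᵥ x) ⬝ᵥ ((W ^ m) *ᵥ x) := fun m => by
    rw [pow_add, ← Matrix.mulVec_mulVec, Matrix.dotProduct_mulVec, ← Matrix.mulVec_transpose, hsymm]
  have hcs : ∀ y z : V → ℝ, (y ⬝ᵥ z) ^ 2 ≤ (y ⬝ᵥ y) * (z ⬝ᵥ z) := fun y z => by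
    simpa [dotProduct, sq] using Finset.sum_mul_sq_le_sq_mul_sq Finset.univ y z
  have hstep : ∀ m, (x ⬝ᵥ ((W ^ m) *ᵥ x)) ^ 2 ≤ (x ⬝ᵥ x) * (x ⬝ᵥ ((W ^ (m + m)) *ᵥ x)) := fun m => by
    rw [hdouble]; exact hcs _ _
  -- Iterated Cauchy–Schwarz doubles the power of `W` each time, which replaces the spectral theorem
  -- and is why the exponents are powers of two.
  have hind : ∀ i, (x ⬝ᵥ (W *ᵥ x)) ^ 2 ^ i ≤
      (x ⬝ᵥ x) ^ (2 ^ i - 1) * (x ⬝ᵥ ((W ^ 2 ^ i) *ᵥ x)) := by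
    intro i
    induction i with
    | zero => simp
    | succ i ih =>
      -- For i = 0 the quantity being squared may be negative, so squaring the inequality is not
      -- allowed; from i = 1 on the exponent is even.
      rcases Nat.eq_zero_or_pos i with rfl | hi
      · simpa using hstep 1
      have h0 : (0 : ℝ) ≤ (x ⬝ᵥ (W *ᵥ x)) ^ 2 ^ i :=
        (Nat.even_pow.2 ⟨even_two, hi.ne'⟩).pow_nonneg _
      calc (x ⬝ᵥ (W *ᵥ x)) ^ 2 ^ (i + 1) = ((x ⬝ᵥ (W *ᵥ x)) ^ 2 ^ i) ^ 2 := by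
            rw [← pow_mul, pow_succ]
        _ ≤ ((x ⬝ᵥ x) ^ (2 ^ i - 1) * (x ⬝ᵥ ((W ^ 2 ^ i) *ᵥ x))) ^ 2 := by gcongr
        _ = ((x ⬝ᵥ x) ^ (2 ^ i - 1)) ^ 2 * (x ⬝ᵥ ((W ^ 2 ^ i) *ᵥ x)) ^ 2 := by ring
        _ ≤ ((x ⬝ᵥ x) ^ (2 ^ i - 1)) ^ 2 *
            ((x ⬝ᵥ x) * (x ⬝ᵥ ((W ^ (2 ^ i + 2 ^ i)) *ᵥ x))) := by gcongr; exact hstep _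
        _ = _ := by
            have e1 : 2 ^ i + 2 ^ i = 2 ^ (i + 1) := by ring
            have e2 : 2 ^ (i + 1) - 1 = (2 ^ i - 1) * 2 + 1 := by
              have := Nat.one_le_two_pow (n := i); omega
            rw [e1, e2, pow_succ _ ((2 ^ i - 1) * 2), pow_mul]; ring
  -- The form is |W^m x|², and the trace is the squared Frobenius norm of W^m.
  have hfrob : ∀ m, x ⬝ᵥ ((W ^ (m + m)) *ᵥ x) ≤ (W ^ (m + m)).trace * (x ⬝ᵥ x) := by
    intro m
    rw [hdouble]
    have htr : (W ^ (m + m)).trace = ∑ i, (W ^ m) i ⬝ᵥ (W ^ m) i := by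
      rw [pow_add]
      nth_rewrite 2 [← hsymm m]
      rfl
    rw [htr, Finset.sum_mul]
    refine Finset.sum_le_sum fun i _ => ?_
    have := hcs ((W ^ m) i) x
    calc _ = ((W ^ m) i ⬝ᵥ x) ^ 2 := by rw [sq]; rfl
      _ ≤ _ := this
  have hfin : (x ⬝ᵥ (W *ᵥ x)) ^ 2 ^ (j + 1) ≤ (t * (x ⬝ᵥ x)) ^ 2 ^ (j + 1) := by
    have e1 : 2 ^ (j + 1) = 2 ^ j + 2 ^ j := by ring
    have h2 := hfrob (2 ^ j)
    rw [← e1] at h2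
    calc _ ≤ _ := hind (j + 1)
      _ ≤ (x ⬝ᵥ x) ^ (2 ^ (j + 1) - 1) * (t ^ 2 ^ (j + 1) * (x ⬝ᵥ x)) := by
        gcongr
        exact h2.trans (by gcongr)
      _ = t ^ 2 ^ (j + 1) * (x ⬝ᵥ x) ^ (2 ^ (j + 1) - 1 + 1) := by ring
      _ = _ := by
        rw [Nat.sub_add_cancel Nat.one_le_two_pow, mul_pow]
  have ht2 : 0 ≤ t * (x ⬝ᵥ x) := mul_nonneg ht hxx
  exact le_of_pow_le_pow_left₀ (by positivity) ht2 hfin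

end Walks


/-! ### Symmetric matrices indexed by pairs -/

/-- The unordered pair of two distinct vertices. -/
def mkPair {n : ℕ} (i j : Fin n) (h : i ≠ j) : Pair n :=
  if hlt : i < j then ⟨(i, j), hlt⟩ else ⟨(j, i), lt_of_le_of_ne (not_lt.1 hlt) h.symm⟩

/-- The symmetric matrix with zero diagonal and off-diagonal entries `f`. -/
def symMat {n : ℕ} (f : Pair n → ℝ) : Matrix (Fin n) (Fin n) ℝ := fun i j =>
  if h : i ≠ j then f (mkPair i j h) else 0

lemma mkPair_comm {n : ℕ} {i j : Fin n} (h : i ≠ j) : mkPair i j h = mkPair j i h.symm := by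
  unfold mkPair
  rcases lt_or_gt_of_ne h with h' | h' <;> simp [h', h'.not_gt]

lemma sym2_mkPair {n : ℕ} {i j : Fin n} (h : i ≠ j) :
    s((mkPair i j h).1.1, (mkPair i j h).1.2) = s(i, j) := by
  unfold mkPair
  split_ifs
  · rfl
  · exact Sym2.eq_swap

lemma symMat_isSymm {n : ℕ} (f : Pair n → ℝ) : (symMat f).IsSymm := by
  ext i j
  simp only [Matrix.transpose_apply, symMat]
  by_cases h : i = j
  · simp [h]
  · rw [dif_pos (show j ≠ i from fun h' => h h'.symm), dif_pos h, mkPair_comm]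

lemma adjacency_eq_symMat {n : ℕ} (A : SignedGraph n) :
    adjacency A = symMat fun e => ((A e : SignType) : ℝ) := by
  ext i j
  unfold adjacency symMat mkPair
  rcases lt_trichotomy i j with h | rfl | h
  · simp [h, h.ne]
  · simp
  · simp [h, h.ne', h.not_gt]

/-- The `2k`-th trace moment of a random symmetric matrix with independent centred entries. -/
lemma prodExp_trace_pow_le {n : ℕ} {α : Type*} [Fintype α] {w : Pair n → α → ℝ}
    (hw : ∀ e x, 0 ≤ w e x) (h1 : ∀ e, ∑ x, w e x = 1)
    {g : Pair n → α → ℝ} (hg : ∀ e x, |g e x| ≤ 2) (h0 : ∀ e, ∑ x, w e x * g e x = 0)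
    {P : ℝ} (hP : ∀ e, ∑ x, w e x * g e x ^ 2 ≤ P) (hnP : 1 ≤ n * P) (k : ℕ) :
    prodExp w (fun A => (symMat (fun e => g e (A e)) ^ (2 * k)).trace) ≤
      4 ^ k * (2 * k + 1).factorial * n * (n * P) ^ k := by
  have hn : 0 < n := by
    rcases Nat.eq_zero_or_pos n with rfl | h
    · norm_num at hnP
    · exact h
  have hn' : (0 : ℝ) < n := by exact_mod_cast hn
  have : Nonempty (Fin n) := ⟨⟨0, hn⟩⟩
  simp_rw [trace_pow_eq_sum_walks]
  rw [prodExp_sum]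
  simp_rw [prodExp_const_mul]
  have hP0 : 0 < P := by
    by_contra h
    nlinarith
  -- A walk contributes only if each of its d edges is used at least twice, so d ≤ k, and it visits
  -- at most d + 1 vertices. Writing P^d as (nP)^d n^(-d) and using nP ≥ 1 gives a bound that
  -- depends on the walk only through its number of vertices.
  have key : ∀ v : Fin (2 * k + 1) → Fin n,
      (if v (Fin.last (2 * k)) = v 0 then (1 : ℝ) else 0) *
        prodExp w (fun A => ∏ l : Fin (2 * k),
          symMat (fun e => g e (A e)) (v l.castSucc) (v l.succ)) ≤
      4 ^ k * (n * P) ^ k * n * ((n : ℝ)⁻¹) ^ (Finset.univ.image v).card := by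
    intro v
    have hR : 0 ≤ 4 ^ k * (n * P) ^ k * n * ((n : ℝ)⁻¹) ^ (Finset.univ.image v).card := by
      positivity
    have habs : |prodExp w (fun A => ∏ l : Fin (2 * k),
          symMat (fun e => g e (A e)) (v l.castSucc) (v l.succ))| ≤
        4 ^ k * (n * P) ^ k * n * ((n : ℝ)⁻¹) ^ (Finset.univ.image v).card := by
      by_cases hv : ∀ l : Fin (2 * k), v l.castSucc ≠ v l.succ
      · have hprod : (fun A : Pair n → α => ∏ l : Fin (2 * k),
            symMat (fun e => g e (A e)) (v l.castSucc) (v l.succ)) =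
            fun A => ∏ l, g (mkPair _ _ (hv l)) (A (mkPair _ _ (hv l))) := by
          ext A
          refine Finset.prod_congr rfl fun l _ => ?_
          rw [symMat, dif_pos (hv l)]
        rw [hprod]
        refine (abs_prodExp_monomial_le hw h1 hg h0 hP fun l => mkPair _ _ (hv l)).trans ?_
        split_ifs with hcard
        swap
        · exact hR
        set d := (Finset.univ.image fun l => mkPair _ _ (hv l)).card with hd
        rw [Fintype.card_fin] at hcard ⊢
        have hdk : d ≤ k := by omega
        have himg : (Finset.univ.image v).card ≤ d + 1 := by
          refine (card_image_vertices_le v).trans (Nat.add_le_add_right ?_ 1)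
          have : (Finset.univ.image fun l : Fin (2 * k) => s(v l.castSucc, v l.succ)) =
              (Finset.univ.image fun l => mkPair _ _ (hv l)).image
                fun e : Pair n => s(e.1.1, e.1.2) := by
            rw [Finset.image_image]
            refine Finset.image_congr fun l _ => ?_
            exact (sym2_mkPair (hv l)).symm
          rw [this]
          exact Finset.card_image_le
        have h4 : (2 : ℝ) ^ (2 * k) = 4 ^ k := by rw [pow_mul]; norm_num
        have hinv1 : (n : ℝ)⁻¹ ≤ 1 := inv_le_one_of_one_le₀ (by exact_mod_cast hn)
        have hPd : P ^ d = (n * P) ^ d * ((n : ℝ)⁻¹) ^ d := by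
          rw [← mul_pow]; congr 1; field_simp
        have hnn : ((n : ℝ)⁻¹) ^ d = n * ((n : ℝ)⁻¹) ^ (d + 1) := by
          rw [pow_succ]; field_simp
        rw [h4, hPd, hnn]
        calc 4 ^ k * ((n * P) ^ d * (n * (n : ℝ)⁻¹ ^ (d + 1))) ≤
            4 ^ k * ((n * P) ^ k * (n * (n : ℝ)⁻¹ ^ (Finset.univ.image v).card)) := by
              refine mul_le_mul_of_nonneg_left ?_ (by positivity)
              refine mul_le_mul (pow_le_pow_right₀ hnP hdk) ?_ (by positivity) (by positivity)
              refine mul_le_mul_of_nonneg_left ?_ (by positivity)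
              exact pow_le_pow_of_le_one (by positivity) hinv1 himg
          _ = _ := by ring
      · push Not at hv
        obtain ⟨l, hl⟩ := hv
        have hprod : (fun A : Pair n → α => ∏ l : Fin (2 * k),
            symMat (fun e => g e (A e)) (v l.castSucc) (v l.succ)) = fun _ => 0 := by
          ext A
          refine Finset.prod_eq_zero (Finset.mem_univ l) ?_
          rw [symMat, dif_neg (by simp [hl])]
        rw [hprod, prodExp_const h1, abs_zero]
        exact hR
    -- That the walk is closed can be forgotten: the multiplicity constraint already gives the right
    -- power of n.
    split_ifs
    · rw [one_mul]; exact (le_abs_self _).trans habs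
    · rw [zero_mul]; exact hR
  calc _ ≤ ∑ v : Fin (2 * k + 1) → Fin n,
        4 ^ k * (n * P) ^ k * n * ((n : ℝ)⁻¹) ^ (Finset.univ.image v).card :=
        Finset.sum_le_sum fun v _ => key v
    _ ≤ 4 ^ k * (n * P) ^ k * n * (2 * k + 1).factorial := by
        rw [← Finset.mul_sum]
        refine mul_le_mul_of_nonneg_left ?_ (by positivity)
        simpa using sum_inv_pow_card_image_le (V := Fin n) (2 * k + 1)
    _ = _ := by ring

/-! ### Tightness of the semidefinite relaxation -/

/-- A label as a real number. -/
abbrev sgn {n : ℕ} (σ : Labels n) (i : Fin n) : ℝ := ((σ i : ℤ) : ℝ)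

lemma sgn_mul_self {n : ℕ} (σ : Labels n) (i : Fin n) : sgn σ i * sgn σ i = 1 := by
  unfold sgn
  rcases Int.units_eq_one_or (σ i) with h | h <;> simp [h]

open Matrix in
/-- If the label-weighted degrees dominate the noise, then the semidefinite relaxation has the
rank-one matrix of the labels as its only solution. -/
lemma IsSDPSolution.eq_of_degree_of_quadForm {n : ℕ} {σ : Labels n}
    {B W Y : Matrix (Fin n) (Fin n) ℝ} (hB : B.IsSymm) {q d₀ w : ℝ}
    (hBW : ∀ i j, B i j = q * (sgn σ i * sgn σ j - if i = j then 1 else 0) + W i j)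
    (hd : ∀ i, d₀ ≤ sgn σ i * (B *ᵥ sgn σ) i)
    (hW : ∀ x : Fin n → ℝ, x ⬝ᵥ (W *ᵥ x) ≤ w * (x ⬝ᵥ x))
    (hpos : 0 < d₀ + q - w) (hY : IsSDPSolution B Y) (i j : Fin n) :
    Y i j = sgn σ i * sgn σ j := by
  have hn : (0 : ℝ) < n := by exact_mod_cast (Nat.zero_le _).trans_lt i.2
  set s : Fin n → ℝ := sgn σ with hs
  have hss : ∀ i, s i * s i = 1 := sgn_mul_self σ
  have hsn : s ⬝ᵥ s = n := by simp [dotProduct, hss]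
  -- Dual certificate: `d` is the only diagonal for which `diagonal d - B` annihilates the label
  -- vector.
  set d : Fin n → ℝ := fun i => s i * (B *ᵥ s) i with hd_def
  set L : Matrix (Fin n) (Fin n) ℝ := diagonal d - B with hL
  have hLs : L *ᵥ s = 0 := by
    ext i
    simp only [hL, sub_mulVec, Pi.sub_apply, mulVec_diagonal, hd_def, Pi.zero_apply]
    linear_combination (B *ᵥ s) i * hss i
  have hLsymm : Lᵀ = L := by simp [hL, hB.eq]
  have hsL : ∀ y, s ⬝ᵥ (L *ᵥ y) = 0 := fun y => by
    rw [dotProduct_mulVec, ← mulVec_transpose, hLsymm, hLs, zero_dotProduct]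
  -- The certificate is positive on the orthogonal complement of `s`; the bracket is the squared
  -- length of the projection `y` of `x` onto it.
  have hform : ∀ x : Fin n → ℝ, (d₀ + q - w) * (x ⬝ᵥ x - (s ⬝ᵥ x) ^ 2 / n) ≤ x ⬝ᵥ (L *ᵥ x) := by
    intro x
    set a : ℝ := (s ⬝ᵥ x) / n with ha
    obtain ⟨y, hy⟩ : ∃ y, y = x - a • s := ⟨_, rfl⟩
    have hsy : s ⬝ᵥ y = 0 := by
      rw [hy, dotProduct_sub, dotProduct_smul, hsn, ha, smul_eq_mul]; field_simp; ring
    have hxy : x = y + a • s := by simp [hy]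
    have hxx : x ⬝ᵥ x - (s ⬝ᵥ x) ^ 2 / n = y ⬝ᵥ y := by
      have h1 : s ⬝ᵥ x = a * n := by rw [ha]; field_simp
      rw [h1]
      conv_lhs => rw [hxy]
      rw [dotProduct_add, add_dotProduct, add_dotProduct, dotProduct_smul, smul_dotProduct,
        smul_dotProduct, dotProduct_smul, dotProduct_comm y s, hsy, hsn]
      simp only [smul_eq_mul]
      field_simp
      ring
    have hLx : x ⬝ᵥ (L *ᵥ x) = y ⬝ᵥ (L *ᵥ y) := by
      rw [hxy, mulVec_add, mulVec_smul, hLs, smul_zero, add_zero, add_dotProduct,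
        smul_dotProduct, hsL, smul_zero, add_zero]
    -- Orthogonally to `s` the rank-one mean disappears, and its removed diagonal acts as -q, in
    -- favour of the certificate.
    have hBy : B *ᵥ y = W *ᵥ y - q • y := by
      ext i
      simp only [mulVec, dotProduct, Pi.sub_apply, Pi.smul_apply, smul_eq_mul]
      have hsy' : ∑ j, s j * y j = 0 := hsy
      calc ∑ j, B i j * y j = ∑ j, (q * s i * (s j * y j) - q * (if i = j then y j else 0) +
            W i j * y j) := by
            refine Finset.sum_congr rfl fun j _ => ?_
            rw [hBW]; split_ifs <;> ring
        _ = _ := by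
            rw [Finset.sum_add_distrib, Finset.sum_sub_distrib, ← Finset.mul_sum,
              ← Finset.mul_sum, hsy']
            simp
            ring
    have hdy : d₀ * (y ⬝ᵥ y) ≤ y ⬝ᵥ (diagonal d *ᵥ y) := by
      simp only [dotProduct, mulVec_diagonal, Finset.mul_sum]
      refine Finset.sum_le_sum fun i _ => ?_
      have := mul_le_mul_of_nonneg_right (hd i) (mul_self_nonneg (y i))
      calc _ ≤ _ := this
        _ = _ := by simp only [hd_def]; ring
    rw [hxx, hLx, hL, sub_mulVec, dotProduct_sub, hBy, dotProduct_sub, dotProduct_smul, smul_eq_mul]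
    have := hW y
    linarith
  obtain ⟨hYp, hYd, hYopt⟩ := hY
  -- A Gram factorization reduces statements on the trace against `Y` to quadratic forms in the rows
  -- of `C`.
  obtain ⟨C, hC⟩ : ∃ C : Matrix (Fin n) (Fin n) ℝ, Y = star C * C := by
    open scoped MatrixOrder in
    exact CStarAlgebra.nonneg_iff_eq_star_mul_self.1 hYp.nonneg
  have hYij : ∀ i j, Y i j = ∑ r, C r i * C r j := fun i j => by
    rw [hC, Matrix.mul_apply]; simp [Matrix.star_apply]
  set Z : Matrix (Fin n) (Fin n) ℝ := vecMulVec s s with hZ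
  have hZp : Z.PosSemidef := by
    have := Matrix.posSemidef_vecMulVec_self_star s
    simpa [hZ] using this
  have hZd : ∀ i, Z i i = 1 := fun i => hss i
  -- The labels are feasible with objective Σ d i, so optimality of `Y` says tr(LY) ≤ 0.
  have hopt := hYopt Z hZp hZd
  have htrZ : (B * Z).trace = ∑ i, d i := by
    rw [Matrix.trace]
    refine Finset.sum_congr rfl fun i _ => ?_
    rw [diag_apply, Matrix.mul_apply]
    simp only [hZ, vecMulVec_apply, hd_def, mulVec, dotProduct, Finset.mul_sum]
    exact Finset.sum_congr rfl fun j _ => by ring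
  have htrY : (B * Y).trace = ∑ i, d i - (L * Y).trace := by
    rw [hL, sub_mul, trace_sub]
    have : (diagonal d * Y).trace = ∑ i, d i := by
      simp [Matrix.trace, diagonal_mul, hYd]
    rw [this]; ring
  have htrL : (L * Y).trace = ∑ r, C r ⬝ᵥ (L *ᵥ C r) := by
    have hYC : Y = Cᵀ * C := by
      ext i j
      rw [hYij, Matrix.mul_apply]
      rfl
    rw [hYC, ← Matrix.mul_assoc, Matrix.trace_mul_comm, Matrix.trace]
    refine Finset.sum_congr rfl fun r _ => ?_
    rw [diag_apply, Matrix.mul_apply]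
    refine Finset.sum_congr rfl fun i _ => ?_
    rw [Matrix.mul_apply]
    rfl
  have htrL0 : (L * Y).trace ≤ 0 := by linarith
  have hsC : ∑ r, (s ⬝ᵥ C r) ^ 2 = ∑ i, ∑ j, s i * s j * Y i j := by
    have hsq : ∀ r, (s ⬝ᵥ C r) ^ 2 = ∑ i, ∑ j, (s i * C r i) * (s j * C r j) := fun r => by
      rw [sq]; exact Finset.sum_mul_sum _ _ _ _
    simp_rw [hsq, hYij, Finset.mul_sum]
    rw [Finset.sum_comm]
    refine Finset.sum_congr rfl fun i _ => ?_
    rw [Finset.sum_comm]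
    exact Finset.sum_congr rfl fun j _ => Finset.sum_congr rfl fun r _ => by ring
  have hCC : ∑ r, C r ⬝ᵥ C r = n := by
    simp only [dotProduct]
    rw [Finset.sum_comm]
    simp [← hYij, hYd]
  -- Strict positivity off `s` confines the rows of `C` to the line of `s`.
  have hsum : ∑ i, ∑ j, (1 - s i * s j * Y i j) ≤ 0 := by
    have h1 : (d₀ + q - w) * ∑ r, (C r ⬝ᵥ C r - (s ⬝ᵥ C r) ^ 2 / n) ≤ 0 := by
      rw [Finset.mul_sum]
      exact (Finset.sum_le_sum fun r _ => hform (C r)).trans (htrL ▸ htrL0)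
    rw [Finset.sum_sub_distrib, hCC, ← Finset.sum_div, hsC] at h1
    have h2 : (n : ℝ) - (∑ i, ∑ j, s i * s j * Y i j) / n ≤ 0 := by
      by_contra h
      push Not at h
      exact absurd h1 (not_le.2 (mul_pos hpos h))
    simp only [Finset.sum_sub_distrib, Finset.sum_const, Finset.card_univ, Fintype.card_fin,
      nsmul_eq_mul, mul_one]
    have h3 : (n : ℝ) ≤ (∑ i, ∑ j, s i * s j * Y i j) / n := by linarith
    rw [le_div_iff₀ hn] at h3
    linarith
  -- Each term is half a squared distance of sign-adjusted columns of `C`, so a nonpositive total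
  -- makes all of them vanish.
  have hterm : ∀ i j, 0 ≤ 1 - s i * s j * Y i j := by
    intro i j
    have h : 1 - s i * s j * Y i j = 1 / 2 * ∑ r, (s i * C r i - s j * C r j) ^ 2 := by
      have e1 : ∑ r, (s i * C r i - s j * C r j) ^ 2 =
          s i * s i * Y i i + s j * s j * Y j j - 2 * (s i * s j * Y i j) := by
        simp only [hYij, Finset.mul_sum]
        rw [← Finset.sum_add_distrib, ← Finset.sum_sub_distrib]
        exact Finset.sum_congr rfl fun r _ => by ring
      rw [e1, hss, hss, hYd, hYd]; ring
    rw [h]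
    exact mul_nonneg (by norm_num) (Finset.sum_nonneg fun r _ => sq_nonneg _)
  have hz : 1 - s i * s j * Y i j = 0 := by
    refine le_antisymm ?_ (hterm i j)
    calc 1 - s i * s j * Y i j ≤ ∑ j, (1 - s i * s j * Y i j) :=
          Finset.single_le_sum (f := fun j => 1 - s i * s j * Y i j)
            (fun j _ => hterm i j) (Finset.mem_univ j)
      _ ≤ ∑ i, ∑ j, (1 - s i * s j * Y i j) :=
          Finset.single_le_sum (f := fun i => ∑ j, (1 - s i * s j * Y i j))
            (fun i _ => Finset.sum_nonneg fun j _ => hterm i j) (Finset.mem_univ i)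
      _ ≤ 0 := hsum
  linear_combination (-(s i * s j)) * hz - Y i j * hss i - s i * s i * Y i j * hss j


/-! ### Edge probabilities and likelihoods -/

lemma agree_eq_one_or {n : ℕ} (σ : Labels n) (e : Pair n) : agree σ e = 1 ∨ agree σ e = -1 := by
  unfold agree; split_ifs <;> simp

lemma agree_neg {n : ℕ} (σ : Labels n) : agree (-σ) = agree σ := by
  ext e
  simp [agree]

/-- The law sees labels only through products of pairs, which makes the global sign left open by the
estimator harmless. -/
lemma likelihood_neg {n : ℕ} (p ζ : ℝ) (σ : Labels n) : likelihood p ζ (-σ) = likelihood p ζ σ := by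
  ext A
  simp [likelihood, agree_neg]

lemma agree_coe {n : ℕ} (σ : Labels n) (e : Pair n) :
    ((agree σ e : SignType) : ℝ) = sgn σ e.1.1 * sgn σ e.1.2 := by
  unfold agree sgn
  rcases Int.units_eq_one_or (σ e.1.1) with h | h <;>
    rcases Int.units_eq_one_or (σ e.1.2) with h' | h' <;> simp [h, h']

lemma signType_one_ne_neg_one : (1 : SignType) ≠ -1 := by decide

lemma sum_edgeProb_mul {p ζ : ℝ} {s : SignType} (hs : s = 1 ∨ s = -1) (f : SignType → ℝ) :
    ∑ x, edgeProb p ζ s x * f x =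
      (1 - p) * f 0 + p * (1 - ζ) * f s + p * ζ * f (-s) := by
  rw [sum_signType]
  rcases hs with rfl | rfl
  · simp [edgeProb, signType_one_ne_neg_one.symm]; ring
  · simp [edgeProb]

lemma edgeProb_pos {p ζ : ℝ} (hp : 0 < p) (hp1 : p < 1) (hz : 0 < ζ) (hz1 : ζ < 1)
    (s x : SignType) : 0 < edgeProb p ζ s x := by
  have h1 : 0 < 1 - p := by linarith
  have h2 : 0 < p * (1 - ζ) := mul_pos hp (by linarith)
  have h3 : 0 < p * ζ := mul_pos hp hz
  unfold edgeProb
  split_ifs <;> assumption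

section Tilde

variable {n : ℕ} (M : Model n)

lemma Model.tilde_den_pos : 0 < 2 + (M.p : ℝ) * (Real.exp M.ε - 1) := by
  nlinarith [M.p.2.1, M.p.2.2, mul_nonneg M.p.2.1 (Real.exp_pos M.ε).le]

/-- Randomized response reports each value with positive probability for every real ε. The
privatized parameters are thus interior even if p or ζ is 0 or 1, and all likelihoods are positive.
-/
lemma Model.pTilde_pos : 0 < M.pTilde :=
  div_pos M.tilde_den_pos (by positivity)

lemma Model.pTilde_lt_one : M.pTilde < 1 := by
  have hE := Real.exp_pos M.ε
  unfold Model.pTilde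
  rw [div_lt_one (by positivity)]
  rcases M.p.2.1.eq_or_lt with h | h
  · rw [← h]; linarith
  · nlinarith [mul_nonneg (sub_nonneg.2 M.p.2.2) hE.le]

lemma Model.zetaTilde_pos : 0 < M.zetaTilde := by
  have hE := Real.exp_pos M.ε
  refine div_pos ?_ M.tilde_den_pos
  have h1 : (M.p : ℝ) * M.ζ ≤ 1 := mul_le_one₀ M.p.2.2 M.ζ.2.1 M.ζ.2.2
  have h0 : 0 ≤ (M.p : ℝ) * M.ζ := mul_nonneg M.p.2.1 M.ζ.2.1
  rcases h0.eq_or_lt with h | h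
  · rw [← h]; norm_num
  · nlinarith [mul_pos h hE]

lemma Model.zetaTilde_lt_one : M.zetaTilde < 1 := by
  have hE := Real.exp_pos M.ε
  unfold Model.zetaTilde
  rw [div_lt_one M.tilde_den_pos]
  have h1 : (M.p : ℝ) * (1 - M.ζ) ≤ 1 :=
    mul_le_one₀ M.p.2.2 (sub_nonneg.2 M.ζ.2.2) (by linarith [M.ζ.2.1])
  have h0 : 0 ≤ (M.p : ℝ) * (1 - M.ζ) := mul_nonneg M.p.2.1 (sub_nonneg.2 M.ζ.2.2)
  rcases h0.eq_or_lt with h | h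
  · nlinarith
  · nlinarith [mul_pos h hE]

/-- The distribution of one privatized edge. -/
lemma Model.sum_edgeProb_mul_rrProb {s : SignType} (hs : s = 1 ∨ s = -1) (y : SignType) :
    ∑ x, edgeProb M.p M.ζ s x * rrProb M.ε x y = edgeProb M.pTilde M.zetaTilde s y := by
  have hE := Real.exp_pos M.ε
  have hden := M.tilde_den_pos.ne'
  have h2 : Real.exp M.ε + 2 ≠ 0 := by positivity
  rw [sum_edgeProb_mul hs]
  have h0 : (1 : SignType) ≠ -1 := signType_one_ne_neg_one
  have e1 : M.pTilde * M.zetaTilde =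
      (1 + (M.p : ℝ) * M.ζ * (Real.exp M.ε - 1)) / (Real.exp M.ε + 2) := by
    unfold Model.pTilde Model.zetaTilde; field_simp
  have e2 : M.pTilde * (1 - M.zetaTilde) =
      (1 + (M.p : ℝ) * (1 - M.ζ) * (Real.exp M.ε - 1)) / (Real.exp M.ε + 2) := by
    rw [mul_sub, e1]; unfold Model.pTilde; field_simp; ring
  have e3 : 1 - M.pTilde =
      (1 + (1 - (M.p : ℝ)) * (Real.exp M.ε - 1)) / (Real.exp M.ε + 2) := by
    unfold Model.pTilde; field_simp; ring
  have h0' := h0.symm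
  rcases hs with rfl | rfl <;> (
    rcases y with _ | _ | _ <;>
    simp [edgeProb, rrProb, e1, e2, e3, h0, h0'] <;>
    field_simp <;> ring)

/-- The weights of the privatized edges under the labels `σ`. -/
abbrev Model.wt (σ : Labels n) (e : Pair n) (x : SignType) : ℝ :=
  edgeProb M.pTilde M.zetaTilde (agree σ e) x

/-- The expectation of a function of the privatized graph under the labels `σ`. -/
def Model.expect (σ : Labels n) (f : SignedGraph n → ℝ) : ℝ := prodExp (M.wt σ) f

lemma Model.wt_pos (σ : Labels n) (e : Pair n) (x : SignType) : 0 < M.wt σ e x :=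
  edgeProb_pos M.pTilde_pos M.pTilde_lt_one M.zetaTilde_pos M.zetaTilde_lt_one _ _

lemma Model.wt_nonneg (σ : Labels n) (e : Pair n) (x : SignType) : 0 ≤ M.wt σ e x :=
  (M.wt_pos σ e x).le

lemma Model.sum_wt (σ : Labels n) (e : Pair n) : ∑ x, M.wt σ e x = 1 := by
  have := sum_edgeProb_mul (p := M.pTilde) (ζ := M.zetaTilde) (agree_eq_one_or σ e) (fun _ => 1)
  simp only [mul_one] at this
  rw [this]; ring

lemma Model.likelihood_pos (σ : Labels n) (A : SignedGraph n) :
    0 < likelihood M.pTilde M.zetaTilde σ A :=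
  Finset.prod_pos fun e _ => M.wt_pos σ e (A e)

lemma Model.expect_eq (σ : Labels n) (f : SignedGraph n → ℝ) :
    M.expect σ f = ∑ A, likelihood M.pTilde M.zetaTilde σ A * f A := rfl

lemma Model.sum_likelihood (σ : Labels n) :
    ∑ A, likelihood M.pTilde M.zetaTilde σ A = 1 := by
  have := prodExp_const (M.sum_wt σ) 1
  unfold prodExp at this
  simp only [mul_one] at this
  exact this

/-- The expectation of a privatized edge in the direction of its label. -/
def Model.signal : ℝ := M.pTilde * (1 - 2 * M.zetaTilde)

/-- The log-odds of a correct sign of a privatized edge. -/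
def Model.logOdds : ℝ := Real.log ((1 - M.zetaTilde) / M.zetaTilde)

/-- The reported label has the law of the true one with weight (e^ε-1)/(e^ε+2) plus a symmetric
remainder, which does not contribute to the mean. -/
lemma Model.signal_eq : M.signal =
    (M.p : ℝ) * (1 - 2 * M.ζ) * ((Real.exp M.ε - 1) / (Real.exp M.ε + 2)) := by
  have hden := M.tilde_den_pos.ne'
  have h2 : Real.exp M.ε + 2 ≠ 0 := by positivity
  unfold Model.signal Model.pTilde Model.zetaTilde
  field_simp
  ring

lemma Model.abs_signal_le : |M.signal| ≤ M.pTilde := by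
  unfold Model.signal
  rw [abs_mul, abs_of_pos M.pTilde_pos]
  refine mul_le_of_le_one_right M.pTilde_pos.le (abs_le.2 ⟨?_, ?_⟩) <;>
    linarith [M.zetaTilde_pos, M.zetaTilde_lt_one]

/-- The edges on which two label vectors predict different signs. -/
def disagree (σ τ : Labels n) : Finset (Pair n) :=
  Finset.univ.filter fun e => agree σ e ≠ agree τ e

lemma agree_eq_neg_of_mem_disagree {σ τ : Labels n} {e : Pair n} (h : e ∈ disagree σ τ) :
    agree τ e = -agree σ e := by
  have h1 := (Finset.mem_filter.1 h).2
  rcases agree_eq_one_or σ e with h2 | h2 <;> rcases agree_eq_one_or τ e with h3 | h3 <;>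
    simp_all

/-- The log-likelihood ratio of two label vectors. -/
lemma Model.log_likelihood_div (σ τ : Labels n) (A : SignedGraph n) :
    Real.log (likelihood M.pTilde M.zetaTilde σ A / likelihood M.pTilde M.zetaTilde τ A) =
      M.logOdds * ∑ e ∈ disagree σ τ, ((agree σ e : SignType) : ℝ) * ((A e : SignType) : ℝ) := by
  have hz := M.zetaTilde_pos
  have hz1 : 0 < 1 - M.zetaTilde := by linarith [M.zetaTilde_lt_one]
  have hp := M.pTilde_pos
  unfold likelihood
  rw [← Finset.prod_div_distrib, Real.log_prod fun e _ =>
    (div_pos (M.wt_pos σ e (A e)) (M.wt_pos τ e (A e))).ne', disagree, Finset.sum_filter,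
    Finset.mul_sum]
  refine Finset.sum_congr rfl fun e _ => ?_
  by_cases h : agree σ e = agree τ e
  · have : M.wt σ e (A e) = M.wt τ e (A e) := by simp only [Model.wt, h]
    rw [this, div_self (M.wt_pos τ e (A e)).ne']
    simp [h]
  · simp only [Model.wt]
    rw [if_pos h, agree_eq_neg_of_mem_disagree (Finset.mem_filter.2 ⟨Finset.mem_univ e, h⟩)]
    have h0 := signType_one_ne_neg_one
    have h0' := h0.symm
    have l1 : Real.log (M.pTilde * (1 - M.zetaTilde) / (M.pTilde * M.zetaTilde)) = M.logOdds := by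
      rw [mul_div_mul_left _ _ hp.ne', Model.logOdds]
    have l2 : Real.log (M.pTilde * M.zetaTilde / (M.pTilde * (1 - M.zetaTilde))) =
        -M.logOdds := by
      rw [mul_div_mul_left _ _ hp.ne', Model.logOdds, ← Real.log_inv, inv_div]
    have hp1 : 1 - M.pTilde ≠ 0 := by linarith [M.pTilde_lt_one]
    rcases agree_eq_one_or σ e with h2 | h2 <;> rw [h2] <;>
      rcases (SignType.trichotomy (A e)) with h3 | h3 | h3 <;>
      rw [h3] <;> simp [edgeProb, h0, h0', l1, l2, hp1]

lemma card_pair (n : ℕ) : Fintype.card (Pair n) = n.choose 2 := by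
  have h : Fintype.card (Pair n) = ∑ j : Fin n, (Finset.Iio j).card := by
    rw [Fintype.card_subtype, ← Finset.card_sigma]
    refine Finset.card_bij (fun e _ => ⟨e.2, e.1⟩) ?_ ?_ ?_
    · rintro ⟨i, j⟩ h
      simpa using h
    · rintro ⟨i, j⟩ _ ⟨k, l⟩ _ h
      simp only [Sigma.mk.injEq, heq_eq_eq] at h
      rw [h.1, h.2]
    · rintro ⟨j, i⟩ h
      exact ⟨(i, j), by simpa using h, rfl⟩
  rw [h]
  simp only [Fin.card_Iio]
  rw [Fin.sum_univ_eq_sum_range (fun i => i) n, Finset.sum_range_id, Nat.choose_two_right]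

/-- The information number counts the edges on which the labels disagree. -/
lemma Model.infoTilde_eq : M.infoTilde = (disagree M.post M.pre).card * M.signal * M.logOdds := by
  have h : ∀ e : Pair n, sgn M.pre e.1.1 * sgn M.pre e.1.2 * sgn M.post e.1.1 * sgn M.post e.1.2 =
      1 - 2 * (if agree M.post e ≠ agree M.pre e then 1 else 0) := fun e => by
    rw [mul_assoc (sgn M.pre e.1.1 * sgn M.pre e.1.2), ← agree_coe, ← agree_coe]
    rcases agree_eq_one_or M.pre e with h2 | h2 <;> rcases agree_eq_one_or M.post e with h3 | h3 <;>
      simp [h2, h3, signType_one_ne_neg_one.symm] <;> norm_num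
  unfold Model.infoTilde
  simp only [sgn] at h
  simp_rw [h]
  rw [Finset.sum_sub_distrib, ← Finset.mul_sum, Finset.sum_boole, ← disagree, ← card_pair,
    Model.signal, Model.logOdds]
  simp
  ring

lemma card_pair_le (n : ℕ) : (Fintype.card (Pair n) : ℝ) ≤ (n : ℝ) ^ 2 := by
  have := Fintype.card_subtype_le (fun e : Fin n × Fin n => e.1 < e.2)
  rw [Fintype.card_prod, Fintype.card_fin] at this
  rw [sq]
  exact_mod_cast this

lemma signType_abs_le_one (x : SignType) : |((x : SignType) : ℝ)| ≤ 1 := by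
  rcases SignType.trichotomy x with h | h | h <;> simp [h]

/-- Crude control of a step taken with a wrong estimate, each edge counting at most one log-odds;
the factor n² is absorbed by the rapid decay of the failure probability. -/
lemma Model.abs_log_likelihood_div_le (hl : 0 ≤ M.logOdds) (σ τ : Labels n) (A : SignedGraph n) :
    |Real.log (likelihood M.pTilde M.zetaTilde σ A / likelihood M.pTilde M.zetaTilde τ A)| ≤
      M.logOdds * (n : ℝ) ^ 2 := by
  rw [M.log_likelihood_div, abs_mul, abs_of_nonneg hl]
  refine mul_le_mul_of_nonneg_left ?_ hl
  calc |∑ e ∈ disagree σ τ, ((agree σ e : SignType) : ℝ) * ((A e : SignType) : ℝ)| ≤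
        ∑ e ∈ disagree σ τ, (1 : ℝ) := by
        refine (Finset.abs_sum_le_sum_abs _ _).trans (Finset.sum_le_sum fun e _ => ?_)
        rw [abs_mul]
        exact mul_le_one₀ (signType_abs_le_one _) (abs_nonneg _) (signType_abs_le_one _)
    _ ≤ Fintype.card (Pair n) := by
        simp only [Finset.sum_const, nsmul_eq_mul, mul_one]
        exact_mod_cast Finset.card_le_univ _
    _ ≤ _ := card_pair_le n

/-- The disagreeing edges include all those across the cut between changed and unchanged vertices,
and h(n-h) ≥ n-1 for 1 ≤ h ≤ n/2. -/
lemma card_disagree_ge (hh : 1 ≤ M.ham) (hh2 : 2 * M.ham ≤ n) :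
    (n : ℝ) - 1 ≤ (disagree M.post M.pre).card := by
  set S := Finset.univ.filter fun i => M.pre i ≠ M.post i with hS
  have hcS : S.card = M.ham := rfl
  have hcS' : Sᶜ.card = n - M.ham := by rw [Finset.card_compl, hcS, Fintype.card_fin]
  have hunits : ∀ a b c d : ℤˣ, a ≠ c → b = d → ¬((if c = d then (1 : SignType) else -1) =
      if a = b then (1 : SignType) else -1) := by decide
  have hunits' : ∀ a b c d : ℤˣ, a ≠ c → b = d → ¬((if d = c then (1 : SignType) else -1) =
      if b = a then (1 : SignType) else -1) := by decide
  -- Orienting an edge so that its changed end comes first recovers every pair of the product.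
  have hle : (S ×ˢ Sᶜ).card ≤ (disagree M.post M.pre).card := by
    refine (Finset.card_le_card fun x hx => ?_).trans (Finset.card_image_le
      (f := fun e : Pair n => if e.1.1 ∈ S then (e.1.1, e.1.2) else (e.1.2, e.1.1)))
    obtain ⟨i, j⟩ := x
    simp only [Finset.mem_product, Finset.mem_compl] at hx
    obtain ⟨hi, hj⟩ := hx
    have hi' : M.pre i ≠ M.post i := by simpa [hS] using hi
    have hj' : M.pre j = M.post j := by simpa [hS] using hj
    have hne : i ≠ j := fun h => hj (h ▸ hi)
    rw [Finset.mem_image]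
    rcases lt_or_gt_of_ne hne with h | h
    · exact ⟨⟨(i, j), h⟩, Finset.mem_filter.2 ⟨Finset.mem_univ _, hunits _ _ _ _ hi' hj'⟩,
        by simp [hi]⟩
    · exact ⟨⟨(j, i), h⟩, Finset.mem_filter.2 ⟨Finset.mem_univ _, hunits' _ _ _ _ hi' hj'⟩,
        by simp [hj]⟩
  rw [Finset.card_product, hcS, hcS'] at hle
  -- With h = 1 + k and n = 2h + l this reads 1 + 2k + l ≤ (1 + k)(1 + k + l).
  have : n - 1 ≤ M.ham * (n - M.ham) := by
    obtain ⟨k, hk⟩ := Nat.exists_eq_add_of_le hh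
    obtain ⟨l, hl⟩ := Nat.exists_eq_add_of_le hh2
    rw [show n - M.ham = 1 + (k + l) by omega, hk]
    have : n - 1 = 1 + 2 * k + l := by omega
    rw [this]; nlinarith
  have h3 : n ≤ (disagree M.post M.pre).card + 1 := by omega
  have : (n : ℝ) ≤ (disagree M.post M.pre).card + 1 := by exact_mod_cast h3
  linarith

end Tilde


/-! ### Mean and variance of the log-likelihood ratio. -/

section Moments

variable {n : ℕ} (M : Model n)

lemma agree_mul_self (σ : Labels n) (e : Pair n) :
    ((agree σ e : SignType) : ℝ) * ((agree σ e : SignType) : ℝ) = 1 := by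
  rcases agree_eq_one_or σ e with h | h <;> simp [h]

/-- The centred privatized edge, oriented by its label. -/
def Model.centred (σ : Labels n) (e : Pair n) (x : SignType) : ℝ :=
  ((agree σ e : SignType) : ℝ) * ((x : SignType) : ℝ) - M.signal

lemma Model.abs_centred_le (σ : Labels n) (e : Pair n) (x : SignType) :
    |M.centred σ e x| ≤ 2 := by
  have h1 : |((agree σ e : SignType) : ℝ) * ((x : SignType) : ℝ)| ≤ 1 := by
    rw [abs_mul]
    exact mul_le_one₀ (signType_abs_le_one _) (abs_nonneg _) (signType_abs_le_one _)
  have h2 := M.abs_signal_le.trans M.pTilde_lt_one.le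
  calc |M.centred σ e x| ≤ _ := abs_sub _ _
    _ ≤ 2 := by linarith

lemma Model.sum_wt_mul_centred (σ : Labels n) (e : Pair n) :
    ∑ x, M.wt σ e x * M.centred σ e x = 0 := by
  unfold Model.wt Model.centred
  rw [sum_edgeProb_mul (agree_eq_one_or σ e)]
  rcases agree_eq_one_or σ e with h | h <;> simp [h, Model.signal] <;> ring

lemma Model.sum_wt_mul_centred_sq_le (σ : Labels n) (e : Pair n) :
    ∑ x, M.wt σ e x * M.centred σ e x ^ 2 ≤ M.pTilde := by
  unfold Model.wt Model.centred
  rw [sum_edgeProb_mul (agree_eq_one_or σ e)]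
  have : 0 ≤ M.signal ^ 2 := sq_nonneg _
  rcases agree_eq_one_or σ e with h | h <;> simp [h] <;> unfold Model.signal at this ⊢ <;> nlinarith

lemma Model.expect_sum_centred (σ : Labels n) (s : Finset (Pair n)) :
    M.expect σ (fun A => ∑ e ∈ s, M.centred σ e (A e)) = 0 := by
  unfold Model.expect
  rw [prodExp_sum]
  refine Finset.sum_eq_zero fun e _ => ?_
  have := abs_prodExp_monomial_le (M.wt_nonneg σ) (M.sum_wt σ) (M.abs_centred_le σ)
    (M.sum_wt_mul_centred σ) (M.sum_wt_mul_centred_sq_le σ) (fun _ : Fin 1 => e)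
  simpa using this

/-- Cross terms vanish by independence. The 4 is the factor 2² of the general moment bound, not the
sharp variance constant; the threshold 4 for the signal-to-noise ratio is matched to it later. -/
lemma Model.expect_sum_centred_sq_le (σ : Labels n) (s : Finset (Pair n)) :
    M.expect σ (fun A => (∑ e ∈ s, M.centred σ e (A e)) ^ 2) ≤ 4 * M.pTilde * s.card := by
  unfold Model.expect
  simp_rw [sq, Finset.sum_mul_sum]
  simp_rw [prodExp_sum]
  have hterm : ∀ e f, prodExp (M.wt σ) (fun A => M.centred σ e (A e) * M.centred σ f (A f)) ≤
      if e = f then 4 * M.pTilde else 0 := fun e f => by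
    have := abs_prodExp_monomial_le (M.wt_nonneg σ) (M.sum_wt σ) (M.abs_centred_le σ)
      (M.sum_wt_mul_centred σ) (M.sum_wt_mul_centred_sq_le σ) (![e, f] : Fin 2 → Pair n)
    simp only [Fin.prod_univ_two, Matrix.cons_val_zero, Matrix.cons_val_one, Fintype.card_fin] at this
    have himg : Finset.univ.image (![e, f] : Fin 2 → Pair n) = {e, f} := by
      ext x
      simp [Fin.exists_fin_two, eq_comm]
    rw [himg] at this
    by_cases h : e = f
    · subst h
      refine (le_abs_self _).trans (this.trans ?_)
      simp; norm_num
    · rw [Finset.card_pair h] at this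
      simpa [h] using (le_abs_self _).trans this
  calc _ ≤ ∑ e ∈ s, ∑ f ∈ s, (if e = f then 4 * M.pTilde else 0) :=
        Finset.sum_le_sum fun e _ => Finset.sum_le_sum fun f _ => hterm e f
    _ = _ := by
        simp only [Finset.sum_ite_eq, Finset.sum_ite_mem, Finset.inter_self, Finset.sum_const]
        simp [mul_comm]

/-- The log-likelihood ratio of the post-change labels and the pre-change labels. -/
def Model.llr (A : SignedGraph n) : ℝ :=
  Real.log (likelihood M.pTilde M.zetaTilde M.post A / likelihood M.pTilde M.zetaTilde M.pre A)

/-- Expresses the fluctuation through centred independent edges, so that mean and variance can be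
read off. -/
lemma Model.llr_sub_infoTilde (A : SignedGraph n) :
    M.llr A - M.infoTilde =
      M.logOdds * ∑ e ∈ disagree M.post M.pre, M.centred M.post e (A e) := by
  rw [Model.llr, M.log_likelihood_div, M.infoTilde_eq]
  unfold Model.centred
  rw [Finset.sum_sub_distrib, Finset.sum_const, nsmul_eq_mul]
  ring

lemma Model.expect_llr : M.expect M.post M.llr = M.infoTilde := by
  have h : M.llr = fun A => M.infoTilde +
      M.logOdds * ∑ e ∈ disagree M.post M.pre, M.centred M.post e (A e) := by
    ext A
    rw [← M.llr_sub_infoTilde]; ring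
  have h0 := M.expect_sum_centred M.post (disagree M.post M.pre)
  unfold Model.expect at h0 ⊢
  rw [h, prodExp_add, prodExp_const (M.sum_wt _), prodExp_const_mul, h0]
  ring

lemma Model.expect_llr_sub_sq_le : M.expect M.post (fun A => (M.llr A - M.infoTilde) ^ 2) ≤
    M.logOdds ^ 2 * (4 * M.pTilde * (disagree M.post M.pre).card) := by
  simp_rw [M.llr_sub_infoTilde, mul_pow]
  have h0 := M.expect_sum_centred_sq_le M.post (disagree M.post M.pre)
  unfold Model.expect at h0 ⊢
  rw [prodExp_const_mul]
  gcongr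

end Moments

/-! ### The law of the privatized graph -/

section Law

variable {n : ℕ} (M : Model n)

/-- The sum over raw graphs factors over edges, and each factor is the law of one privatized edge.
-/
lemma Model.bind_perturb_apply (σ : Labels n) (B : SignedGraph n) :
    ((cbm M.p M.ζ σ).bind (fun A => perturb M.ε A)) B =
      ENNReal.ofReal (likelihood M.pTilde M.zetaTilde σ B) := by
  rw [PMF.bind_apply, tsum_fintype]
  have hedge : ∀ e x, 0 ≤ edgeProb M.p M.ζ (agree σ e) x := fun e x => by
    have h2 : (0 : ℝ) ≤ M.p * M.ζ := mul_nonneg M.p.2.1 M.ζ.2.1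
    have h3 : (0 : ℝ) ≤ M.p * (1 - M.ζ) := mul_nonneg M.p.2.1 (sub_nonneg.2 M.ζ.2.2)
    have h1 : (0 : ℝ) ≤ 1 - M.p := sub_nonneg.2 M.p.2.2
    unfold edgeProb; split_ifs <;> assumption
  have hrr : ∀ x y, 0 ≤ rrProb M.ε x y := fun x y => by
    unfold rrProb; split_ifs <;> positivity
  have h : ∀ A : SignedGraph n, cbm M.p M.ζ σ A * perturb M.ε A B =
      ENNReal.ofReal (∏ e, edgeProb M.p M.ζ (agree σ e) (A e) * rrProb M.ε (A e) (B e)) := by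
    intro A
    simp only [cbm, perturb, indepEdges, edgePMF, rrPMF, PMF.ofFintype_apply]
    rw [← Finset.prod_mul_distrib, ENNReal.ofReal_prod_of_nonneg fun e _ =>
      mul_nonneg (hedge e _) (hrr _ _)]
    exact Finset.prod_congr rfl fun e _ => (ENNReal.ofReal_mul (hedge e _)).symm
  simp_rw [h]
  rw [← ENNReal.ofReal_sum_of_nonneg fun A _ => Finset.prod_nonneg fun e _ =>
    mul_nonneg (hedge e _) (hrr _ _)]
  congr 1
  have := Fintype.prod_sum fun (e : Pair n) x =>
    edgeProb M.p M.ζ (agree σ e) x * rrProb M.ε x (B e)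
  rw [← this]
  exact Finset.prod_congr rfl fun e _ => M.sum_edgeProb_mul_rrProb (agree_eq_one_or σ e) (B e)

/-- Bridge between the measure on pairs (raw, private) and the finite weighted sums in which all
moments are computed. -/
lemma Model.lintegral_sampleLaw (σ : Labels n) (h : SignedGraph n → ℝ≥0∞) :
    ∫⁻ x, h x.2 ∂(M.sampleLaw σ).toMeasure =
      ∑ B, ENNReal.ofReal (likelihood M.pTilde M.zetaTilde σ B) * h B := by
  have hmap : ((M.sampleLaw σ).toMeasure).map Prod.snd =
      ((cbm M.p M.ζ σ).bind (fun A => perturb M.ε A)).toMeasure := by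
    rw [PMF.toMeasure_map _ _ measurable_snd]
    congr 1
    rw [Model.sampleLaw, PMF.map_bind]
    congr 1
    ext1 A
    rw [PMF.map_comp]
    exact PMF.map_id _
  have : ∫⁻ x, h x.2 ∂(M.sampleLaw σ).toMeasure =
      ∫⁻ B, h B ∂((M.sampleLaw σ).toMeasure).map Prod.snd :=
    (lintegral_map (measurable_of_finite h) measurable_snd).symm
  rw [this, hmap, lintegral_fintype]
  refine Finset.sum_congr rfl fun B _ => ?_
  rw [PMF.toMeasure_apply_singleton _ _ (measurableSet_singleton B), M.bind_perturb_apply, mul_comm]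

lemma Model.lintegral_sampleLaw_ofReal (σ : Labels n) {h : SignedGraph n → ℝ} (hh : ∀ B, 0 ≤ h B) :
    ∫⁻ x, ENNReal.ofReal (h x.2) ∂(M.sampleLaw σ).toMeasure = ENNReal.ofReal (M.expect σ h) := by
  rw [M.lintegral_sampleLaw σ fun B => ENNReal.ofReal (h B), M.expect_eq,
    ENNReal.ofReal_sum_of_nonneg fun B _ => mul_nonneg (M.likelihood_pos σ B).le (hh B)]
  exact Finset.sum_congr rfl fun B _ => (ENNReal.ofReal_mul (M.likelihood_pos σ B).le).symm

/-- The Kullback-Leibler divergence on a finite set. -/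
lemma klDiv_toMeasure_of_finite {α : Type*} [Fintype α] [MeasurableSpace α]
    [MeasurableSingletonClass α] (P Q : PMF α) (hQ : ∀ x, Q x ≠ 0) :
    InformationTheory.klDiv P.toMeasure Q.toMeasure =
      ENNReal.ofReal (∑ x, (P x).toReal * Real.log ((P x).toReal / (Q x).toReal)) := by
  -- Full support of Q makes the pointwise ratio a density.
  have hwd : P.toMeasure = Q.toMeasure.withDensity (fun x => P x / Q x) := by
    refine Measure.ext_of_singleton fun x => ?_
    rw [withDensity_apply _ (measurableSet_singleton x), lintegral_singleton,
      PMF.toMeasure_apply_singleton _ _ (measurableSet_singleton x),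
      PMF.toMeasure_apply_singleton _ _ (measurableSet_singleton x),
      ENNReal.div_mul_cancel (hQ x) (PMF.apply_ne_top _ _)]
  have hac : P.toMeasure ≪ Q.toMeasure := hwd ▸ withDensity_absolutelyContinuous _ _
  have hrn : P.toMeasure.rnDeriv Q.toMeasure =ᵐ[P.toMeasure] fun x => P x / Q x := by
    refine hac.ae_le ?_
    rw [hwd]
    exact Measure.rnDeriv_withDensity _ (measurable_of_finite _)
  have hllr : llr P.toMeasure Q.toMeasure =ᵐ[P.toMeasure]
      fun x => Real.log ((P x).toReal / (Q x).toReal) := by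
    filter_upwards [hrn] with x hx
    rw [llr, hx, ENNReal.toReal_div]
  have hint : Integrable (llr P.toMeasure Q.toMeasure) P.toMeasure :=
    Integrable.of_finite
  rw [InformationTheory.klDiv_of_ac_of_integrable hac hint, integral_congr_ae hllr,
    PMF.integral_eq_sum]
  simp

lemma Model.klDiv_privateLaw :
    InformationTheory.klDiv (M.privateLaw M.post) (M.privateLaw M.pre) =
      ENNReal.ofReal M.infoTilde := by
  have hne : ∀ σ B, ((cbm M.p M.ζ σ).bind (fun A => perturb M.ε A)) B ≠ 0 := fun σ B => by
    rw [M.bind_perturb_apply]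
    simpa using M.likelihood_pos σ B
  unfold Model.privateLaw
  rw [klDiv_toMeasure_of_finite _ _ (hne _), ← M.expect_llr, M.expect_eq]
  simp_rw [M.bind_perturb_apply, ENNReal.toReal_ofReal (M.likelihood_pos _ _).le]
  rfl

end Law


/-! ### Exact recovery -/

section Recovery

variable {n : ℕ}

/-- The edges at the vertex `i`. -/
def incident (i : Fin n) : Finset (Pair n) :=
  Finset.univ.filter fun e => e.1.1 = i ∨ e.1.2 = i

/-- Row sums become sums over distinct independent edges, as the Chernoff bound for degrees
requires. -/
lemma sum_symMat (f : Pair n → ℝ) (i : Fin n) : ∑ j, symMat f i j = ∑ e ∈ incident i, f e := by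
  have h : ∑ j, symMat f i j = ∑ j ∈ Finset.univ.filter (fun j => i ≠ j), symMat f i j := by
    rw [Finset.sum_filter]
    refine Finset.sum_congr rfl fun j _ => ?_
    by_cases h : i = j <;> simp [symMat, h]
  rw [h]
  symm
  refine Finset.sum_bij (fun e _ => if e.1.1 = i then e.1.2 else e.1.1) ?_ ?_ ?_ ?_
  · intro e he
    have he' := (Finset.mem_filter.1 he).2
    rw [Finset.mem_filter]
    refine ⟨Finset.mem_univ _, ?_⟩
    have hlt := e.2
    split_ifs with h1
    · exact h1 ▸ hlt.ne
    · exact fun h => h1 h.symm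
  · rintro ⟨⟨a, b⟩, hab⟩ he ⟨⟨c, d⟩, hcd⟩ he' heq
    have h1 := (Finset.mem_filter.1 he).2
    have h2 := (Finset.mem_filter.1 he').2
    simp only at h1 h2 heq hab hcd
    have : a = c ∧ b = d := by
      split_ifs at heq <;> (constructor <;> omega)
    simp [this.1, this.2]
  · intro j hj
    have hij := (Finset.mem_filter.1 hj).2
    refine ⟨mkPair i j hij, ?_, ?_⟩
    · rw [incident, Finset.mem_filter]
      refine ⟨Finset.mem_univ _, ?_⟩
      unfold mkPair
      split_ifs <;> simp
    · unfold mkPair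
      split_ifs <;> simp_all
  · rintro ⟨⟨a, b⟩, hab⟩ he
    have h1 := (Finset.mem_filter.1 he).2
    simp only at h1 hab
    simp only
    by_cases hai : a = i
    · subst hai
      rw [if_pos rfl, symMat, dif_pos hab.ne]
      simp [mkPair, hab]
    · have hbi : b = i := by tauto
      subst hbi
      rw [if_neg hai, symMat, dif_pos hab.ne']
      simp [mkPair, hab.not_gt]

lemma card_incident (i : Fin n) : ((incident i).card : ℝ) = n - 1 := by
  have h := sum_symMat (fun _ => (1 : ℝ)) i
  have h2 : ∀ j, symMat (fun _ => (1 : ℝ)) i j = 1 - if i = j then 1 else 0 := fun j => by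
    unfold symMat; by_cases h : i = j <;> simp [h]
  simp_rw [h2] at h
  simpa using h.symm

lemma agree_mkPair (σ : Labels n) {i j : Fin n} (h : i ≠ j) :
    ((agree σ (mkPair i j h) : SignType) : ℝ) = sgn σ i * sgn σ j := by
  rw [agree_coe]
  unfold mkPair
  split_ifs
  · rfl
  · exact mul_comm _ _

lemma sgn_mul_adjacency_mulVec (σ : Labels n) (A : SignedGraph n) (i : Fin n) :
    sgn σ i * (adjacency A).mulVec (sgn σ) i =
      ∑ e ∈ incident i, ((agree σ e : SignType) : ℝ) * ((A e : SignType) : ℝ) := by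
  rw [← sum_symMat (fun e => ((agree σ e : SignType) : ℝ) * ((A e : SignType) : ℝ)),
    adjacency_eq_symMat, Matrix.mulVec, dotProduct, Finset.mul_sum]
  refine Finset.sum_congr rfl fun j _ => ?_
  unfold symMat
  by_cases h : i = j
  · simp [h]
  · rw [dif_pos h, dif_pos h]
    simp only [agree_mkPair]
    ring

variable (M : Model n)

/-- The noise matrix of the privatized graph. -/
def Model.noise (σ : Labels n) (A : SignedGraph n) : Matrix (Fin n) (Fin n) ℝ :=
  symMat fun e => ((agree σ e : SignType) : ℝ) * M.centred σ e (A e)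

lemma Model.adjacency_eq (σ : Labels n) (A : SignedGraph n) (i j : Fin n) :
    adjacency A i j =
      M.signal * (sgn σ i * sgn σ j - if i = j then 1 else 0) + M.noise σ A i j := by
  rw [adjacency_eq_symMat]
  unfold Model.noise symMat Model.centred
  by_cases h : i = j
  · subst h
    simp [sgn_mul_self]
  · rw [dif_pos h, dif_pos h, if_neg h, ← agree_mkPair σ h]
    linear_combination -((A (mkPair i j h) : SignType) : ℝ) * agree_mul_self σ (mkPair i j h)

/-- On graphs with large degrees and small noise, the estimator recovers the labels. -/
lemma Model.recovers {est : SignedGraph n → Labels n} (hest : IsSDPEstimator est) (σ : Labels n)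
    (hq : 0 < M.signal) {j : ℕ} {A : SignedGraph n}
    (hd : ∀ i, ((n : ℝ) - 1) * M.signal / 2 ≤
      ∑ e ∈ incident i, ((agree σ e : SignType) : ℝ) * ((A e : SignType) : ℝ))
    (hW : (M.noise σ A ^ 2 ^ (j + 1)).trace ≤ (n * M.signal / 8) ^ 2 ^ (j + 1)) :
    est A = σ ∨ est A = -σ := by
  obtain ⟨Y, hY⟩ := hest
  refine (hY A).2 σ fun i k => ?_
  have hn : (0 : ℝ) < n := by exact_mod_cast (Nat.zero_le _).trans_lt i.2
  have hB : (adjacency A).IsSymm := by rw [adjacency_eq_symMat]; exact symMat_isSymm _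
  -- The margin is (n-1)q/2 + q - nq/8 = 3nq/8 + q/2 > 0.
  refine (hY A).1.eq_of_degree_of_quadForm (σ := σ) hB (M.adjacency_eq σ A)
    (d₀ := ((n : ℝ) - 1) * M.signal / 2) (w := n * M.signal / 8) (fun i => ?_)
    (quadForm_le_of_trace_pow_le (symMat_isSymm _) (by positivity) hW) ?_ i k
  · rw [sgn_mul_adjacency_mulVec]; exact hd i
  · nlinarith [mul_pos hn hq]

/-- The ratio of squared signal and noise. -/
def Model.snr : ℝ := ((n : ℝ) - 1) * M.signal ^ 2 / M.pTilde

/-- Chernoff bound for the event that a sum of n-1 independent edges of mean q and second moment p̃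
falls below half its mean. -/
lemma Model.prodExp_degree_lt_le (σ : Labels n) (hq : 0 < M.signal) (i : Fin n) :
    prodExp (M.wt σ) (fun A => if ∑ e ∈ incident i,
        ((agree σ e : SignType) : ℝ) * ((A e : SignType) : ℝ) < ((n : ℝ) - 1) * M.signal / 2
      then 1 else 0) ≤ Real.exp (-(M.snr / 16)) := by
  have hp := M.pTilde_pos
  have hqp : M.signal ≤ M.pTilde := (le_abs_self _).trans M.abs_signal_le
  set q := M.signal with hq_def
  -- Minimizer of -θq/2 + θ²p̃, with minimum -q²/(16p̃). It is at most 1 because q ≤ p̃, which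
  -- allows exp u ≤ 1 + u + u².
  set θ : ℝ := q / (4 * M.pTilde) with hθ
  have hθ0 : 0 < θ := by positivity
  have hθ1 : θ ≤ 1 := by
    rw [hθ, div_le_one (by positivity)]; linarith
  have hedge : ∀ e, ∑ x, M.wt σ e x * (if e ∈ incident i then
      Real.exp (-(θ * (((agree σ e : SignType) : ℝ) * ((x : SignType) : ℝ)))) else 1) ≤
      if e ∈ incident i then Real.exp (-(θ * q) + θ ^ 2 * M.pTilde) else 1 := by
    intro e
    by_cases he : e ∈ incident i
    swap
    · simp only [he, if_false, mul_one]
      exact (M.sum_wt σ e).le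
    simp only [he, if_true]
    have hexp : ∀ u : ℝ, |u| ≤ 1 → Real.exp u ≤ 1 + u + u ^ 2 := fun u hu => by
      have := (abs_le.1 (Real.abs_exp_sub_one_sub_id_le hu)).2
      linarith
    have h1 := hexp (-θ) (by rw [abs_neg, abs_of_pos hθ0]; exact hθ1)
    have h2 := hexp θ (by rw [abs_of_pos hθ0]; exact hθ1)
    have hval : ∑ x, M.wt σ e x *
        Real.exp (-(θ * (((agree σ e : SignType) : ℝ) * ((x : SignType) : ℝ)))) =
        (1 - M.pTilde) + M.pTilde * (1 - M.zetaTilde) * Real.exp (-θ) +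
          M.pTilde * M.zetaTilde * Real.exp θ := by
      unfold Model.wt
      rw [sum_edgeProb_mul (agree_eq_one_or σ e)]
      rcases agree_eq_one_or σ e with h | h <;> simp [h]
    rw [hval]
    have hz0 : 0 ≤ M.pTilde * M.zetaTilde := (mul_pos hp M.zetaTilde_pos).le
    have hz1 : 0 ≤ M.pTilde * (1 - M.zetaTilde) :=
      mul_nonneg hp.le (by linarith [M.zetaTilde_lt_one])
    calc _ ≤ (1 - M.pTilde) + M.pTilde * (1 - M.zetaTilde) * (1 + -θ + (-θ) ^ 2) +
          M.pTilde * M.zetaTilde * (1 + θ + θ ^ 2) := by gcongr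
      _ = (-(θ * q) + θ ^ 2 * M.pTilde) + 1 := by rw [hq_def, Model.signal]; ring
      _ ≤ _ := Real.add_one_le_exp _
  calc _ ≤ prodExp (M.wt σ) (fun A => Real.exp (θ * (((n : ℝ) - 1) * q / 2)) *
        ∏ e, (if e ∈ incident i then
          Real.exp (-(θ * (((agree σ e : SignType) : ℝ) * ((A e : SignType) : ℝ)))) else 1)) := by
        refine prodExp_mono (M.wt_nonneg σ) fun A => ?_
        rw [Finset.prod_ite_mem, Finset.univ_inter, ← Real.exp_sum, ← Real.exp_add]
        split_ifs with h
        · rw [Real.one_le_exp_iff, Finset.sum_neg_distrib, ← Finset.mul_sum, ← sub_eq_add_neg,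
            ← mul_sub]
          exact mul_nonneg hθ0.le (by linarith)
        · positivity
    _ ≤ Real.exp (θ * (((n : ℝ) - 1) * q / 2)) *
          ∏ e, (if e ∈ incident i then Real.exp (-(θ * q) + θ ^ 2 * M.pTilde) else 1) := by
        rw [prodExp_const_mul]
        refine mul_le_mul_of_nonneg_left ?_ (Real.exp_pos _).le
        have := prodExp_prod (w := M.wt σ) (fun e x => if e ∈ incident i then
          Real.exp (-(θ * (((agree σ e : SignType) : ℝ) * ((x : SignType) : ℝ)))) else 1)
        rw [this]
        refine Finset.prod_le_prod (fun e _ => Finset.sum_nonneg fun x _ =>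
          mul_nonneg (M.wt_nonneg σ e x) ?_) fun e _ => hedge e
        split_ifs <;> positivity
    _ = Real.exp (-(M.snr / 16)) := by
        rw [Finset.prod_ite_mem, Finset.univ_inter, Finset.prod_const, ← Real.exp_nat_mul,
          ← Real.exp_add, card_incident, Model.snr, ← hq_def, hθ]
        congr 1
        field_simp
        ring

/-- Markov's inequality for the trace moment of order 2k with k = 2^j: the ratio of np̃ to (nq/8)²
is at most 64/snr. -/
lemma Model.prodExp_noise_lt_le (σ : Labels n) (hq : 0 < M.signal) (hN : 1 ≤ M.snr) (j : ℕ) :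
    prodExp (M.wt σ) (fun A => if (n * M.signal / 8) ^ 2 ^ (j + 1) <
        (M.noise σ A ^ 2 ^ (j + 1)).trace then 1 else 0) ≤
      4 ^ 2 ^ j * (2 * 2 ^ j + 1).factorial * n * (64 / M.snr) ^ 2 ^ j := by
  have hp := M.pTilde_pos
  have hqp : M.signal ≤ M.pTilde := (le_abs_self _).trans M.abs_signal_le
  have hN' : M.pTilde ≤ ((n : ℝ) - 1) * M.signal ^ 2 := by
    have := hN; unfold Model.snr at this
    rwa [one_le_div hp] at this
  have hn1 : (0 : ℝ) < (n : ℝ) - 1 := by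
    by_contra h
    push Not at h
    nlinarith [mul_nonneg (neg_nonneg.2 h) (sq_nonneg M.signal)]
  have hn : (0 : ℝ) < n := by linarith
  -- Otherwise p̃ ≤ (n-1)q² ≤ np̃q < q ≤ p̃.
  have hnP : 1 ≤ n * M.pTilde := by
    by_contra h
    push Not at h
    have h1 : ((n : ℝ) - 1) * M.signal ^ 2 ≤ n * M.pTilde * M.signal := by
      have : ((n : ℝ) - 1) * M.signal ≤ n * M.pTilde := by gcongr; linarith
      calc ((n : ℝ) - 1) * M.signal ^ 2 = ((n : ℝ) - 1) * M.signal * M.signal := by ring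
        _ ≤ _ := by gcongr
    nlinarith
  have h2j : 2 ^ (j + 1) = 2 * 2 ^ j := by ring
  rw [h2j]
  set k := 2 ^ j with hk
  have ht : 0 < (n * M.signal / 8) ^ (2 * k) := by positivity
  have hpow_nonneg : ∀ A, 0 ≤ (M.noise σ A ^ (2 * k)).trace := fun A => by
    have hs : (M.noise σ A ^ k).transpose = M.noise σ A ^ k := by
      rw [Matrix.transpose_pow, Model.noise, (symMat_isSymm _).eq]
    rw [two_mul, pow_add]
    nth_rewrite 2 [← hs]
    refine Finset.sum_nonneg fun i _ => ?_
    rw [Matrix.diag_apply, Matrix.mul_apply]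
    exact Finset.sum_nonneg fun l _ => by
      rw [Matrix.transpose_apply]; exact mul_self_nonneg _
  have hmarkov := mul_prodExp_indicator_le (M.wt_nonneg σ) hpow_nonneg
    (t := (n * M.signal / 8) ^ (2 * k))
    (s := fun A => (n * M.signal / 8) ^ (2 * k) < (M.noise σ A ^ (2 * k)).trace)
    (fun A h => le_of_lt h)
  have hsq : ∀ e x, (((agree σ e : SignType) : ℝ) * M.centred σ e x) ^ 2 = M.centred σ e x ^ 2 :=
    fun e x => by
      rw [mul_pow, sq ((agree σ e : SignType) : ℝ), agree_mul_self, one_mul]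
  have hmoment := prodExp_trace_pow_le (M.wt_nonneg σ) (M.sum_wt σ)
    (g := fun e x => ((agree σ e : SignType) : ℝ) * M.centred σ e x)
    (fun e x => by
      rw [abs_mul]
      exact (mul_le_of_le_one_left (abs_nonneg _) (signType_abs_le_one _)).trans
        (M.abs_centred_le σ e x))
    (fun e => by
      have := M.sum_wt_mul_centred σ e
      calc _ = ((agree σ e : SignType) : ℝ) * ∑ x, M.wt σ e x * M.centred σ e x := by
            rw [Finset.mul_sum]; exact Finset.sum_congr rfl fun x _ => by ring
        _ = 0 := by rw [this, mul_zero])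
    (fun e => by simp_rw [hsq]; exact M.sum_wt_mul_centred_sq_le σ e) hnP k
  have h3 := hmarkov.trans hmoment
  rw [mul_comm, ← le_div_iff₀ ht] at h3
  refine h3.trans ?_
  have hratio : (n * M.pTilde) ^ k / (n * M.signal / 8) ^ (2 * k) ≤ (64 / M.snr) ^ k := by
    rw [pow_mul, ← div_pow]
    refine pow_le_pow_left₀ (by positivity) ?_ _
    unfold Model.snr
    rw [div_le_div_iff₀ (by positivity) (by positivity)]
    have h4 : ((n : ℝ) - 1) * M.signal ^ 2 / M.pTilde * M.pTilde = ((n : ℝ) - 1) * M.signal ^ 2 := by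
      field_simp
    calc n * M.pTilde * (((n : ℝ) - 1) * M.signal ^ 2 / M.pTilde) =
          n * (((n : ℝ) - 1) * M.signal ^ 2 / M.pTilde * M.pTilde) := by ring
      _ = n * (((n : ℝ) - 1) * M.signal ^ 2) := by rw [h4]
      _ ≤ n * (n * M.signal ^ 2) := by gcongr; linarith
      _ = _ := by ring
  calc _ = 4 ^ k * (2 * k + 1).factorial * n *
        ((n * M.pTilde) ^ k / (n * M.signal / 8) ^ (2 * k)) := by ring
    _ ≤ _ := by gcongr

/-- The estimator recovers the labels up to a global flip. -/
def recovered (est : SignedGraph n → Labels n) (σ : Labels n) (A : SignedGraph n) : Prop :=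
  est A = σ ∨ est A = -σ

instance (est : SignedGraph n → Labels n) (σ : Labels n) : DecidablePred (recovered est σ) :=
  fun A => inferInstanceAs (Decidable (est A = σ ∨ est A = -σ))

/-- The probability that the estimator fails. -/
def Model.failProb (est : SignedGraph n → Labels n) : ℝ :=
  M.expect M.post fun A => if recovered est M.post A then 0 else 1

lemma Model.failProb_nonneg (est : SignedGraph n → Labels n) : 0 ≤ M.failProb est :=
  prodExp_nonneg (M.wt_nonneg _) fun A => by split_ifs <;> norm_num

/-- The failure probability decays faster than any power of the signal-to-noise ratio. -/
lemma Model.failProb_le {est : SignedGraph n → Labels n} (hest : IsSDPEstimator est)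
    (hq : 0 < M.signal) (hN : 1 ≤ M.snr) (j : ℕ) :
    M.failProb est ≤ n * (((2 ^ j).factorial * 16 ^ 2 ^ j +
      4 ^ 2 ^ j * (2 * 2 ^ j + 1).factorial * 64 ^ 2 ^ j) / M.snr ^ 2 ^ j) := by
  set σ := M.post with hσ
  have hN0 : 0 < M.snr := by linarith
  -- The exponential bound is weakened to the same power of the signal-to-noise ratio as the trace
  -- bound, from x^k/k! ≤ e^x.
  have hexp : Real.exp (-(M.snr / 16)) ≤ (2 ^ j).factorial * 16 ^ 2 ^ j / M.snr ^ 2 ^ j := by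
    have := Real.pow_div_factorial_le_exp (M.snr / 16) (by positivity) (2 ^ j)
    rw [Real.exp_neg]
    calc _ ≤ ((M.snr / 16) ^ 2 ^ j / (2 ^ j).factorial)⁻¹ := by gcongr
      _ = _ := by rw [div_pow]; field_simp
  -- Union bound: failure needs one small degree or a large trace.
  have hunion : M.failProb est ≤ prodExp (M.wt σ) (fun A =>
      ∑ i, (if ∑ e ∈ incident i, ((agree σ e : SignType) : ℝ) * ((A e : SignType) : ℝ) <
        ((n : ℝ) - 1) * M.signal / 2 then 1 else 0) +
      if (n * M.signal / 8) ^ 2 ^ (j + 1) < (M.noise σ A ^ 2 ^ (j + 1)).trace then 1 else 0) := by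
    refine prodExp_mono (M.wt_nonneg σ) fun A => ?_
    have hnn : ∀ i : Fin n, (0 : ℝ) ≤
        if ∑ e ∈ incident i, ((agree σ e : SignType) : ℝ) * ((A e : SignType) : ℝ) <
        ((n : ℝ) - 1) * M.signal / 2 then 1 else 0 := fun i => by split_ifs <;> norm_num
    have hnn' := Finset.sum_nonneg fun i (_ : i ∈ Finset.univ) => hnn i
    have hnn2 : (0 : ℝ) ≤ if (n * M.signal / 8) ^ 2 ^ (j + 1) <
        (M.noise σ A ^ 2 ^ (j + 1)).trace then 1 else 0 := by split_ifs <;> norm_num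
    by_cases h : recovered est σ A
    · rw [if_pos h]
      exact add_nonneg hnn' hnn2
    rw [if_neg h]
    by_cases hW : (n * M.signal / 8) ^ 2 ^ (j + 1) < (M.noise σ A ^ 2 ^ (j + 1)).trace
    · rw [if_pos hW]; linarith
    obtain ⟨i, hi⟩ : ∃ i, ∑ e ∈ incident i,
        ((agree σ e : SignType) : ℝ) * ((A e : SignType) : ℝ) < ((n : ℝ) - 1) * M.signal / 2 := by
      by_contra hcon
      push Not at hcon
      exact h (M.recovers hest σ hq hcon (not_lt.1 hW))
    have := Finset.single_le_sum (fun i _ => hnn i) (Finset.mem_univ i)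
    rw [if_pos hi] at this
    linarith
  refine hunion.trans ?_
  rw [prodExp_add, prodExp_sum]
  calc _ ≤ ∑ _i : Fin n, (2 ^ j).factorial * 16 ^ 2 ^ j / M.snr ^ 2 ^ j +
        4 ^ 2 ^ j * (2 * 2 ^ j + 1).factorial * n * (64 / M.snr) ^ 2 ^ j :=
        add_le_add (Finset.sum_le_sum fun i _ => (M.prodExp_degree_lt_le σ hq i).trans hexp)
          (M.prodExp_noise_lt_le σ hq hN j)
    _ = _ := by
        rw [Finset.sum_const, Finset.card_univ, Fintype.card_fin, nsmul_eq_mul, div_pow]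
        ring

end Recovery


/-! ### Product measures -/

/-- Under a product measure, one coordinate may be resampled. -/
lemma lintegral_infinitePi_update {ι : Type*} [DecidableEq ι] {X : ι → Type*}
    [∀ i, MeasurableSpace (X i)] (μ μ' : ∀ i, Measure (X i)) [∀ i, IsProbabilityMeasure (μ i)]
    [∀ i, IsProbabilityMeasure (μ' i)] (i : ι) (h : ∀ j, j ≠ i → μ j = μ' j)
    {f : (∀ i, X i) → ℝ≥0∞} (hf : Measurable f) :
    ∫⁻ ω, f ω ∂Measure.infinitePi μ =
      ∫⁻ ω, ∫⁻ x, f (Function.update ω i x) ∂μ i ∂Measure.infinitePi μ' := by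
  have hu : Measurable fun p : (∀ i, X i) × X i => Function.update p.1 i p.2 :=
    measurable_update'
  -- Overwriting coordinate i erases the only place where μ and μ' may differ; finite boxes identify
  -- the resulting law.
  have hμ : ((Measure.infinitePi μ').prod (μ i)).map (fun p => Function.update p.1 i p.2) =
      Measure.infinitePi μ := by
    refine Measure.eq_infinitePi _ fun s t ht => ?_
    rw [Measure.map_apply hu (MeasurableSet.pi s.countable_toSet fun j _ => ht j)]
    have hpre : (fun p : (∀ i, X i) × X i => Function.update p.1 i p.2) ⁻¹'
        ((s : Set ι).pi t) = ((s.erase i : Finset ι) : Set ι).pi t ×ˢ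
          (if i ∈ s then t i else Set.univ) := by
      ext ⟨ω, x⟩
      simp only [Set.mem_preimage, Set.mem_pi, Set.mem_prod, Finset.mem_coe, Finset.mem_erase]
      constructor
      · intro hω
        refine ⟨fun j hj => ?_, ?_⟩
        · have := hω j hj.2
          rwa [Function.update_of_ne hj.1] at this
        · split_ifs with his
          · have := hω i his
            rwa [Function.update_self] at this
          · trivial
      · rintro ⟨h1, h2⟩ j hj
        by_cases hji : j = i
        · subst hji
          rw [Function.update_self]
          simpa [hj] using h2
        · rw [Function.update_of_ne hji]
          exact h1 j ⟨hji, hj⟩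
    rw [hpre, Measure.prod_prod, Measure.infinitePi_pi _ fun j _ => ht j]
    have hprod : ∏ j ∈ s.erase i, μ' j (t j) = ∏ j ∈ s.erase i, μ j (t j) :=
      Finset.prod_congr rfl fun j hj => by rw [h j (Finset.ne_of_mem_erase hj)]
    rw [hprod]
    by_cases his : i ∈ s
    · rw [if_pos his, Finset.prod_erase_mul s _ his]
    · rw [if_neg his, Finset.erase_eq_of_notMem his, measure_univ, mul_one]
  rw [← hμ, lintegral_map hf hu]
  exact lintegral_prod _ (hf.comp hu).aemeasurable

/-! ### Events of the filtrations -/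

section Path

variable {n : ℕ}

/-- Membership in an event of the filtration is decided by the observations up to that time. -/
lemma mem_iff_of_forall_eq {β : Type*} [MeasurableSpace β] {f : Sample n → β} {hf : Measurable f}
    {k : ℕ} {s : Set (SamplePath n)} (hs : MeasurableSet[filtrationOf f hf k] s)
    {ω ω' : SamplePath n} (h : ∀ t, 1 ≤ t → t ≤ k → f (ω t) = f (ω' t)) : ω ∈ s ↔ ω' ∈ s := by
  -- The sets that do not separate ω from ω' form a σ-algebra containing the generators.
  let m' : MeasurableSpace (SamplePath n) :=
    { MeasurableSet' := fun s => ω ∈ s ↔ ω' ∈ s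
      measurableSet_empty := Iff.rfl
      measurableSet_compl := fun s hs => not_congr hs
      measurableSet_iUnion := fun g hg => by
        simp only [Set.mem_iUnion]
        exact exists_congr hg }
  have hle : filtrationOf f hf k ≤ m' := by
    refine iSup₂_le fun t ht => ?_
    rintro _ ⟨u, -, rfl⟩
    change f (ω t) ∈ u ↔ f (ω' t) ∈ u
    rw [h t ht.1 ht.2]
  exact hle s hs

lemma measurable_snd_apply {k t : ℕ} (h1 : 1 ≤ t) (h2 : t ≤ k) :
    Measurable[privateFiltration n k] fun ω : SamplePath n => (ω t).2 :=
  (comap_measurable (fun ω : SamplePath n => (ω t).2)).mono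
    (le_iSup₂_of_le (f := fun (t : ℕ) (_ : 1 ≤ t ∧ t ≤ k) =>
      MeasurableSpace.comap (fun ω : SamplePath n => (ω t).2) inferInstance) t ⟨h1, h2⟩ le_rfl)
    le_rfl

variable (M : Model n)

instance (ν : ℕ∞) : IsProbabilityMeasure (M.pathLaw ν) := by
  unfold Model.pathLaw; infer_instance

/-- A path with prescribed values up to time `k`. -/
def extendPath {n : ℕ} (k : ℕ) (z : (i : Finset.Iic k) → Sample n) : SamplePath n := fun t =>
  -- The filler is arbitrary: events up to time k do not see later coordinates.
  if h : t ∈ Finset.Iic k then z ⟨t, h⟩ else (fun _ => 0, fun _ => 0)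

lemma measurable_extendPath {n : ℕ} (k : ℕ) : Measurable (extendPath (n := n) k) := by
  refine measurable_pi_lambda _ fun t => ?_
  unfold extendPath
  by_cases h : t ∈ Finset.Iic k
  · simp only [h, dif_pos]
    exact measurable_pi_apply _
  · simp only [h, dif_neg, not_false_eq_true]
    exact measurable_const

/-- Two path laws with the same labels up to time `k` agree on the events up to time `k`. -/
lemma Model.pathLaw_apply_eq {ν ν' : ℕ∞} {k : ℕ}
    (hν : ∀ t ≤ k, M.labelsAt ν t = M.labelsAt ν' t)
    {β : Type*} [MeasurableSpace β] {f : Sample n → β} {hf : Measurable f}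
    {s : Set (SamplePath n)} (hs : MeasurableSet[filtrationOf f hf k] s) :
    M.pathLaw ν s = M.pathLaw ν' s := by
  have hsm : MeasurableSet s := (filtrationOf f hf).le k s hs
  -- The event is a cylinder over the coordinates up to k, so a finite product measure determines
  -- its probability.
  have hse : s = (Finset.Iic k).restrict ⁻¹' (extendPath k ⁻¹' s) := by
    ext ω
    refine mem_iff_of_forall_eq hs fun t _ ht => ?_
    simp only [extendPath, Finset.mem_Iic, ht, dif_pos, Finset.restrict]
  have hkey : ∀ ν, M.pathLaw ν s = Measure.pi (fun i : Finset.Iic k =>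
      (M.sampleLaw (M.labelsAt ν i)).toMeasure) (extendPath k ⁻¹' s) := fun ν => by
    rw [← Measure.infinitePi_map_restrict (I := Finset.Iic k)
      (μ := fun t => (M.sampleLaw (M.labelsAt ν t)).toMeasure),
      Measure.map_apply (Finset.measurable_restrict _) (measurable_extendPath k hsm), ← hse]
    rfl
  have hfun : (fun i : Finset.Iic k => (M.sampleLaw (M.labelsAt ν i)).toMeasure) =
      fun i : Finset.Iic k => (M.sampleLaw (M.labelsAt ν' i)).toMeasure := by
    funext i
    rw [hν i (Finset.mem_Iic.1 i.2)]
  rw [hkey, hkey, hfun]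

lemma Model.labelsAt_coe_of_lt {ν t : ℕ} (h : t < ν) : M.labelsAt ν t = M.pre := by
  unfold Model.labelsAt; rw [if_pos (by exact_mod_cast h)]

lemma Model.labelsAt_coe_of_le {ν t : ℕ} (h : ν ≤ t) : M.labelsAt ν t = M.post := by
  unfold Model.labelsAt; rw [if_neg (by exact_mod_cast not_lt.2 h)]

lemma Model.labelsAt_top (t : ℕ) : M.labelsAt ⊤ t = M.pre := by
  unfold Model.labelsAt; rw [if_pos (ENat.natCast_lt_top t)]

lemma Model.pathLaw_coe_apply {ν k : ℕ} (hk : k < ν)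
    {β : Type*} [MeasurableSpace β] {f : Sample n → β} {hf : Measurable f}
    {s : Set (SamplePath n)} (hs : MeasurableSet[filtrationOf f hf k] s) :
    M.pathLaw ν s = M.pathLaw ⊤ s :=
  M.pathLaw_apply_eq (fun t ht => by
    rw [M.labelsAt_top, M.labelsAt_coe_of_lt (ht.trans_lt hk)]) hs

/-- The observation at time `t` may be resampled. -/
lemma Model.lintegral_pathLaw_update (ν : ℕ∞) (t : ℕ) {f : SamplePath n → ℝ≥0∞}
    (hf : Measurable f) :
    ∫⁻ ω, f ω ∂M.pathLaw ν = ∫⁻ ω, ∫⁻ x, f (Function.update ω t x)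
      ∂(M.sampleLaw (M.labelsAt ν t)).toMeasure ∂M.pathLaw ν :=
  lintegral_infinitePi_update _ _ t (fun _ _ => rfl) hf

/-- The change-point may be delayed by one step if the observation is resampled. -/
lemma Model.lintegral_pathLaw_succ (ν : ℕ) {f : SamplePath n → ℝ≥0∞} (hf : Measurable f) :
    ∫⁻ ω, f ω ∂M.pathLaw ν = ∫⁻ ω, ∫⁻ x, f (Function.update ω ν x)
      ∂(M.sampleLaw M.post).toMeasure ∂M.pathLaw ((ν + 1 : ℕ) : ℕ∞) := by
  have h := lintegral_infinitePi_update
    (fun t => (M.sampleLaw (M.labelsAt ν t)).toMeasure)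
    (fun t => (M.sampleLaw (M.labelsAt ((ν + 1 : ℕ) : ℕ∞) t)).toMeasure) ν (fun t ht => by
      rcases lt_or_gt_of_ne ht with h | h
      · rw [M.labelsAt_coe_of_lt h, M.labelsAt_coe_of_lt (by omega)]
      · rw [M.labelsAt_coe_of_le h.le, M.labelsAt_coe_of_le h]) hf
  rw [M.labelsAt_coe_of_le le_rfl] at h
  exact h

/-! ### The worst-case delay -/

variable {F : Filtration ℕ (inferInstance : MeasurableSpace (SamplePath n))}
  {τ : SamplePath n → ℕ∞}

/-- The delay of a stopping rule at the change-point `ν`. -/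
def delay (τ : SamplePath n → ℕ∞) (ν : ℕ) (ω : SamplePath n) : ℝ≥0∞ :=
  ((τ ω : ℕ∞) : ℝ≥0∞) + 1 - (ν : ℝ≥0∞)

/-- The way lower bounds use the worst-case delay: averaging over one past event replaces the
conditional expectation and its essential supremum. -/
lemma Model.setLIntegral_delay_le_wadd {ν : ℕ} (hν : 1 ≤ ν) {s : Set (SamplePath n)}
    (hs : MeasurableSet[F (ν - 1)] s) :
    ∫⁻ ω in s, delay τ ν ω ∂M.pathLaw ν ≤ M.wadd F τ * M.pathLaw ν s := by
  rw [← setLIntegral_condLExp (F.le (ν - 1)) (M.pathLaw ν) _ hs]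
  have hle : ∀ᵐ ω ∂M.pathLaw ν, condLExp (F (ν - 1)) (M.pathLaw ν) (delay τ ν) ω ≤ M.wadd F τ := by
    filter_upwards [ae_le_essSup (μ := M.pathLaw ν)
      (f := condLExp (F (ν - 1)) (M.pathLaw ν) (delay τ ν))] with ω hω
    exact hω.trans (le_iSup₂_of_le (f := fun (ν : ℕ) (_ : 1 ≤ ν) =>
      essSup (condLExp (F (ν - 1)) (M.pathLaw ν) (delay τ ν)) (M.pathLaw ν)) ν hν le_rfl)
  calc _ ≤ ∫⁻ _ω in s, M.wadd F τ ∂M.pathLaw ν := lintegral_mono_ae (ae_restrict_of_ae hle)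
    _ = _ := setLIntegral_const _ _

/-- Testing on the past event where the conditional delay exceeds `C` shows that this event is null;
finiteness of `C` makes the strict comparison of integrals possible. -/
lemma Model.wadd_le {C : ℝ≥0∞} (hC : C ≠ ∞)
    (h : ∀ ν, 1 ≤ ν → ∀ s, MeasurableSet[F (ν - 1)] s →
      ∫⁻ ω in s, delay τ ν ω ∂M.pathLaw ν ≤ C * M.pathLaw ν s) : M.wadd F τ ≤ C := by
  refine iSup₂_le fun ν hν => essSup_le_of_ae_le C ?_
  change condLExp (F (ν - 1)) (M.pathLaw ν) (delay τ ν) ≤ᵐ[M.pathLaw ν] fun _ => C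
  set g := condLExp (F (ν - 1)) (M.pathLaw ν) (delay τ ν) with hg
  have hgm : Measurable[F (ν - 1)] g := measurable_condLExp _ _ _
  set s : Set (SamplePath n) := {ω | C < g ω} with hs
  have hsm : MeasurableSet[F (ν - 1)] s := hgm measurableSet_Ioi
  have h1 : ∫⁻ ω in s, g ω ∂M.pathLaw ν ≤ C * M.pathLaw ν s := by
    rw [hg, setLIntegral_condLExp (F.le (ν - 1)) (M.pathLaw ν) _ hsm]
    exact h ν hν s hsm
  have hs0 : M.pathLaw ν s = 0 := by
    by_contra hne
    have h2 := setLIntegral_strict_mono (μ := M.pathLaw ν) (f := fun _ => C) (g := g)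
      ((F.le (ν - 1)) s hsm) hne (hgm.mono (F.le (ν - 1)) le_rfl) (by
        rw [setLIntegral_const]
        exact ENNReal.mul_ne_top hC (measure_ne_top _ _))
      (Eventually.of_forall fun ω hω => hω)
    rw [setLIntegral_const] at h2
    exact absurd h1 (not_le.2 h2)
  rw [EventuallyLE, ae_iff]
  simpa [hs] using hs0

/-! ### Tail sums -/

lemma enat_toENNReal_eq_tsum (a : ℕ∞) :
    ((a : ℕ∞) : ℝ≥0∞) = ∑' j : ℕ, if (j : ℕ∞) < a then (1 : ℝ≥0∞) else 0 := by
  induction a using ENat.recTopCoe with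
  | top => simp
  | coe m =>
    rw [tsum_eq_sum (s := Finset.range m)]
    · rw [Finset.sum_congr rfl (g := fun _ => (1 : ℝ≥0∞))]
      · simp
      · intro j hj
        rw [if_pos (by exact_mod_cast Finset.mem_range.1 hj)]
    · intro j hj
      rw [if_neg]
      have := Finset.mem_range.not.1 hj
      exact_mod_cast this

/-- The delay counts the times from ν on at which the rule is still running, plus one; equality can
fail only because the left side is truncated for early stops. -/
lemma delay_le_tsum (τ : SamplePath n → ℕ∞) (ν : ℕ) (ω : SamplePath n) :
    delay τ ν ω ≤ 1 + ∑' j : ℕ, if ((ν + j : ℕ) : ℕ∞) < τ ω then (1 : ℝ≥0∞) else 0 := by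
  unfold delay
  have h : ∀ a : ℕ∞, (∑' j : ℕ, if ((ν + j : ℕ) : ℕ∞) < a then (1 : ℝ≥0∞) else 0) =
      ((a - ν : ℕ∞) : ℝ≥0∞) := fun a => by
    rw [enat_toENNReal_eq_tsum]
    refine tsum_congr fun j => ?_
    congr 1
    rw [lt_tsub_iff_left]
    push_cast
    rfl
  rw [h]
  induction τ ω using ENat.recTopCoe with
  | top => simp
  | coe m =>
    rw [tsub_le_iff_right]
    have : ((m : ℕ∞) - ν : ℕ∞) = ((m - ν : ℕ) : ℕ∞) := by push_cast; rfl
    rw [this]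
    have h2 : m + 1 ≤ 1 + (m - ν) + ν := by omega
    simp only [ENat.toENNReal_coe]
    exact_mod_cast h2

lemma measurableSet_coe_lt (hτ : IsStoppingTime F τ) (j : ℕ) :
    MeasurableSet[F j] {ω | (j : ℕ∞) < τ ω} := by
  have : {ω | (j : ℕ∞) < τ ω} = {ω | τ ω ≤ j}ᶜ := by
    ext ω; simp
  rw [this]
  exact (hτ j).compl

lemma Model.arl_eq_tsum (hτ : IsStoppingTime F τ) :
    M.arl τ = ∑' j : ℕ, M.pathLaw ⊤ {ω | (j : ℕ∞) < τ ω} := by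
  unfold Model.arl
  simp_rw [enat_toENNReal_eq_tsum]
  have hm : ∀ j : ℕ, MeasurableSet {ω | (j : ℕ∞) < τ ω} := fun j =>
    F.le j _ (measurableSet_coe_lt hτ j)
  have hind : ∀ j : ℕ, (fun ω => if (j : ℕ∞) < τ ω then (1 : ℝ≥0∞) else 0) =
      Set.indicator {ω | (j : ℕ∞) < τ ω} (fun _ => 1) := fun j => by
    ext ω; simp [Set.indicator_apply]
  rw [lintegral_tsum fun j => ?_]
  · refine tsum_congr fun j => ?_
    rw [hind, lintegral_indicator_const (hm j), one_mul]
  · rw [hind]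
    exact (measurable_const.indicator (hm j)).aemeasurable

end Path


/-! ### The detection statistic -/

section Stat

variable {n : ℕ} (M : Model n) (est : SignedGraph n → Labels n)

/-- The log-likelihood ratio of the labels `σ` and the pre-change labels. -/
def Model.llrOf (σ : Labels n) (A : SignedGraph n) : ℝ :=
  Real.log (likelihood M.pTilde M.zetaTilde σ A / likelihood M.pTilde M.zetaTilde M.pre A)

lemma Model.exp_llrOf (σ : Labels n) (A : SignedGraph n) : Real.exp (M.llrOf σ A) =
    likelihood M.pTilde M.zetaTilde σ A / likelihood M.pTilde M.zetaTilde M.pre A :=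
  Real.exp_log (div_pos (M.likelihood_pos σ A) (M.likelihood_pos M.pre A))

lemma Model.stat_one (ω : SamplePath n) : M.stat est ω 1 = 0 := by simp [Model.stat]

lemma Model.stat_succ (ω : SamplePath n) {t : ℕ} (ht : 1 ≤ t) :
    M.stat est ω (t + 1) =
      max (M.stat est ω t) 0 + M.llrOf (est (ω t).2) (ω (t + 1)).2 := by
  obtain ⟨t, rfl⟩ : ∃ s, t = s + 1 := ⟨t - 1, by omega⟩
  rfl

lemma Model.stat_congr {ω ω' : SamplePath n} {t : ℕ}
    (h : ∀ j, 1 ≤ j → j ≤ t → (ω j).2 = (ω' j).2) : M.stat est ω t = M.stat est ω' t := by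
  induction t with
  | zero => rfl
  | succ t ih =>
    rcases Nat.eq_zero_or_pos t with rfl | ht
    · rw [M.stat_one, M.stat_one]
    · rw [M.stat_succ est ω ht, M.stat_succ est ω' ht, ih fun j h1 h2 => h j h1 (by omega),
        h t ht (by omega), h (t + 1) (by omega) le_rfl]

lemma Model.measurable_stat {t k : ℕ} (htk : t ≤ k) :
    Measurable[privateFiltration n k] fun ω => M.stat est ω t := by
  induction t with
  | zero => exact measurable_const
  | succ t ih =>
    rcases Nat.eq_zero_or_pos t with rfl | ht
    · simp only [zero_add, M.stat_one]
      exact measurable_const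
    · have h1 := measurable_snd_apply (n := n) (k := k) ht (by omega)
      have h2 := measurable_snd_apply (n := n) (k := k) (t := t + 1) (by omega) htk
      have h3 := (measurable_of_finite
        (fun x : SignedGraph n × SignedGraph n => M.llrOf (est x.1) x.2)).comp (h1.prodMk h2)
      have h4 := ((ih (by omega)).max (measurable_const (a := (0 : ℝ)))).add h3
      have hfun : (fun ω => M.stat est ω (t + 1)) = fun ω : SamplePath n =>
          max (M.stat est ω t) 0 + M.llrOf (est (ω t).2) (ω (t + 1)).2 :=
        funext fun ω => M.stat_succ est ω ht
      rw [hfun]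
      exact h4

/-- The procedure has not stopped up to time `t`. -/
def Model.alive (b : ℝ) (t : ℕ) : Set (SamplePath n) :=
  {ω | ∀ j, 1 ≤ j → j ≤ t → M.stat est ω j < b}

lemma Model.coe_lt_TL_iff (b : ℝ) (t : ℕ) (ω : SamplePath n) :
    (t : ℕ∞) < M.TL est b ω ↔ ω ∈ M.alive est b t := by
  have h : (t : ℕ∞) < M.TL est b ω ↔ ((t + 1 : ℕ) : ℕ∞) ≤ M.TL est b ω := by
    push_cast
    exact (Order.add_one_le_iff_of_not_isMax (by simp)).symm
  rw [h]
  unfold Model.TL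
  simp only [le_iInf_iff, Nat.cast_le, Model.alive, Set.mem_ofPred_eq]
  constructor
  · intro h j h1 h2
    by_contra hcon
    have := h j ⟨h1, not_lt.1 hcon⟩
    omega
  · rintro h j ⟨h1, h2⟩
    by_contra hcon
    exact absurd h2 (not_le.2 (h j h1 (by omega)))

lemma Model.setOf_coe_lt_TL (b : ℝ) (t : ℕ) :
    {ω | (t : ℕ∞) < M.TL est b ω} = M.alive est b t := by
  ext ω
  exact M.coe_lt_TL_iff est b t ω

lemma Model.measurableSet_alive (b : ℝ) (t : ℕ) :
    MeasurableSet[privateFiltration n t] (M.alive est b t) := by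
  have : M.alive est b t = ⋂ (j : ℕ) (_ : 1 ≤ j) (_ : j ≤ t), {ω | M.stat est ω j < b} := by
    ext ω
    simp [Model.alive]
  rw [this]
  refine MeasurableSet.iInter fun j => MeasurableSet.iInter fun _ => MeasurableSet.iInter fun h2 => ?_
  exact M.measurable_stat est h2 measurableSet_Iio

lemma Model.isStoppingTime_TL (b : ℝ) : IsStoppingTime (privateFiltration n) (M.TL est b) := by
  intro t
  have : {ω | M.TL est b ω ≤ (t : ℕ)} = (M.alive est b t)ᶜ := by
    ext ω
    rw [Set.mem_compl_iff, ← M.coe_lt_TL_iff, not_lt]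
    rfl
  have h := (M.measurableSet_alive est b t).compl
  rw [← this] at h
  exact h

lemma Model.alive_succ (b : ℝ) (t : ℕ) (ω : SamplePath n) :
    ω ∈ M.alive est b (t + 1) ↔ ω ∈ M.alive est b t ∧ M.stat est ω (t + 1) < b := by
  constructor
  · intro h
    exact ⟨fun j h1 h2 => h j h1 (by omega), h (t + 1) (by omega) le_rfl⟩
  · rintro ⟨h, h'⟩ j h1 h2
    rcases Nat.lt_or_ge t j with h3 | h3
    · obtain rfl : j = t + 1 := by omega
      exact h'
    · exact h j h1 h3

lemma Model.alive_congr {b : ℝ} {t : ℕ} {ω ω' : SamplePath n}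
    (h : ∀ j, 1 ≤ j → j ≤ t → (ω j).2 = (ω' j).2) :
    ω ∈ M.alive est b t ↔ ω' ∈ M.alive est b t :=
  mem_iff_of_forall_eq (M.measurableSet_alive est b t) h

lemma Model.alive_one {b : ℝ} (hb : 0 < b) : M.alive est b 1 = Set.univ := by
  refine Set.eq_univ_of_forall fun ω j h1 h2 => ?_
  obtain rfl : j = 1 := by omega
  rwa [M.stat_one]

/-- Conditional expectations of functions of the next privatized graph. -/
lemma Model.lintegral_next (ν : ℕ∞) (t : ℕ) {φ : SamplePath n → SignedGraph n → ℝ}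
    (hφ : ∀ ω B, 0 ≤ φ ω B) (hm : ∀ B, Measurable fun ω => φ ω B)
    (hinv : ∀ ω x B, φ (Function.update ω t x) B = φ ω B) :
    ∫⁻ ω, ENNReal.ofReal (φ ω (ω t).2) ∂M.pathLaw ν =
      ∫⁻ ω, ENNReal.ofReal (M.expect (M.labelsAt ν t) (φ ω)) ∂M.pathLaw ν := by
  have hmeas : Measurable fun ω : SamplePath n => ENNReal.ofReal (φ ω (ω t).2) := by
    have h1 : Measurable fun p : SamplePath n × SignedGraph n => φ p.1 p.2 :=
      measurable_from_prod_countable_left hm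
    exact (h1.comp (measurable_id.prodMk (measurable_snd.comp (measurable_pi_apply t)))).ennreal_ofReal
  rw [M.lintegral_pathLaw_update ν t hmeas]
  refine lintegral_congr fun ω => ?_
  simp only [Function.update_self, hinv]
  exact M.lintegral_sampleLaw_ofReal _ (hφ ω)

end Stat


/-! ### Run length and delay of the procedure. -/

section Bounds

variable {n : ℕ} (M : Model n) (est : SignedGraph n → Labels n)

lemma Model.measurableSet_alive' (b : ℝ) (t : ℕ) : MeasurableSet (M.alive est b t) :=
  (privateFiltration n).le t _ (M.measurableSet_alive est b t)

lemma Model.measurable_stat' (t : ℕ) : Measurable fun ω => M.stat est ω t :=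
  (M.measurable_stat est le_rfl).mono ((privateFiltration n).le t) le_rfl

lemma measurable_comp_snd_apply {β : Type*} [MeasurableSpace β] (f : SignedGraph n → β) (t : ℕ) :
    Measurable fun ω : SamplePath n => f (ω t).2 :=
  (measurable_of_finite f).comp (measurable_snd.comp (measurable_pi_apply t))

lemma update_snd_apply {ω : SamplePath n} {x : Sample n} {s j : ℕ} (h : j ≠ s) :
    (Function.update ω s x j).2 = (ω j).2 := by
  rw [Function.update_of_ne h]

lemma Model.stat_update {ω : SamplePath n} {x : Sample n} {t s : ℕ} (h : t < s) :
    M.stat est (Function.update ω s x) t = M.stat est ω t :=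
  M.stat_congr est fun _ _ hj => update_snd_apply (by omega)

lemma Model.alive_update {b : ℝ} {ω : SamplePath n} {x : Sample n} {t s : ℕ} (h : t < s) :
    Function.update ω s x ∈ M.alive est b t ↔ ω ∈ M.alive est b t :=
  M.alive_congr est fun _ _ hj => update_snd_apply (by omega)

/-! ### The average run length -/

lemma exp_max_zero (s : ℝ) : Real.exp (max s 0) = max (Real.exp s) 1 := by
  rw [Real.exp_monotone.map_max, Real.exp_zero]

/-- Valid for every label vector, so false-alarm control asks nothing of the estimator. -/
lemma Model.expect_exp_llrOf (σ : Labels n) :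
    M.expect M.pre (fun B => Real.exp (M.llrOf σ B)) = 1 := by
  rw [M.expect_eq, ← M.sum_likelihood σ]
  refine Finset.sum_congr rfl fun B _ => ?_
  rw [M.exp_llrOf, mul_div_cancel₀ _ (M.likelihood_pos M.pre B).ne']

lemma Model.expect_const (σ : Labels n) (c : ℝ) : M.expect σ (fun _ => c) = c :=
  prodExp_const (M.sum_wt σ) c

open Classical in
-- Given the past, e^(S⁺) times the next likelihood ratio has mean e^(S⁺), and max(x, 1) ≤ x + 1, so
-- max(e^S, 1) gains at most one in mean; a path that crosses now carries at least e^b. The crossing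
-- probability is written as two survival probabilities on opposite sides to avoid truncated
-- subtraction.
lemma Model.lintegral_exp_stat_step {b : ℝ} {t : ℕ} (ht : 1 ≤ t) :
    ∫⁻ ω in M.alive est b (t + 1), ENNReal.ofReal (max (Real.exp (M.stat est ω (t + 1))) 1)
        ∂M.pathLaw ⊤ + ENNReal.ofReal (Real.exp b) * M.pathLaw ⊤ (M.alive est b t) ≤
      ∫⁻ ω in M.alive est b t, ENNReal.ofReal (max (Real.exp (M.stat est ω t)) 1) ∂M.pathLaw ⊤ +
        M.pathLaw ⊤ (M.alive est b t) +
        ENNReal.ofReal (Real.exp b) * M.pathLaw ⊤ (M.alive est b (t + 1)) := by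
  set φ : SamplePath n → SignedGraph n → ℝ := fun ω B => if ω ∈ M.alive est b t then
    max (Real.exp (max (M.stat est ω t) 0 + M.llrOf (est (ω t).2) B)) 1 else 0 with hφ
  have hA := M.measurableSet_alive' est b t
  have hA1 := M.measurableSet_alive' est b (t + 1)
  have hnext := M.lintegral_next ⊤ (t + 1) (φ := φ) (fun ω B => by
      simp only [hφ]; split_ifs <;> positivity)
    (fun B => Measurable.ite hA
      (((Real.measurable_exp.comp (((M.measurable_stat' est t).max measurable_const).add
        (measurable_comp_snd_apply (fun A => M.llrOf (est A) B) t)))).max measurable_const)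
      measurable_const)
    (fun ω x B => by
      simp only [hφ, M.alive_update est (Nat.lt_succ_self t), M.stat_update est (Nat.lt_succ_self t),
        update_snd_apply (Nat.lt_succ_self t).ne])
  rw [M.labelsAt_top] at hnext
  have hexp : ∀ ω, M.expect M.pre (φ ω) ≤ if ω ∈ M.alive est b t then
      max (Real.exp (M.stat est ω t)) 1 + 1 else 0 := by
    intro ω
    by_cases hω : ω ∈ M.alive est b t
    · simp only [hφ, hω, if_true]
      calc _ ≤ M.expect M.pre (fun B => Real.exp (max (M.stat est ω t) 0) *
            Real.exp (M.llrOf (est (ω t).2) B) + 1) := by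
            refine prodExp_mono (M.wt_nonneg _) fun B => ?_
            rw [← Real.exp_add]
            exact max_le (by linarith) (by linarith [Real.exp_pos (max (M.stat est ω t) 0 +
              M.llrOf (est (ω t).2) B)])
        _ = _ := by
            have h1 := M.expect_exp_llrOf (est (ω t).2)
            unfold Model.expect at h1 ⊢
            rw [prodExp_add, prodExp_const_mul, h1, prodExp_const (M.sum_wt _), exp_max_zero,
              mul_one]
    · simp only [hφ, hω, if_false]
      exact (M.expect_const M.pre 0).le
  have hpt : ∀ ω, (M.alive est b (t + 1)).indicator (fun ω =>
        ENNReal.ofReal (max (Real.exp (M.stat est ω (t + 1))) 1)) ω +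
        (M.alive est b t).indicator (fun _ => ENNReal.ofReal (Real.exp b)) ω ≤
      ENNReal.ofReal (φ ω (ω (t + 1)).2) +
        (M.alive est b (t + 1)).indicator (fun _ => ENNReal.ofReal (Real.exp b)) ω := by
    intro ω
    by_cases h0 : ω ∈ M.alive est b t
    · have hval : φ ω (ω (t + 1)).2 = max (Real.exp (M.stat est ω (t + 1))) 1 := by
        simp only [hφ, h0, if_true]
        rw [M.stat_succ est ω ht]
      rw [hval]
      by_cases h1 : ω ∈ M.alive est b (t + 1)
      · simp [h0, h1]
      · simp only [h0, h1, Set.indicator_of_mem, Set.indicator_of_notMem, not_false_eq_true,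
          zero_add, add_zero]
        have : b ≤ M.stat est ω (t + 1) := by
          by_contra hcon
          exact h1 ((M.alive_succ est b t ω).2 ⟨h0, not_le.1 hcon⟩)
        exact ENNReal.ofReal_le_ofReal (le_max_of_le_left (Real.exp_le_exp.2 this))
    · have h1 : ω ∉ M.alive est b (t + 1) := fun h => h0 ((M.alive_succ est b t ω).1 h).1
      simp [h0, h1]
  calc _ = ∫⁻ ω, ((M.alive est b (t + 1)).indicator (fun ω =>
        ENNReal.ofReal (max (Real.exp (M.stat est ω (t + 1))) 1)) ω +
        (M.alive est b t).indicator (fun _ => ENNReal.ofReal (Real.exp b)) ω) ∂M.pathLaw ⊤ := by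
        rw [lintegral_add_right _ (measurable_const.indicator hA), lintegral_indicator hA1,
          lintegral_indicator_const hA]
    _ ≤ ∫⁻ ω, (ENNReal.ofReal (φ ω (ω (t + 1)).2) +
        (M.alive est b (t + 1)).indicator (fun _ => ENNReal.ofReal (Real.exp b)) ω) ∂M.pathLaw ⊤ :=
        lintegral_mono hpt
    _ = ∫⁻ ω, ENNReal.ofReal (M.expect M.pre (φ ω)) ∂M.pathLaw ⊤ +
        ENNReal.ofReal (Real.exp b) * M.pathLaw ⊤ (M.alive est b (t + 1)) := by
        rw [lintegral_add_right _ (measurable_const.indicator hA1), hnext,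
          lintegral_indicator_const hA1]
    _ ≤ ∫⁻ ω, ((M.alive est b t).indicator (fun ω =>
          ENNReal.ofReal (max (Real.exp (M.stat est ω t)) 1)) ω +
          (M.alive est b t).indicator (fun _ => 1) ω) ∂M.pathLaw ⊤ +
        ENNReal.ofReal (Real.exp b) * M.pathLaw ⊤ (M.alive est b (t + 1)) := by
        gcongr with ω
        refine (ENNReal.ofReal_le_ofReal (hexp ω)).trans ?_
        by_cases h0 : ω ∈ M.alive est b t
        · simp only [h0, if_true, Set.indicator_of_mem]
          rw [ENNReal.ofReal_add (by positivity) zero_le_one, ENNReal.ofReal_one]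
        · simp [h0]
    _ = _ := by
        rw [lintegral_add_right _ (measurable_const.indicator hA), lintegral_indicator hA,
          lintegral_indicator_const hA, one_mul]

/-- Telescoped form of the one-step inequality, started from S_1 = 0. As N → ∞ it bounds the run
length, and for fixed N the false-alarm probability. -/
lemma Model.exp_le_sum_alive {b : ℝ} (hb : 0 < b) {N : ℕ} (hN : 1 ≤ N) :
    ENNReal.ofReal (Real.exp b) ≤ ∑ t ∈ Finset.range N, M.pathLaw ⊤ (M.alive est b t) +
      ENNReal.ofReal (Real.exp b) * M.pathLaw ⊤ (M.alive est b N) := by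
  suffices h : ∫⁻ ω in M.alive est b N, ENNReal.ofReal (max (Real.exp (M.stat est ω N)) 1)
      ∂M.pathLaw ⊤ + ENNReal.ofReal (Real.exp b) ≤
      ∑ t ∈ Finset.range N, M.pathLaw ⊤ (M.alive est b t) +
      ENNReal.ofReal (Real.exp b) * M.pathLaw ⊤ (M.alive est b N) from le_add_self.trans h
  induction N, hN using Nat.le_induction with
  | base =>
    have h0 : M.alive est b 0 = Set.univ := Set.eq_univ_of_forall fun ω j h1 h2 => by omega
    simp [M.alive_one est hb, h0, M.stat_one]
  | succ N hN ih =>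
    have hstep := M.lintegral_exp_stat_step est (b := b) hN
    set E := ENNReal.ofReal (Real.exp b)
    set p := M.pathLaw ⊤ (M.alive est b N)
    have hp : E * p ≠ ∞ := ENNReal.mul_ne_top ENNReal.ofReal_ne_top (measure_ne_top _ _)
    rw [Finset.sum_range_succ]
    refine (ENNReal.add_le_add_iff_right hp).1 ?_
    calc _ = (∫⁻ ω in M.alive est b (N + 1),
          ENNReal.ofReal (max (Real.exp (M.stat est ω (N + 1))) 1) ∂M.pathLaw ⊤ + E * p) + E := by
          ring
      _ ≤ _ + E := add_le_add_left hstep _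
      _ = (∫⁻ ω in M.alive est b N, ENNReal.ofReal (max (Real.exp (M.stat est ω N)) 1)
          ∂M.pathLaw ⊤ + E) + (p + E * M.pathLaw ⊤ (M.alive est b (N + 1))) := by ring
      _ ≤ _ := add_le_add_left ih _
      _ = _ := by ring

/-- The average run length of the procedure is at least `exp b`. -/
lemma Model.exp_le_arl_TL {b : ℝ} (hb : 0 < b) :
    ENNReal.ofReal (Real.exp b) ≤ M.arl (M.TL est b) := by
  rw [M.arl_eq_tsum (M.isStoppingTime_TL est b)]
  simp_rw [M.setOf_coe_lt_TL]
  -- A finite sum forces the survival probability to zero, which removes the remainder term.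
  by_cases htop : ∑' t, M.pathLaw ⊤ (M.alive est b t) = ∞
  · rw [htop]; exact le_top
  have h0 := ENNReal.tendsto_atTop_zero_of_tsum_ne_top htop
  have hlim : Tendsto (fun N => ∑' t, M.pathLaw ⊤ (M.alive est b t) +
      ENNReal.ofReal (Real.exp b) * M.pathLaw ⊤ (M.alive est b N)) atTop
      (𝓝 (∑' t, M.pathLaw ⊤ (M.alive est b t) + ENNReal.ofReal (Real.exp b) * 0)) :=
    tendsto_const_nhds.add (ENNReal.Tendsto.const_mul h0 (Or.inr ENNReal.ofReal_ne_top))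
  rw [mul_zero, add_zero] at hlim
  refine ge_of_tendsto hlim ?_
  filter_upwards [eventually_ge_atTop 1] with N hN
  exact (M.exp_le_sum_alive est hb hN).trans (add_le_add_left (ENNReal.sum_le_tsum _) _)

/-- The probability of a false alarm up to time `m`. -/
lemma Model.pathLaw_top_compl_alive_le {b : ℝ} (hb : 0 < b) {m : ℕ} (hm : 1 ≤ m) :
    M.pathLaw ⊤ (M.alive est b m)ᶜ ≤ ENNReal.ofReal (m / Real.exp b) := by
  have h := M.exp_le_sum_alive est hb hm
  have hsum : ∑ t ∈ Finset.range m, M.pathLaw ⊤ (M.alive est b t) ≤ m := by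
    calc _ ≤ ∑ t ∈ Finset.range m, (1 : ℝ≥0∞) := Finset.sum_le_sum fun _ _ => prob_le_one
      _ = m := by simp
  have hE : ENNReal.ofReal (Real.exp b) ≠ 0 := by simpa using Real.exp_pos b
  have h2 : ENNReal.ofReal (Real.exp b) * M.pathLaw ⊤ (M.alive est b m)ᶜ ≤ m := by
    rw [prob_compl_eq_one_sub (M.measurableSet_alive' est b m), ENNReal.mul_sub fun _ _ =>
      ENNReal.ofReal_ne_top, mul_one, tsub_le_iff_right]
    exact h.trans (add_le_add_left hsum _)
  rw [ENNReal.ofReal_div_of_pos (Real.exp_pos b), ENNReal.ofReal_natCast,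
    ENNReal.le_div_iff_mul_le (Or.inl hE) (Or.inl ENNReal.ofReal_ne_top), mul_comm]
  exact h2

/-! ### The delay of the procedure -/

open Classical in
-- One-step decrease of a potential: remaining distance to b + Lc plus a penalty `K` for a failed
-- current estimate. A wrong estimate spoils only the next increment, and the penalty already stored
-- pays for it, while failures of the new graph cost `K` times the failure probability on average.
-- This removes the dependence between consecutive increments.
lemma Model.lintegral_drift_step {b Lc K I' : ℝ} (hb : 0 < b) (hK : 0 ≤ K)
    (hI' : 0 ≤ I')
    (hdrift : ∀ A, I' + K * M.failProb est ≤
      M.expect M.post (fun B => min (M.llrOf (est A) B) Lc) +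
        K * if recovered est M.post A then 0 else 1)
    {ν t : ℕ} (hν : 1 ≤ ν) (ht : ν ≤ t) {s : Set (SamplePath n)} (hsm : MeasurableSet s)
    (hs : ∀ ω x j, ν ≤ j → (Function.update ω j x ∈ s ↔ ω ∈ s)) :
    ∫⁻ ω in s ∩ M.alive est b (t + 1), ENNReal.ofReal (max (b + Lc - max (M.stat est ω (t + 1)) 0) 0
        + K * if recovered est M.post (ω (t + 1)).2 then 0 else 1) ∂M.pathLaw ν +
        ENNReal.ofReal I' * M.pathLaw ν (s ∩ M.alive est b t) ≤
      ∫⁻ ω in s ∩ M.alive est b t, ENNReal.ofReal (max (b + Lc - max (M.stat est ω t) 0) 0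
        + K * if recovered est M.post (ω t).2 then 0 else 1) ∂M.pathLaw ν := by
  set φ : SamplePath n → SignedGraph n → ℝ := fun ω B => if ω ∈ s ∩ M.alive est b t then
    max (b + Lc - max (max (M.stat est ω t) 0 + M.llrOf (est (ω t).2) B) 0) 0 +
      K * (if recovered est M.post B then 0 else 1) else 0 with hφ
  have hA := hsm.inter (M.measurableSet_alive' est b t)
  have hA1 := hsm.inter (M.measurableSet_alive' est b (t + 1))
  have hbad : ∀ B, (0 : ℝ) ≤ K * (if recovered est M.post B then 0 else 1) := fun B => by
    split_ifs <;> simp [hK]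
  have hnext := M.lintegral_next ν (t + 1) (φ := φ) (fun ω B => by
      simp only [hφ]; split_ifs <;> first | exact add_nonneg (le_max_right _ _) (by simp [hK]) | simp)
    (fun B => Measurable.ite hA
      (((measurable_const.sub ((((M.measurable_stat' est t).max measurable_const).add
        (measurable_comp_snd_apply (fun A => M.llrOf (est A) B) t)).max measurable_const)).max
        measurable_const).add measurable_const)
      measurable_const)
    (fun ω x B => by
      simp only [hφ, Set.mem_inter_iff, M.alive_update est (Nat.lt_succ_self t),
        M.stat_update est (Nat.lt_succ_self t), hs ω x (t + 1) (by omega),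
        update_snd_apply (Nat.lt_succ_self t).ne])
  rw [M.labelsAt_coe_of_le (show ν ≤ t + 1 by omega)] at hnext
  have hexp : ∀ ω ∈ s ∩ M.alive est b t, M.expect M.post (φ ω) + I' ≤
      max (b + Lc - max (M.stat est ω t) 0) 0 +
        K * if recovered est M.post (ω t).2 then 0 else 1 := by
    intro ω hω
    have hstat : M.stat est ω t < b := hω.2 t (hν.trans ht) le_rfl
    have hmax : max (M.stat est ω t) 0 ≤ b := max_le hstat.le hb.le
    simp only [hφ, hω, if_true]
    have h1 : M.expect M.post (fun B =>
        max (b + Lc - max (max (M.stat est ω t) 0 + M.llrOf (est (ω t).2) B) 0) 0 +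
        K * (if recovered est M.post B then 0 else 1)) ≤
        M.expect M.post (fun B => ((b + Lc - max (M.stat est ω t) 0) -
          min (M.llrOf (est (ω t).2) B) Lc) +
          K * (if recovered est M.post B then 0 else 1)) := by
      refine prodExp_mono (M.wt_nonneg _) fun B => ?_
      gcongr
      have hmin1 := min_le_left (M.llrOf (est (ω t).2) B) Lc
      have hmin2 := min_le_right (M.llrOf (est (ω t).2) B) Lc
      -- Truncation at `Lc` keeps the remaining distance nonnegative when S⁺ ≤ b, so the outer
      -- positive part costs nothing.
      refine max_le ?_ (by linarith)
      have := le_max_left (max (M.stat est ω t) 0 + M.llrOf (est (ω t).2) B) 0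
      linarith
    have h2 : M.expect M.post (fun B => ((b + Lc - max (M.stat est ω t) 0) -
          min (M.llrOf (est (ω t).2) B) Lc) +
          K * (if recovered est M.post B then 0 else 1)) =
        b + Lc - max (M.stat est ω t) 0 - M.expect M.post (fun B => min (M.llrOf (est (ω t).2) B) Lc)
          + K * M.failProb est := by
      unfold Model.failProb Model.expect
      rw [prodExp_add, prodExp_sub, prodExp_const (M.sum_wt _), prodExp_const_mul]
    have h3 := hdrift (ω t).2
    have h4 := le_max_left (b + Lc - max (M.stat est ω t) 0) 0
    linarith
  calc _ = ∫⁻ ω, ((s ∩ M.alive est b (t + 1)).indicator (fun ω =>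
        ENNReal.ofReal (max (b + Lc - max (M.stat est ω (t + 1)) 0) 0
        + K * if recovered est M.post (ω (t + 1)).2 then 0 else 1)) ω +
        (s ∩ M.alive est b t).indicator (fun _ => ENNReal.ofReal I') ω) ∂M.pathLaw ν := by
        rw [lintegral_add_right _ (measurable_const.indicator hA), lintegral_indicator hA1,
          lintegral_indicator_const hA]
    _ ≤ ∫⁻ ω, (ENNReal.ofReal (φ ω (ω (t + 1)).2) +
        (s ∩ M.alive est b t).indicator (fun _ => ENNReal.ofReal I') ω) ∂M.pathLaw ν := by
        refine lintegral_mono fun ω => ?_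
        refine add_le_add_left ?_ _
        by_cases h1 : ω ∈ s ∩ M.alive est b (t + 1)
        · have h0 : ω ∈ s ∩ M.alive est b t := ⟨h1.1, ((M.alive_succ est b t ω).1 h1.2).1⟩
          rw [Set.indicator_of_mem h1]
          simp only [hφ, h0, if_true]
          rw [M.stat_succ est ω (hν.trans ht)]
        · rw [Set.indicator_of_notMem h1]; exact zero_le
    _ = ∫⁻ ω, (ENNReal.ofReal (M.expect M.post (φ ω)) +
        (s ∩ M.alive est b t).indicator (fun _ => ENNReal.ofReal I') ω) ∂M.pathLaw ν := by
        rw [lintegral_add_right _ (measurable_const.indicator hA),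
          lintegral_add_right _ (measurable_const.indicator hA), hnext]
    _ ≤ ∫⁻ ω, (s ∩ M.alive est b t).indicator (fun ω =>
        ENNReal.ofReal (max (b + Lc - max (M.stat est ω t) 0) 0
        + K * if recovered est M.post (ω t).2 then 0 else 1)) ω ∂M.pathLaw ν := by
        refine lintegral_mono fun ω => ?_
        by_cases h0 : ω ∈ s ∩ M.alive est b t
        · simp only [h0, Set.indicator_of_mem]
          rw [← ENNReal.ofReal_add _ hI']
          · exact ENNReal.ofReal_le_ofReal (hexp ω h0)
          · refine prodExp_nonneg (M.wt_nonneg _) fun B => ?_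
            simp only [hφ, h0, if_true]
            exact add_nonneg (le_max_right _ _) (hbad B)
        · have : φ ω = fun _ => 0 := by ext B; simp only [hφ, h0, if_false]
          simp only [h0, Set.indicator_of_notMem, not_false_eq_true, this, M.expect_const]
          simp
    _ = _ := by rw [lintegral_indicator hA]

open Classical in
/-- The worst-case delay of the procedure, in terms of a lower bound `I'` for the drift of the
statistic with increments truncated at `Lc`. -/
lemma Model.wadd_TL_le {b Lc K I' : ℝ} (hb : 0 < b) (hLc : 0 < Lc) (hK : 0 ≤ K)
    (hI' : 0 < I')
    (hdrift : ∀ A, I' + K * M.failProb est ≤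
      M.expect M.post (fun B => min (M.llrOf (est A) B) Lc) +
        K * if recovered est M.post A then 0 else 1)
    {β : Type*} [MeasurableSpace β] {f : Sample n → β} (hf : Measurable f) :
    M.wadd (filtrationOf f hf) (M.TL est b) ≤
      ENNReal.ofReal (1 + (b + Lc + K * M.failProb est) / I') := by
  have hδ := M.failProb_nonneg est
  refine M.wadd_le ENNReal.ofReal_ne_top fun ν hν s hs => ?_
  have hsm : MeasurableSet s := (filtrationOf f hf).le _ s hs
  -- All that is used of the filtration: past events ignore the observations from ν on.
  have hinv : ∀ ω x j, ν ≤ j → (Function.update ω j x ∈ s ↔ ω ∈ s) := fun ω x j hj =>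
    mem_iff_of_forall_eq hs fun t _ ht => by rw [Function.update_of_ne (by omega)]
  set P := M.pathLaw ν with hP
  set c : ℕ → ℝ≥0∞ := fun t => ∫⁻ ω in s ∩ M.alive est b t,
    ENNReal.ofReal (max (b + Lc - max (M.stat est ω t) 0) 0
        + K * if recovered est M.post (ω t).2 then 0 else 1) ∂P with hc
  have hstep : ∀ t, ν ≤ t → c (t + 1) + ENNReal.ofReal I' * P (s ∩ M.alive est b t) ≤ c t :=
    fun t ht => M.lintegral_drift_step est hb hK hI'.le hdrift hν ht hsm hinv
  have hsum : ∀ N, c (ν + N) + ENNReal.ofReal I' *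
      ∑ j ∈ Finset.range N, P (s ∩ M.alive est b (ν + j)) ≤ c ν := by
    intro N
    induction N with
    | zero => simp
    | succ N ih =>
      rw [Finset.sum_range_succ, mul_add]
      calc _ = (c (ν + N + 1) + ENNReal.ofReal I' * P (s ∩ M.alive est b (ν + N))) +
            ENNReal.ofReal I' * ∑ j ∈ Finset.range N, P (s ∩ M.alive est b (ν + j)) := by
            rw [show ν + (N + 1) = ν + N + 1 from rfl]; ring
        _ ≤ c (ν + N) + ENNReal.ofReal I' * ∑ j ∈ Finset.range N, P (s ∩ M.alive est b (ν + j)) :=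
            add_le_add_left (hstep _ (by omega)) _
        _ ≤ _ := ih
  -- At time ν the distance is at most b + Lc whatever the past, and the graph at ν is already
  -- post-change and independent of `s`.
  have hinit : c ν ≤ ENNReal.ofReal (b + Lc + K * M.failProb est) * P s := by
    have hnext := M.lintegral_next ν ν (φ := fun ω B => if ω ∈ s then
        b + Lc + K * (if recovered est M.post B then 0 else 1) else 0)
      (fun ω B => by split_ifs <;> simp <;> positivity)
      (fun B => Measurable.ite hsm measurable_const measurable_const)
      (fun ω x B => by simp only [hinv ω x ν le_rfl])
    rw [M.labelsAt_coe_of_le le_rfl] at hnext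
    calc c ν = ∫⁻ ω, (s ∩ M.alive est b ν).indicator (fun ω =>
          ENNReal.ofReal (max (b + Lc - max (M.stat est ω ν) 0) 0
          + K * if recovered est M.post (ω ν).2 then 0 else 1)) ω ∂P := by
          rw [lintegral_indicator (hsm.inter (M.measurableSet_alive' est b ν))]
      _ ≤ ∫⁻ ω, ENNReal.ofReal (if ω ∈ s then
          b + Lc + K * (if recovered est M.post (ω ν).2 then 0 else 1) else 0) ∂P := by
          refine lintegral_mono fun ω => ?_
          by_cases h : ω ∈ s ∩ M.alive est b ν
          · rw [Set.indicator_of_mem h, if_pos h.1]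
            refine ENNReal.ofReal_le_ofReal (add_le_add_left (max_le ?_ (by positivity)) _)
            linarith [le_max_right (M.stat est ω ν) 0]
          · rw [Set.indicator_of_notMem h]; exact zero_le
      _ = _ := hnext
      _ = ∫⁻ ω, s.indicator (fun _ => ENNReal.ofReal (b + Lc + K * M.failProb est)) ω ∂P := by
          refine lintegral_congr fun ω => ?_
          by_cases h : ω ∈ s
          · simp only [h, if_true, Set.indicator_of_mem]
            unfold Model.failProb Model.expect
            rw [prodExp_add, prodExp_const (M.sum_wt _), prodExp_const_mul]
          · simp only [h, if_false, Set.indicator_of_notMem, not_false_eq_true, M.expect_const]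
            simp
      _ = _ := lintegral_indicator_const hsm _
  have hI0 : ENNReal.ofReal I' ≠ 0 := by simpa using hI'
  have htsum : ∑' j, P (s ∩ M.alive est b (ν + j)) ≤
      ENNReal.ofReal ((b + Lc + K * M.failProb est) / I') * P s := by
    rw [ENNReal.ofReal_div_of_pos hI', ← ENNReal.mul_div_right_comm]
    rw [ENNReal.le_div_iff_mul_le (Or.inl hI0) (Or.inl ENNReal.ofReal_ne_top), mul_comm,
      ← ENNReal.tsum_mul_left]
    refine ENNReal.tsum_le_of_sum_range_le fun N => ?_
    rw [← Finset.mul_sum]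
    exact (le_add_self.trans (hsum N)).trans hinit
  have hmeas : ∀ j, Measurable fun ω : SamplePath n =>
      if ((ν + j : ℕ) : ℕ∞) < M.TL est b ω then (1 : ℝ≥0∞) else 0 := fun j => by
    refine Measurable.ite ?_ measurable_const measurable_const
    rw [M.setOf_coe_lt_TL]
    exact M.measurableSet_alive' est b _
  calc ∫⁻ ω in s, delay (M.TL est b) ν ω ∂P ≤ ∫⁻ ω in s, (1 + ∑' j : ℕ,
        if ((ν + j : ℕ) : ℕ∞) < M.TL est b ω then (1 : ℝ≥0∞) else 0) ∂P :=
        lintegral_mono fun ω => delay_le_tsum _ _ _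
    _ = P s + ∑' j, P (s ∩ M.alive est b (ν + j)) := by
        rw [lintegral_add_left measurable_const, lintegral_tsum fun j => (hmeas j).aemeasurable]
        congr 1
        · simp
        · refine tsum_congr fun j => ?_
          have hind : (fun ω : SamplePath n =>
              if ((ν + j : ℕ) : ℕ∞) < M.TL est b ω then (1 : ℝ≥0∞) else 0) =
              (M.alive est b (ν + j)).indicator (fun _ => 1) := by
            ext ω
            simp only [M.coe_lt_TL_iff, Set.indicator_apply]
          rw [hind, lintegral_indicator_const (M.measurableSet_alive' est b _), one_mul,
            Measure.restrict_apply (M.measurableSet_alive' est b _), Set.inter_comm]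
    _ ≤ P s + ENNReal.ofReal ((b + Lc + K * M.failProb est) / I') * P s := by gcongr
    _ = _ := by
        rw [ENNReal.ofReal_add zero_le_one (by positivity), ENNReal.ofReal_one, add_mul, one_mul]

end Bounds


/-! ### Lower bounds for the delay -/

section Lower

variable {n : ℕ} (M : Model n)

/-- The log-likelihood ratio of `m` privatized graphs from time `ν` on. -/
def Model.llrSum (ν m : ℕ) (ω : SamplePath n) : ℝ :=
  ∑ j ∈ Finset.range m, M.llr (ω (ν + j)).2

lemma Model.measurable_llrSum (ν m : ℕ) : Measurable (M.llrSum ν m) :=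
  Finset.measurable_fun_sum _ fun _ _ => measurable_comp_snd_apply _ _

lemma Model.exp_llr (B : SignedGraph n) : Real.exp (M.llr B) =
    likelihood M.pTilde M.zetaTilde M.post B / likelihood M.pTilde M.zetaTilde M.pre B :=
  M.exp_llrOf M.post B

/-- Change of measure for one observation. -/
lemma Model.lintegral_change_one (ν : ℕ) {h : SamplePath n → ℝ≥0∞} (hm : Measurable h)
    (hpriv : ∀ ω ω', (∀ t, (ω t).2 = (ω' t).2) → h ω = h ω') :
    ∫⁻ ω, h ω ∂M.pathLaw ν =
      ∫⁻ ω, h ω * ENNReal.ofReal (Real.exp (M.llr (ω ν).2)) ∂M.pathLaw ((ν + 1 : ℕ) : ℕ∞) := by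
  have hm' : Measurable fun ω : SamplePath n =>
      h ω * ENNReal.ofReal (Real.exp (M.llr (ω ν).2)) :=
    hm.mul (measurable_comp_snd_apply (fun B => ENNReal.ofReal (Real.exp (M.llr B))) ν)
  rw [M.lintegral_pathLaw_succ ν hm, M.lintegral_pathLaw_update _ ν hm',
    M.labelsAt_coe_of_lt (Nat.lt_succ_self ν)]
  refine lintegral_congr fun ω => ?_
  -- The raw graph is replaced by a fixed filler; `h` then depends on the private graph only, and
  -- both integrals become finite sums.
  have hB : ∀ x : Sample n, h (Function.update ω ν x) =
      h (Function.update ω ν ((fun _ => 0 : SignedGraph n), x.2)) := fun x => by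
    refine hpriv _ _ fun t => ?_
    by_cases ht : t = ν
    · subst ht; simp
    · simp [Function.update_of_ne ht]
  simp only [Function.update_self]
  simp_rw [hB]
  rw [M.lintegral_sampleLaw M.post (fun B => h (Function.update ω ν ((fun _ => 0), B))),
    M.lintegral_sampleLaw M.pre (fun B => h (Function.update ω ν ((fun _ => 0), B)) *
      ENNReal.ofReal (Real.exp (M.llr B)))]
  refine Finset.sum_congr rfl fun B _ => ?_
  rw [M.exp_llr, mul_left_comm, mul_comm, ← ENNReal.ofReal_mul (M.likelihood_pos _ _).le,
    mul_div_cancel₀ _ (M.likelihood_pos M.pre B).ne']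

/-- Iterating the one-step change of measure postpones the change-point by m, one likelihood ratio
per step. -/
lemma Model.lintegral_change (ν m : ℕ) {h : SamplePath n → ℝ≥0∞} (hm : Measurable h)
    (hpriv : ∀ ω ω', (∀ t, (ω t).2 = (ω' t).2) → h ω = h ω') :
    ∫⁻ ω, h ω ∂M.pathLaw ν =
      ∫⁻ ω, h ω * ENNReal.ofReal (Real.exp (M.llrSum ν m ω)) ∂M.pathLaw ((ν + m : ℕ) : ℕ∞) := by
  induction m with
  | zero => simp [Model.llrSum]
  | succ m ih =>
    have hm' : Measurable fun ω => h ω * ENNReal.ofReal (Real.exp (M.llrSum ν m ω)) :=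
      hm.mul (Real.measurable_exp.comp (M.measurable_llrSum ν m)).ennreal_ofReal
    rw [ih, M.lintegral_change_one (ν + m) hm' fun ω ω' hω => by
      simp only [hpriv ω ω' hω, Model.llrSum, hω]]
    refine lintegral_congr fun ω => ?_
    rw [mul_assoc, ← ENNReal.ofReal_mul (Real.exp_pos _).le, ← Real.exp_add]
    simp only [Model.llrSum, Finset.sum_range_succ]

/-- On events of small log-likelihood ratio, the change of measure costs at most `exp c`. -/
lemma Model.pathLaw_inter_llrSum_le {ν m : ℕ} {C : Set (SamplePath n)} (hνm : 1 ≤ ν + m)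
    (hC : MeasurableSet[privateFiltration n (ν + m - 1)] C) (c : ℝ) :
    M.pathLaw ν (C ∩ {ω | M.llrSum ν m ω ≤ c}) ≤
      ENNReal.ofReal (Real.exp c) * M.pathLaw ⊤ C := by
  have hCm : MeasurableSet C := (privateFiltration n).le _ C hC
  have hΛ : MeasurableSet {ω | M.llrSum ν m ω ≤ c} := M.measurable_llrSum ν m measurableSet_Iic
  have hCΛ := hCm.inter hΛ
  rw [← one_mul (M.pathLaw ν _), ← lintegral_indicator_const hCΛ,
    M.lintegral_change ν m (measurable_const.indicator hCΛ) fun ω ω' hω => ?_]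
  -- `C` is decided before time ν + m, so a change there has not yet affected it.
  · rw [← M.pathLaw_coe_apply (ν := ν + m) (by omega) hC, ← lintegral_indicator_const hCm]
    refine lintegral_mono fun ω => ?_
    by_cases h : ω ∈ C ∩ {ω | M.llrSum ν m ω ≤ c}
    · rw [Set.indicator_of_mem h, Set.indicator_of_mem h.1, one_mul]
      exact ENNReal.ofReal_le_ofReal (Real.exp_le_exp.2 h.2)
    · rw [Set.indicator_of_notMem h, zero_mul]; exact zero_le
  · have h1 : ω ∈ C ↔ ω' ∈ C := mem_iff_of_forall_eq hC fun t _ _ => hω t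
    have h2 : M.llrSum ν m ω = M.llrSum ν m ω' := by simp only [Model.llrSum, hω]
    have h3 : ω ∈ C ∩ {ω | M.llrSum ν m ω ≤ c} ↔ ω' ∈ C ∩ {ω | M.llrSum ν m ω ≤ c} :=
      and_congr h1 (by rw [Set.mem_ofPred_eq, Set.mem_ofPred_eq, h2])
    by_cases h : ω ∈ C ∩ {ω | M.llrSum ν m ω ≤ c}
    · rw [Set.indicator_of_mem h, Set.indicator_of_mem (h3.1 h)]
    · rw [Set.indicator_of_notMem h, Set.indicator_of_notMem fun h' => h (h3.2 h')]

/-- The variance of the log-likelihood ratio of `m` graphs. -/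
lemma Model.lintegral_llrSum_sq_le {ν : ℕ} (m : ℕ) {s : Set (SamplePath n)} (hsm : MeasurableSet s)
    (hs : ∀ ω x j, ν ≤ j → (Function.update ω j x ∈ s ↔ ω ∈ s)) :
    ∫⁻ ω in s, ENNReal.ofReal ((M.llrSum ν m ω - m * M.infoTilde) ^ 2) ∂M.pathLaw ν ≤
      ENNReal.ofReal (m * M.expect M.post (fun A => (M.llr A - M.infoTilde) ^ 2)) *
        M.pathLaw ν s := by
  classical
  set V := M.expect M.post (fun A => (M.llr A - M.infoTilde) ^ 2) with hV
  have hV0 : 0 ≤ V := prodExp_nonneg (M.wt_nonneg _) fun A => sq_nonneg _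
  induction m with
  | zero => simp [Model.llrSum]
  | succ m ih =>
    set φ : SamplePath n → SignedGraph n → ℝ := fun ω B => if ω ∈ s then
      (M.llrSum ν m ω - m * M.infoTilde + (M.llr B - M.infoTilde)) ^ 2 else 0 with hφ
    have hnext := M.lintegral_next ν (ν + m) (φ := φ) (fun ω B => by
        simp only [hφ]; split_ifs <;> positivity)
      (fun B => Measurable.ite hsm ((((M.measurable_llrSum ν m).sub_const _).add_const _).pow_const 2)
        measurable_const)
      (fun ω x B => by
        have h1 : M.llrSum ν m (Function.update ω (ν + m) x) = M.llrSum ν m ω := by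
          refine Finset.sum_congr rfl fun j hj => ?_
          rw [Function.update_of_ne]
          have := Finset.mem_range.1 hj
          omega
        simp only [hφ, h1, hs ω x (ν + m) (by omega)])
    rw [M.labelsAt_coe_of_le (Nat.le_add_right ν m)] at hnext
    have hexp : ∀ ω ∈ s, M.expect M.post (φ ω) = (M.llrSum ν m ω - m * M.infoTilde) ^ 2 + V := by
      intro ω hω
      -- The next increment is centred and independent of the past, so the cross term vanishes also
      -- on `s`.
      have hz : M.expect M.post (fun B => M.llr B - M.infoTilde) = 0 := by
        have := M.expect_llr
        unfold Model.expect at this ⊢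
        rw [prodExp_sub, prodExp_const (M.sum_wt _), this, sub_self]
      set a := M.llrSum ν m ω - m * M.infoTilde with ha
      have h2 : φ ω = fun B => a ^ 2 + 2 * a * (M.llr B - M.infoTilde) +
          (M.llr B - M.infoTilde) ^ 2 := by
        ext B
        simp only [hφ, hω, if_true]
        ring
      rw [h2]
      unfold Model.expect at hz hV ⊢
      rw [prodExp_add, prodExp_add, prodExp_const (M.sum_wt _), prodExp_const_mul, hz, ← hV]
      ring
    calc _ = ∫⁻ ω, ENNReal.ofReal (φ ω (ω (ν + m)).2) ∂M.pathLaw ν := by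
          rw [← lintegral_indicator hsm]
          refine lintegral_congr fun ω => ?_
          by_cases h : ω ∈ s
          · simp only [hφ, h, if_true, Set.indicator_of_mem]
            congr 1
            simp only [Model.llrSum, Finset.sum_range_succ]
            push_cast
            ring
          · simp [hφ, h]
      _ = ∫⁻ ω in s, ENNReal.ofReal ((M.llrSum ν m ω - m * M.infoTilde) ^ 2 + V) ∂M.pathLaw ν := by
          rw [hnext, ← lintegral_indicator hsm]
          refine lintegral_congr fun ω => ?_
          by_cases h : ω ∈ s
          · rw [Set.indicator_of_mem h, hexp ω h]
          · have : φ ω = fun _ => 0 := by ext B; simp only [hφ, h, if_false]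
            rw [Set.indicator_of_notMem h, this, M.expect_const]
            simp
      _ = ∫⁻ ω in s, ENNReal.ofReal ((M.llrSum ν m ω - m * M.infoTilde) ^ 2) ∂M.pathLaw ν +
            ENNReal.ofReal V * M.pathLaw ν s := by
          simp_rw [ENNReal.ofReal_add (sq_nonneg _) hV0]
          rw [lintegral_add_right _ measurable_const, setLIntegral_const]
      _ ≤ ENNReal.ofReal (m * V) * M.pathLaw ν s + ENNReal.ofReal V * M.pathLaw ν s := by gcongr
      _ = _ := by
          rw [← add_mul, ← ENNReal.ofReal_add (by positivity) hV0]
          congr 2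
          push_cast
          ring

/-- Chebyshev's inequality conditionally on a past event: independence lets P(s) factor out. -/
lemma Model.pathLaw_inter_lt_llrSum_le {ν : ℕ} (m : ℕ) {s : Set (SamplePath n)}
    (hsm : MeasurableSet s) (hs : ∀ ω x j, ν ≤ j → (Function.update ω j x ∈ s ↔ ω ∈ s))
    {c : ℝ} (hc : m * M.infoTilde < c) :
    M.pathLaw ν (s ∩ {ω | c < M.llrSum ν m ω}) ≤
      ENNReal.ofReal (m * M.expect M.post (fun A => (M.llr A - M.infoTilde) ^ 2) /
        (c - m * M.infoTilde) ^ 2) * M.pathLaw ν s := by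
  set d := c - m * M.infoTilde with hd
  have hd0 : 0 < d := sub_pos.2 hc
  have hΛ : MeasurableSet {ω | c < M.llrSum ν m ω} := M.measurable_llrSum ν m measurableSet_Ioi
  have h1 := M.lintegral_llrSum_sq_le m hsm hs
  have h2 : ENNReal.ofReal (d ^ 2) * M.pathLaw ν (s ∩ {ω | c < M.llrSum ν m ω}) ≤
      ∫⁻ ω in s, ENNReal.ofReal ((M.llrSum ν m ω - m * M.infoTilde) ^ 2) ∂M.pathLaw ν := by
    rw [← lintegral_indicator_const (hsm.inter hΛ), ← lintegral_indicator hsm]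
    refine lintegral_mono fun ω => ?_
    by_cases h : ω ∈ s ∩ {ω | c < M.llrSum ν m ω}
    · rw [Set.indicator_of_mem h, Set.indicator_of_mem h.1]
      refine ENNReal.ofReal_le_ofReal (pow_le_pow_left₀ hd0.le ?_ 2)
      have : c < M.llrSum ν m ω := h.2
      linarith
    · rw [Set.indicator_of_notMem h]; exact zero_le
  have hd2 : ENNReal.ofReal (d ^ 2) ≠ 0 := (ENNReal.ofReal_pos.2 (by positivity)).ne'
  rw [ENNReal.ofReal_div_of_pos (by positivity), ← ENNReal.mul_div_right_comm,
    ENNReal.le_div_iff_mul_le (Or.inl hd2) (Or.inl ENNReal.ofReal_ne_top), mul_comm]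
  exact h2.trans h1

/-- A stopping rule that rarely stops before time `ν + m` without a change has a large delay. -/
lemma Model.le_setLIntegral_delay {τ : SamplePath n → ℕ∞}
    (hτ : IsStoppingTime (privateFiltration n) τ) {ν m : ℕ} (hν : 1 ≤ ν) {θ c : ℝ} (hθ : 0 ≤ θ)
    (hc : m * M.infoTilde < c)
    (hfa : M.pathLaw ⊤ ({ω | ((ν - 1 : ℕ) : ℕ∞) < τ ω} \ {ω | ((ν + m - 1 : ℕ) : ℕ∞) < τ ω}) ≤
      ENNReal.ofReal θ * M.pathLaw ⊤ {ω | ((ν - 1 : ℕ) : ℕ∞) < τ ω}) :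
    ENNReal.ofReal ((m + 1) * (1 - Real.exp c * θ -
        m * M.expect M.post (fun A => (M.llr A - M.infoTilde) ^ 2) / (c - m * M.infoTilde) ^ 2)) *
      M.pathLaw ν {ω | ((ν - 1 : ℕ) : ℕ∞) < τ ω} ≤
      ∫⁻ ω in {ω | ((ν - 1 : ℕ) : ℕ∞) < τ ω}, delay τ ν ω ∂M.pathLaw ν := by
  set s := {ω | ((ν - 1 : ℕ) : ℕ∞) < τ ω} with hs
  set u := {ω | ((ν + m - 1 : ℕ) : ℕ∞) < τ ω} with hu
  set v := m * M.expect M.post (fun A => (M.llr A - M.infoTilde) ^ 2) / (c - m * M.infoTilde) ^ 2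
    with hv
  have hv0 : 0 ≤ v := div_nonneg (mul_nonneg (Nat.cast_nonneg _)
    (prodExp_nonneg (M.wt_nonneg _) fun A => sq_nonneg _)) (sq_nonneg _)
  have hsF : MeasurableSet[privateFiltration n (ν - 1)] s := measurableSet_coe_lt hτ _
  have huF : MeasurableSet[privateFiltration n (ν + m - 1)] u := measurableSet_coe_lt hτ _
  have hsm : MeasurableSet s := (privateFiltration n).le _ _ hsF
  have hum : MeasurableSet u := (privateFiltration n).le _ _ huF
  have hsu : MeasurableSet[privateFiltration n (ν + m - 1)] (s \ u) :=
    ((privateFiltration n).mono (by omega) s hsF).diff huF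
  have hinv : ∀ ω x j, ν ≤ j → (Function.update ω j x ∈ s ↔ ω ∈ s) := fun ω x j hj =>
    mem_iff_of_forall_eq hsF fun t _ ht => by rw [Function.update_of_ne (by omega)]
  have hPs : M.pathLaw ν s = M.pathLaw ⊤ s := M.pathLaw_coe_apply (by omega) hsF
  have h1 := M.pathLaw_inter_llrSum_le (by omega) hsu c
  have h2 := M.pathLaw_inter_lt_llrSum_le m hsm hinv hc
  -- Stopping inside the window either has log-likelihood ratio at most c, and is compared with the
  -- no-change law at cost e^c, or belongs to the Chebyshev event.
  have hsplit : M.pathLaw ν (s \ u) ≤ ENNReal.ofReal (Real.exp c * θ + v) * M.pathLaw ν s := by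
    calc M.pathLaw ν (s \ u) ≤ M.pathLaw ν ((s \ u) ∩ {ω | M.llrSum ν m ω ≤ c} ∪
          s ∩ {ω | c < M.llrSum ν m ω}) := by
          refine measure_mono fun ω hω => ?_
          rcases le_or_gt (M.llrSum ν m ω) c with h | h
          · exact Or.inl ⟨hω, h⟩
          · exact Or.inr ⟨hω.1, h⟩
      _ ≤ _ := measure_union_le _ _
      _ ≤ ENNReal.ofReal (Real.exp c) * (ENNReal.ofReal θ * M.pathLaw ν s) +
          ENNReal.ofReal v * M.pathLaw ν s := by
          refine add_le_add (h1.trans ?_) h2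
          rw [hPs]
          gcongr
      _ = _ := by
          rw [← mul_assoc, ← ENNReal.ofReal_mul (Real.exp_pos c).le, ← add_mul,
            ← ENNReal.ofReal_add (by positivity) hv0]
  have hkeep : ENNReal.ofReal (1 - Real.exp c * θ - v) * M.pathLaw ν s ≤ M.pathLaw ν (s ∩ u) := by
    have h3 : M.pathLaw ν s ≤ M.pathLaw ν (s ∩ u) + M.pathLaw ν (s \ u) :=
      (measure_inter_add_sdiff s hum).ge
    have h4 : ENNReal.ofReal (1 - Real.exp c * θ - v) =
        1 - ENNReal.ofReal (Real.exp c * θ + v) := by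
      rw [← ENNReal.ofReal_one, ← ENNReal.ofReal_sub _ (by positivity)]
      congr 1; ring
    rw [h4, ENNReal.sub_mul fun _ _ => measure_ne_top _ _, one_mul, tsub_le_iff_right]
    exact h3.trans (by gcongr)
  calc _ = ENNReal.ofReal (m + 1) * (ENNReal.ofReal (1 - Real.exp c * θ - v) * M.pathLaw ν s) := by
        rw [ENNReal.ofReal_mul (by positivity), mul_assoc]
    _ ≤ ENNReal.ofReal (m + 1) * M.pathLaw ν (s ∩ u) := by gcongr
    _ = ∫⁻ ω in s, u.indicator (fun _ => ENNReal.ofReal (m + 1)) ω ∂M.pathLaw ν := by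
        rw [lintegral_indicator_const hum, Measure.restrict_apply hum, Set.inter_comm]
    _ ≤ _ := by
        refine lintegral_mono fun ω => ?_
        by_cases h : ω ∈ u
        · rw [Set.indicator_of_mem h]
          -- Not stopping by ν + m - 1 means τ ≥ ν + m, hence a delay of at least m + 1; the extra
          -- one later absorbs the floor in the choice of m.
          have h5 : ((ν + m : ℕ) : ℕ∞) ≤ τ ω := by
            have h6 : ((ν + m - 1 : ℕ) : ℕ∞) + 1 ≤ τ ω := Order.add_one_le_of_lt h
            have h7 : ((ν + m : ℕ) : ℕ∞) = ((ν + m - 1 : ℕ) : ℕ∞) + 1 :=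
              (congrArg Nat.cast (show ν + m = ν + m - 1 + 1 by omega)).trans (Nat.cast_succ _)
            rwa [h7]
          have h8 : ((ν + m : ℕ) : ℝ≥0∞) ≤ ((τ ω : ℕ∞) : ℝ≥0∞) := by
            rw [← ENat.toENNReal_coe]; exact ENat.toENNReal_le.2 h5
          unfold delay
          refine ENNReal.le_sub_of_add_le_right (ENNReal.natCast_ne_top ν) ?_
          calc ENNReal.ofReal (m + 1) + ν = ((ν + m : ℕ) : ℝ≥0∞) + 1 := by
                rw [ENNReal.ofReal_add (by positivity) zero_le_one, ENNReal.ofReal_natCast,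
                  ENNReal.ofReal_one]
                push_cast; ring
            _ ≤ _ := by gcongr
        · rw [Set.indicator_of_notMem h]; exact zero_le

/-- A stopping rule with a large average run length has a window of length `m` in which it rarely
stops. -/
lemma Model.exists_window {τ : SamplePath n → ℕ∞} (hτ : IsStoppingTime (privateFiltration n) τ)
    {g : ℝ} (hg : 0 < g) (harl : ENNReal.ofReal g ≤ M.arl τ) {m : ℕ} (hm : 1 ≤ m) :
    ∃ ν, 1 ≤ ν ∧ M.pathLaw ⊤ {ω | ((ν - 1 : ℕ) : ℕ∞) < τ ω} ≠ 0 ∧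
      M.pathLaw ⊤ ({ω | ((ν - 1 : ℕ) : ℕ∞) < τ ω} \ {ω | ((ν + m - 1 : ℕ) : ℕ∞) < τ ω}) ≤
      ENNReal.ofReal (2 * m / g) * M.pathLaw ⊤ {ω | ((ν - 1 : ℕ) : ℕ∞) < τ ω} := by
  by_contra hcon
  push Not at hcon
  set P := M.pathLaw ⊤ with hP
  set p : ℕ → ℝ := fun j => P.real {ω | (j : ℕ∞) < τ ω} with hp
  have hp0 : ∀ j, 0 ≤ p j := fun j => measureReal_nonneg
  have hp1 : ∀ j, p j ≤ 1 := fun j => measureReal_le_one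
  have hmeas : ∀ j : ℕ, MeasurableSet {ω | (j : ℕ∞) < τ ω} := fun j =>
    (privateFiltration n).le j _ (measurableSet_coe_lt hτ j)
  have hsub : ∀ i j : ℕ, i ≤ j → {ω | (j : ℕ∞) < τ ω} ⊆ {ω | (i : ℕ∞) < τ ω} :=
    fun i j hij ω hω =>
      show (i : ℕ∞) < τ ω from
        lt_of_le_of_lt (Nat.cast_le.2 hij) (show (j : ℕ∞) < τ ω from hω)
  have hθ : 0 < 2 * (m : ℝ) / g := by
    have : (0 : ℝ) < m := by exact_mod_cast hm
    positivity
  -- If every window were bad, survival would lose the fraction 2m/g over each stretch of length m.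
  have hdec : ∀ j, p (j + m) ≤ p j - 2 * m / g * p j := by
    intro j
    by_cases h0 : P {ω | (j : ℕ∞) < τ ω} = 0
    · have h1 : p j = 0 := by simp [hp, Measure.real, h0]
      have h2 : p (j + m) ≤ p j := measureReal_mono (hsub _ _ (Nat.le_add_right j m))
      rw [h1] at h2 ⊢
      simpa using h2
    · have h1 := hcon (j + 1) (by omega) (by simpa using h0)
      simp only [Nat.add_sub_cancel, show j + 1 + m - 1 = j + m by omega] at h1
      have h2 : 2 * m / g * p j ≤ P.real ({ω | (j : ℕ∞) < τ ω} \ {ω | ((j + m : ℕ) : ℕ∞) < τ ω}) := by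
        have := ENNReal.toReal_mono (measure_ne_top _ _) h1.le
        rwa [ENNReal.toReal_mul, ENNReal.toReal_ofReal hθ.le] at this
      rw [measureReal_sdiff (hsub _ _ (Nat.le_add_right j m)) (hmeas _)] at h2
      simp only [hp] at h2 ⊢
      linarith
  -- A shift by m changes the partial sum by at most m, so summing the decay gives (2m/g)Σp ≤ m and
  -- a run length at most g/2.
  have hpart : ∀ N, ∑ j ∈ Finset.range N, p j ≤ g / 2 := by
    intro N
    have h1 : ∑ j ∈ Finset.range N, p (j + m) ≤
        ∑ j ∈ Finset.range N, p j - 2 * m / g * ∑ j ∈ Finset.range N, p j := by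
      rw [Finset.mul_sum, ← Finset.sum_sub_distrib]
      exact Finset.sum_le_sum fun j _ => hdec j
    have h2 : ∑ j ∈ Finset.range N, p j ≤ ∑ j ∈ Finset.range N, p (j + m) + m := by
      have h3 : ∑ j ∈ Finset.range (m + N), p j =
          ∑ j ∈ Finset.range m, p j + ∑ j ∈ Finset.range N, p (j + m) := by
        rw [Finset.sum_range_add]
        congr 1
        exact Finset.sum_congr rfl fun j _ => by rw [add_comm]
      have h4 : ∑ j ∈ Finset.range N, p j ≤ ∑ j ∈ Finset.range (m + N), p j :=
        Finset.sum_le_sum_of_subset_of_nonneg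
          (Finset.range_subset_range.2 (Nat.le_add_left N m)) fun j _ _ => hp0 j
      have h5 : ∑ j ∈ Finset.range m, p j ≤ m := by
        calc _ ≤ ∑ j ∈ Finset.range m, (1 : ℝ) := Finset.sum_le_sum fun j _ => hp1 j
          _ = m := by simp
      linarith
    have hm0 : (0 : ℝ) < m := by exact_mod_cast hm
    have h6 : 2 * m / g * ∑ j ∈ Finset.range N, p j ≤ m := by linarith
    rw [div_mul_eq_mul_div, div_le_iff₀ hg] at h6
    nlinarith
  have harl2 : M.arl τ ≤ ENNReal.ofReal (g / 2) := by
    rw [M.arl_eq_tsum hτ]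
    refine ENNReal.tsum_le_of_sum_range_le fun N => ?_
    calc ∑ j ∈ Finset.range N, P {ω | (j : ℕ∞) < τ ω} =
          ∑ j ∈ Finset.range N, ENNReal.ofReal (p j) :=
          Finset.sum_congr rfl fun j _ => (ofReal_measureReal (measure_ne_top _ _)).symm
      _ = ENNReal.ofReal (∑ j ∈ Finset.range N, p j) :=
          (ENNReal.ofReal_sum_of_nonneg fun j _ => hp0 j).symm
      _ ≤ _ := ENNReal.ofReal_le_ofReal (hpart N)
  have := harl.trans harl2
  rw [ENNReal.ofReal_le_ofReal_iff (by positivity)] at this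
  linarith

end Lower


/-! ### Non-asymptotic bounds -/

section Finite

variable {n : ℕ} (M : Model n)

lemma Model.signal_le_pTilde : M.signal ≤ M.pTilde := (le_abs_self _).trans M.abs_signal_le

/-- From log x ≥ 1 - 1/x the log-odds are at least (1-2ζ̃)/(1-ζ̃), hence at least 1-2ζ̃ = q/p̃. -/
lemma Model.signal_div_pTilde_le_logOdds (hq : 0 < M.signal) :
    M.signal / M.pTilde ≤ M.logOdds := by
  have hz := M.zetaTilde_pos
  have h2 : 0 < 1 - 2 * M.zetaTilde := by
    by_contra h
    exact absurd hq (not_lt.2 (mul_nonpos_of_nonneg_of_nonpos M.pTilde_pos.le (not_lt.1 h)))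
  have hz1 : 0 < 1 - M.zetaTilde := by linarith
  have h3 := Real.one_sub_inv_le_log_of_pos (div_pos hz1 hz)
  rw [inv_div] at h3
  unfold Model.logOdds
  refine le_trans ?_ h3
  rw [Model.signal, mul_div_cancel_left₀ _ M.pTilde_pos.ne', le_sub_iff_add_le,
    ← le_sub_iff_add_le', div_le_iff₀ hz1]
  nlinarith

lemma Model.logOdds_pos (hq : 0 < M.signal) : 0 < M.logOdds :=
  (div_pos hq M.pTilde_pos).trans_le (M.signal_div_pTilde_le_logOdds hq)

lemma Model.snr_le_mul_signal (hq : 0 < M.signal) (hN : 0 < M.snr) :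
    M.snr ≤ ((n : ℝ) - 1) * M.signal := by
  have hp := M.pTilde_pos
  have hn1 : 0 ≤ (n : ℝ) - 1 := by
    by_contra h
    have : M.snr ≤ 0 := div_nonpos_of_nonpos_of_nonneg
      (mul_nonpos_of_nonpos_of_nonneg (not_le.1 h).le (sq_nonneg _)) hp.le
    linarith
  unfold Model.snr
  rw [div_le_iff₀ hp, sq, ← mul_assoc]
  exact mul_le_mul_of_nonneg_left M.signal_le_pTilde (mul_nonneg hn1 hq.le)

variable {M}

/-- With D disagreeing edges, Ĩ₀ equals D·q·logOdds, and D ≥ n-1 while the log-odds are at least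
q/p̃. -/
lemma Model.snr_le_infoTilde (hq : 0 < M.signal)
    (hD : (n : ℝ) - 1 ≤ (disagree M.post M.pre).card) : M.snr ≤ M.infoTilde := by
  have hp := M.pTilde_pos
  rw [M.infoTilde_eq]
  calc M.snr = ((n : ℝ) - 1) * (M.signal * (M.signal / M.pTilde)) := by
        unfold Model.snr; field_simp
    _ ≤ (disagree M.post M.pre).card * (M.signal * (M.signal / M.pTilde)) :=
        mul_le_mul_of_nonneg_right hD (by positivity)
    _ ≤ (disagree M.post M.pre).card * (M.signal * M.logOdds) := by
        gcongr
        exact M.signal_div_pTilde_le_logOdds hq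
    _ = _ := by ring

/-- Measures the worst increment in units of Ĩ₀: since D·q ≥ 1, one log-odds is at most Ĩ₀. -/
lemma Model.abs_llrOf_le (hq : 0 < M.signal) (hN : 4 ≤ M.snr)
    (hD : (n : ℝ) - 1 ≤ (disagree M.post M.pre).card) (σ : Labels n) (A : SignedGraph n) :
    |M.llrOf σ A| ≤ (n : ℝ) ^ 2 * M.infoTilde := by
  have hl := M.logOdds_pos hq
  have h1 : M.logOdds ≤ M.infoTilde := by
    rw [M.infoTilde_eq]
    have h2 : 1 ≤ ((disagree M.post M.pre).card : ℝ) * M.signal := by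
      have h3 := M.snr_le_mul_signal hq (by linarith)
      have h4 := mul_le_mul_of_nonneg_right hD hq.le
      linarith
    exact le_mul_of_one_le_left hl.le h2
  calc |M.llrOf σ A| ≤ M.logOdds * (n : ℝ) ^ 2 := M.abs_log_likelihood_div_le hl.le σ M.pre A
    _ ≤ _ := by rw [mul_comm]; gcongr

/-- snr ≥ 4 gives 4p̃ ≤ D·q², so the standard deviation of one log-likelihood ratio does not exceed
its mean. -/
lemma Model.variance_llr_le (hN : 4 ≤ M.snr)
    (hD : (n : ℝ) - 1 ≤ (disagree M.post M.pre).card) :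
    M.expect M.post (fun A => (M.llr A - M.infoTilde) ^ 2) ≤ M.infoTilde ^ 2 := by
  have hp := M.pTilde_pos
  refine M.expect_llr_sub_sq_le.trans ?_
  rw [M.infoTilde_eq]
  set d : ℝ := (((disagree M.post M.pre).card : ℕ) : ℝ) with hd
  have hd0 : 0 ≤ d := Nat.cast_nonneg _
  have h1 : 4 * M.pTilde ≤ d * M.signal ^ 2 := by
    unfold Model.snr at hN
    rw [le_div_iff₀ hp] at hN
    exact hN.trans (mul_le_mul_of_nonneg_right hD (sq_nonneg _))
  calc M.logOdds ^ 2 * (4 * M.pTilde * d) ≤ M.logOdds ^ 2 * (d * M.signal ^ 2 * d) := by gcongr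
    _ = _ := by ring

lemma Model.expect_llr_sq_le (hN : 4 ≤ M.snr)
    (hD : (n : ℝ) - 1 ≤ (disagree M.post M.pre).card) :
    M.expect M.post (fun A => M.llr A ^ 2) ≤ 2 * M.infoTilde ^ 2 := by
  have h1 := Model.variance_llr_le hN hD
  have h2 := M.expect_llr
  have h3 : (fun A => M.llr A ^ 2) = fun A =>
      (M.llr A - M.infoTilde) ^ 2 + (2 * M.infoTilde * M.llr A + -(M.infoTilde ^ 2)) := by
    ext A; ring
  unfold Model.expect at h1 h2 ⊢
  rw [h3, prodExp_add, prodExp_add, prodExp_const_mul, prodExp_const (M.sum_wt _), h2]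
  linarith

lemma Model.llrOf_neg (σ : Labels n) (A : SignedGraph n) : M.llrOf (-σ) A = M.llrOf σ A := by
  unfold Model.llrOf
  rw [likelihood_neg]

/-- The drift of the statistic with truncated increments. -/
lemma Model.drift (hq : 0 < M.signal) (hN : 4 ≤ M.snr)
    (hD : (n : ℝ) - 1 ≤ (disagree M.post M.pre).card) (est : SignedGraph n → Labels n) {Lc : ℝ}
    (hLc : 0 < Lc) (A : SignedGraph n) :
    M.infoTilde * (1 - 2 * (M.infoTilde / Lc) - ((n : ℝ) ^ 2 + 1) * M.failProb est) +
        ((n : ℝ) ^ 2 + 1) * M.infoTilde * M.failProb est ≤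
      M.expect M.post (fun B => min (M.llrOf (est A) B) Lc) +
        ((n : ℝ) ^ 2 + 1) * M.infoTilde * if recovered est M.post A then 0 else 1 := by
  have hI : 4 ≤ M.infoTilde := hN.trans (Model.snr_le_infoTilde hq hD)
  have hlhs : M.infoTilde * (1 - 2 * (M.infoTilde / Lc) - ((n : ℝ) ^ 2 + 1) * M.failProb est) +
        ((n : ℝ) ^ 2 + 1) * M.infoTilde * M.failProb est =
      M.infoTilde - 2 * M.infoTilde ^ 2 / Lc := by ring
  rw [hlhs]
  by_cases h : recovered est M.post A
  · rw [if_pos h, mul_zero, add_zero]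
    have hest : M.llrOf (est A) = M.llr := by
      rcases h with h | h <;> rw [h]
      · rfl
      · ext B; rw [Model.llrOf_neg]; rfl
    rw [hest]
    have h1 := M.expect_llr
    have h2 := Model.expect_llr_sq_le hN hD
    -- Truncation costs at most a second moment: min(x, L) ≥ x - x²/L.
    have h3 : M.expect M.post (fun B => M.llr B + -(1 / Lc) * M.llr B ^ 2) ≤
        M.expect M.post (fun B => min (M.llr B) Lc) := by
      refine prodExp_mono (M.wt_nonneg _) fun B => ?_
      refine le_min ?_ ?_
      · have : 0 ≤ 1 / Lc * M.llr B ^ 2 := by positivity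
        linarith
      · have h4 : M.llr B - Lc ≤ 1 / Lc * M.llr B ^ 2 := by
          rw [div_mul_eq_mul_div, one_mul, le_div_iff₀ hLc]
          nlinarith [sq_nonneg (M.llr B - Lc), sq_nonneg (M.llr B), sq_nonneg (M.llr B + Lc)]
        linarith
    refine le_trans ?_ h3
    unfold Model.expect at h1 h2 ⊢
    rw [prodExp_add, prodExp_const_mul, h1]
    have h5 : 1 / Lc * prodExp (M.wt M.post) (fun A => M.llr A ^ 2) ≤
        1 / Lc * (2 * M.infoTilde ^ 2) := by gcongr
    have h6 : 1 / Lc * (2 * M.infoTilde ^ 2) = 2 * M.infoTilde ^ 2 / Lc := by ring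
    linarith
  · rw [if_neg h, mul_one]
    -- After a failed estimate the drift is at worst -n²Ĩ₀, and the penalty (n²+1)Ĩ₀ brings it back
    -- to at least Ĩ₀.
    have h1 : M.expect M.post (fun _ => -((n : ℝ) ^ 2 * M.infoTilde)) ≤
        M.expect M.post (fun B => min (M.llrOf (est A) B) Lc) := by
      refine prodExp_mono (M.wt_nonneg _) fun B => ?_
      have h2 := (abs_le.1 (Model.abs_llrOf_le hq hN hD (est A) B)).1
      exact le_min h2 ((neg_nonpos.2 (by positivity)).trans hLc.le)
    rw [M.expect_const] at h1
    have h3 : 0 ≤ 2 * M.infoTilde ^ 2 / Lc := by positivity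
    linarith

/-- The delay of the procedure. -/
lemma Model.wadd_TL_le_of_snr (hq : 0 < M.signal) (hN : 4 ≤ M.snr)
    (hD : (n : ℝ) - 1 ≤ (disagree M.post M.pre).card) (est : SignedGraph n → Labels n)
    {b η : ℝ} (hb : 0 < b) (hη : 0 < η)
    (hpos : 0 < 1 - 2 / η * (M.infoTilde / b) - ((n : ℝ) ^ 2 + 1) * M.failProb est)
    {β : Type*} [MeasurableSpace β] {f : Sample n → β} (hf : Measurable f) :
    M.wadd (filtrationOf f hf) (M.TL est b) ≤ ENNReal.ofReal (b / M.infoTilde *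
      (M.infoTilde / b + (1 + η + M.infoTilde / b * (((n : ℝ) ^ 2 + 1) * M.failProb est)) /
        (1 - 2 / η * (M.infoTilde / b) - ((n : ℝ) ^ 2 + 1) * M.failProb est))) := by
  have hI : 0 < M.infoTilde := by linarith [hN.trans (Model.snr_le_infoTilde hq hD)]
  have hLc : 0 < η * b := by positivity
  have hrw : 2 * (M.infoTilde / (η * b)) = 2 / η * (M.infoTilde / b) := by field_simp
  -- The level ηb is a small fraction of b, so the overshoot is cheap, yet large against Ĩ₀ = o(b),
  -- so truncation barely lowers the drift.
  refine (M.wadd_TL_le est (Lc := η * b) (K := ((n : ℝ) ^ 2 + 1) * M.infoTilde)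
    (I' := M.infoTilde * (1 - 2 * (M.infoTilde / (η * b)) - ((n : ℝ) ^ 2 + 1) * M.failProb est))
    hb hLc (by positivity) ?_ (Model.drift hq hN hD est hLc) hf).trans (le_of_eq ?_)
  · rw [hrw]; exact mul_pos hI hpos
  · rw [hrw]
    congr 1
    field_simp

/-- Lower bound for the delay of rules with few false alarms in a window. -/
lemma Model.le_setLIntegral_delay_of_snr (hq : 0 < M.signal) (hN : 4 ≤ M.snr)
    (hD : (n : ℝ) - 1 ≤ (disagree M.post M.pre).card)
    {τ : SamplePath n → ℕ∞} (hτ : IsStoppingTime (privateFiltration n) τ) {ν : ℕ} (hν : 1 ≤ ν)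
    {b d : ℝ} (hb : 0 < b) (hd : 0 < d) (hd1 : d < 1)
    (hfa : M.pathLaw ⊤ ({ω | ((ν - 1 : ℕ) : ℕ∞) < τ ω} \
        {ω | ((ν + ⌊(1 - d) * (b / M.infoTilde)⌋₊ - 1 : ℕ) : ℕ∞) < τ ω}) ≤
      ENNReal.ofReal (2 * ⌊(1 - d) * (b / M.infoTilde)⌋₊ / Real.exp b) *
        M.pathLaw ⊤ {ω | ((ν - 1 : ℕ) : ℕ∞) < τ ω})
    (hpos : 0 ≤ 1 - 2 * (b * Real.exp (-(d / 2 * b))) - 4 / d ^ 2 * (M.infoTilde / b)) :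
    ENNReal.ofReal ((1 - d) * (b / M.infoTilde) *
        (1 - 2 * (b * Real.exp (-(d / 2 * b))) - 4 / d ^ 2 * (M.infoTilde / b))) *
      M.pathLaw ν {ω | ((ν - 1 : ℕ) : ℕ∞) < τ ω} ≤
      ∫⁻ ω in {ω | ((ν - 1 : ℕ) : ℕ∞) < τ ω}, delay τ ν ω ∂M.pathLaw ν := by
  have hI : 4 ≤ M.infoTilde := hN.trans (Model.snr_le_infoTilde hq hD)
  have hI0 : 0 < M.infoTilde := by linarith
  set m := ⌊(1 - d) * (b / M.infoTilde)⌋₊ with hm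
  set V := M.expect M.post (fun A => (M.llr A - M.infoTilde) ^ 2) with hV
  have hV0 : 0 ≤ V := prodExp_nonneg (M.wt_nonneg _) fun A => sq_nonneg _
  have hV1 : V ≤ M.infoTilde ^ 2 := Model.variance_llr_le hN hD
  have hx0 : 0 ≤ (1 - d) * (b / M.infoTilde) :=
    mul_nonneg (by linarith) (by positivity)
  have hm1 : (m : ℝ) ≤ (1 - d) * (b / M.infoTilde) := Nat.floor_le hx0
  have hm2 : (1 - d) * (b / M.infoTilde) ≤ m + 1 := (Nat.lt_floor_add_one _).le
  have hmI : m * M.infoTilde ≤ (1 - d) * b := by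
    calc m * M.infoTilde ≤ (1 - d) * (b / M.infoTilde) * M.infoTilde := by gcongr
      _ = _ := by field_simp
  -- The level (1-d/2)b lies db/2 above the mean, for Chebyshev, and db/2 below b, so that
  -- e^c·2m/e^b is still small.
  have hc : m * M.infoTilde < (1 - d / 2) * b := by nlinarith
  have key := M.le_setLIntegral_delay hτ hν (m := m) (θ := 2 * m / Real.exp b)
    (c := (1 - d / 2) * b) (by positivity) hc hfa
  refine le_trans ?_ key
  gcongr ?_ * _
  refine ENNReal.ofReal_le_ofReal (mul_le_mul hm2 ?_ hpos (by positivity))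
  have h1 : Real.exp ((1 - d / 2) * b) * (2 * m / Real.exp b) ≤
      2 * (b * Real.exp (-(d / 2 * b))) := by
    have h2 : Real.exp ((1 - d / 2) * b) = Real.exp (-(d / 2 * b)) * Real.exp b := by
      rw [← Real.exp_add]; congr 1; ring
    have h3 : (m : ℝ) ≤ b := by
      refine hm1.trans ?_
      calc (1 - d) * (b / M.infoTilde) ≤ 1 * (b / 1) := by
            gcongr <;> linarith
        _ = b := by ring
    rw [h2]
    calc _ = 2 * (m * Real.exp (-(d / 2 * b))) := by field_simp
      _ ≤ _ := by gcongr
  have h2 : m * V / ((1 - d / 2) * b - m * M.infoTilde) ^ 2 ≤ 4 / d ^ 2 * (M.infoTilde / b) := by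
    have h3 : d / 2 * b ≤ (1 - d / 2) * b - m * M.infoTilde := by linarith
    calc m * V / ((1 - d / 2) * b - m * M.infoTilde) ^ 2 ≤
          m * M.infoTilde ^ 2 / (d / 2 * b) ^ 2 := by gcongr
      _ = m * M.infoTilde * (M.infoTilde / (d / 2 * b) ^ 2) := by ring
      _ ≤ b * (M.infoTilde / (d / 2 * b) ^ 2) := by
          gcongr
          nlinarith
      _ = _ := by field_simp; norm_num
  linarith

/-- Lower bound for the delay of an arbitrary stopping rule of the privatized graphs. -/
lemma Model.le_wadd_of_arl (hq : 0 < M.signal) (hN : 4 ≤ M.snr)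
    (hD : (n : ℝ) - 1 ≤ (disagree M.post M.pre).card)
    {τ : SamplePath n → ℕ∞} (hτ : IsStoppingTime (privateFiltration n) τ)
    {b d : ℝ} (hb : 0 < b) (hd : 0 < d) (hd1 : d < 1)
    (hm : 1 ≤ (1 - d) * (b / M.infoTilde)) (harl : ENNReal.ofReal (Real.exp b) ≤ M.arl τ)
    (hpos : 0 ≤ 1 - 2 * (b * Real.exp (-(d / 2 * b))) - 4 / d ^ 2 * (M.infoTilde / b)) :
    ENNReal.ofReal ((1 - d) * (b / M.infoTilde) *
        (1 - 2 * (b * Real.exp (-(d / 2 * b))) - 4 / d ^ 2 * (M.infoTilde / b))) ≤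
      M.wadd (privateFiltration n) τ := by
  obtain ⟨ν, hν, hne, hfa⟩ := M.exists_window hτ (Real.exp_pos b) harl (Nat.le_floor (by simpa using hm))
  have h1 := Model.le_setLIntegral_delay_of_snr hq hN hD hτ hν hb hd hd1 hfa hpos
  have hsF : MeasurableSet[privateFiltration n (ν - 1)] {ω | ((ν - 1 : ℕ) : ℕ∞) < τ ω} :=
    measurableSet_coe_lt hτ _
  have h2 := h1.trans (M.setLIntegral_delay_le_wadd hν hsF)
  -- The survival event has positive probability under the change at ν as well, so it can be divided
  -- out.
  rw [← M.pathLaw_coe_apply (ν := ν) (by omega) hsF] at hne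
  exact (ENNReal.mul_le_mul_iff_left hne (measure_ne_top _ _)).1 h2

/-- Lower bound for the delay of the procedure, for an arbitrary filtration. -/
lemma Model.le_wadd_TL (hq : 0 < M.signal) (hN : 4 ≤ M.snr)
    (hD : (n : ℝ) - 1 ≤ (disagree M.post M.pre).card) (est : SignedGraph n → Labels n)
    {b d : ℝ} (hb : 0 < b) (hd : 0 < d) (hd1 : d < 1)
    (hm : 1 ≤ (1 - d) * (b / M.infoTilde))
    (hpos : 0 ≤ 1 - 2 * (b * Real.exp (-(d / 2 * b))) - 4 / d ^ 2 * (M.infoTilde / b))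
    (F : Filtration ℕ (inferInstance : MeasurableSpace (SamplePath n))) :
    ENNReal.ofReal ((1 - d) * (b / M.infoTilde) *
        (1 - 2 * (b * Real.exp (-(d / 2 * b))) - 4 / d ^ 2 * (M.infoTilde / b))) ≤
      M.wadd F (M.TL est b) := by
  set m := ⌊(1 - d) * (b / M.infoTilde)⌋₊ with hmdef
  have hm1 : 1 ≤ m := Nat.le_floor (by simpa using hm)
  -- With ν = 1 the conditioning event is the whole space, measurable in any filtration; the window
  -- condition comes from the direct false-alarm bound.
  have huniv : {ω : SamplePath n | ((1 - 1 : ℕ) : ℕ∞) < M.TL est b ω} = Set.univ := by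
    rw [M.setOf_coe_lt_TL]
    exact Set.eq_univ_of_forall fun ω j h1 h2 => by omega
  have h1 := Model.le_setLIntegral_delay_of_snr hq hN hD (M.isStoppingTime_TL est b) le_rfl hb hd hd1
    (by
      rw [huniv, measure_univ, mul_one, M.setOf_coe_lt_TL, ← Set.compl_eq_univ_sdiff, ← hmdef,
        Nat.add_sub_cancel_left]
      refine (M.pathLaw_top_compl_alive_le est hb hm1).trans (ENNReal.ofReal_le_ofReal ?_)
      gcongr
      linarith [Nat.cast_nonneg (α := ℝ) m]) hpos
  rw [huniv, measure_univ, mul_one] at h1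
  have h2 := h1.trans (M.setLIntegral_delay_le_wadd (F := F) le_rfl MeasurableSet.univ)
  rwa [measure_univ, mul_one] at h2

end Finite


/-! ### Asymptotics -/

section Regime

variable {n : ℕ} {M : Model n}

/-- Since n^(3/2) - n = n(√n - 1) and n - 1 = (√n - 1)(√n + 1), the lower bound on `a` says p(√n +
1) > 2; then p ≤ 1 finishes. -/
lemma Model.RecoveryCondition.one_le_sqrt_mul {a : ℝ} (h : M.RecoveryCondition a) (hn : 2 ≤ n) :
    1 ≤ √(n : ℝ) * M.p := by
  obtain ⟨hp, ha, -⟩ := h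
  have hn' : (2 : ℝ) ≤ n := by exact_mod_cast hn
  have hn0 : (0 : ℝ) < n := by linarith
  have hlog : 0 < Real.log n := Real.log_pos (by linarith)
  have hpow : (n : ℝ) ^ (3 / 2 : ℝ) = n * √(n : ℝ) := by
    rw [show (3 / 2 : ℝ) = 1 + 1 / 2 by norm_num, Real.rpow_add hn0, Real.rpow_one,
      ← Real.sqrt_eq_rpow]
  have hs1 : 1 < √(n : ℝ) := Real.lt_sqrt_of_sq_lt (by linarith)
  have hs : √(n : ℝ) * √(n : ℝ) = n := Real.mul_self_sqrt hn0.le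
  set s := √(n : ℝ) with hsdef
  rw [hpow, gt_iff_lt, div_lt_iff₀ (mul_pos (by linarith) hlog)] at ha
  have h1 : 2 * (s - 1) ≤ (M.p : ℝ) * (n - 1) := by
    rw [hp, div_mul_eq_mul_div, le_div_iff₀ hn0]
    nlinarith
  have h2 : (s - 1) * 2 ≤ (s - 1) * ((M.p : ℝ) * (s + 1)) := by
    calc (s - 1) * 2 = 2 * (s - 1) := by ring
      _ ≤ (M.p : ℝ) * (n - 1) := h1
      _ = _ := by rw [← hs]; ring
  have h3 : 2 ≤ (M.p : ℝ) * (s + 1) := le_of_mul_le_mul_left h2 (by linarith)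
  have hp0 : (0 : ℝ) ≤ M.p := M.p.2.1
  nlinarith

/-- For e^ε ≥ 4 the signal is at least p(1-2ζ)/2, while p̃ ≤ p + 2e^(-ε). As n^c is at most both √n
and e^ε, n^c·p̃ ≤ np² + 2 ≤ 3np²; with n-1 ≥ n/2 this yields the constant 24. -/
lemma Model.le_snr {c : ℝ} (hc : c ≤ 1 / 2) (hn : 2 ≤ n) (hp : 1 ≤ √(n : ℝ) * M.p)
    (hE4 : 4 ≤ Real.exp M.ε) (hE : (n : ℝ) ^ c ≤ Real.exp M.ε) (hζ : (M.ζ : ℝ) < 1 / 2) :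
    0 < M.signal ∧ (1 - 2 * (M.ζ : ℝ)) ^ 2 / 24 * (n : ℝ) ^ c ≤ M.snr := by
  have hn' : (2 : ℝ) ≤ n := by exact_mod_cast hn
  have hn0 : (0 : ℝ) < n := by linarith
  have hs : √(n : ℝ) * √(n : ℝ) = n := Real.mul_self_sqrt hn0.le
  have hs0 : 0 < √(n : ℝ) := Real.sqrt_pos.2 hn0
  have hcs : (n : ℝ) ^ c ≤ √(n : ℝ) := by
    rw [Real.sqrt_eq_rpow]
    exact Real.rpow_le_rpow_of_exponent_le (by linarith) hc
  have hc0 : 0 < (n : ℝ) ^ c := Real.rpow_pos_of_pos hn0 c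
  have hpT0 := M.pTilde_pos
  have hsig := M.signal_eq
  have hpT : M.pTilde ≤ M.p + 2 / Real.exp M.ε := by
    unfold Model.pTilde
    have hp0 : (0 : ℝ) ≤ M.p := M.p.2.1
    have hE0 := Real.exp_pos M.ε
    rw [div_le_iff₀ (by linarith)]
    have : (2 / Real.exp M.ε) * (Real.exp M.ε + 2) = 2 + 4 / Real.exp M.ε := by
      field_simp; ring
    have h4 : 0 ≤ 4 / Real.exp M.ε := by positivity
    rw [add_mul, this]
    nlinarith
  unfold Model.snr
  generalize M.signal = q at *
  generalize M.pTilde = r at *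
  generalize Real.exp M.ε = E at *
  have hp0 : (0 : ℝ) < M.p := by
    by_contra h
    nlinarith
  have hκ : 0 < 1 - 2 * (M.ζ : ℝ) := by linarith
  generalize (M.p : ℝ) = p at *
  generalize 1 - 2 * (M.ζ : ℝ) = κ at *
  generalize √(n : ℝ) = s at *
  generalize (n : ℝ) ^ c = t at *
  generalize (n : ℝ) = N at *
  have hEr : 1 / 2 ≤ (E - 1) / (E + 2) := by
    rw [le_div_iff₀ (by linarith)]; linarith
  have hq : p * κ / 2 ≤ q := by
    rw [hsig]
    calc p * κ / 2 = p * κ * (1 / 2) := by ring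
      _ ≤ _ := by gcongr
  have hq0 : 0 < p * κ / 2 := by positivity
  refine ⟨hq0.trans_le hq, ?_⟩
  rw [le_div_iff₀ hpT0]
  have h1 : t * r ≤ 3 * (N * p ^ 2) := by
    have h2 : t * (2 / E) ≤ 2 := by
      rw [mul_div_assoc', div_le_iff₀ (by linarith)]; linarith
    have h3 : N * p ^ 2 = (s * p) * (s * p) := by rw [← hs]; ring
    have h4 : 1 ≤ N * p ^ 2 := by rw [h3]; nlinarith
    have h5 : t * p ≤ N * p ^ 2 := by
      rw [h3]
      calc t * p ≤ s * p := by gcongr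
        _ ≤ _ := le_mul_of_one_le_left (by positivity) hp
    calc t * r ≤ t * (p + 2 / E) := by gcongr
      _ ≤ _ := by linarith
  calc κ ^ 2 / 24 * t * r = κ ^ 2 / 24 * (t * r) := by ring
    _ ≤ κ ^ 2 / 24 * (3 * (N * p ^ 2)) := by gcongr
    _ = N / 2 * (p * κ / 2) ^ 2 := by ring
    _ ≤ _ := by
      gcongr <;> linarith

end Regime

/-! ### Limits along the sequence of problems. -/

section Sequence

variable {n : ℕ → ℕ} {M : ∀ k, Model (n k)}

/-- Polynomial growth of the signal-to-noise ratio. -/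
lemma eventually_le_snr {ζ : unitInterval} (hζ1 : (ζ : ℝ) < 1 / 2)
    (hn : Tendsto n atTop atTop) (hMζ : ∀ k, (M k).ζ = ζ)
    (hε : ∃ c : ℝ, 0 < c ∧ ∀ᶠ k in atTop, c * Real.log (n k) ≤ (M k).ε)
    {a : ℕ → ℝ} (hrec : ∀ᶠ k in atTop, (M k).RecoveryCondition (a k)) :
    ∃ C c : ℝ, 0 < C ∧ 0 < c ∧
      ∀ᶠ k in atTop, 0 < (M k).signal ∧ C * (n k : ℝ) ^ c ≤ (M k).snr := by
  obtain ⟨c, hc, hε⟩ := hε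
  have hκ : 0 < 1 - 2 * (ζ : ℝ) := by linarith
  have hnR : Tendsto (fun k => (n k : ℝ)) atTop atTop := tendsto_natCast_atTop_atTop.comp hn
  refine ⟨(1 - 2 * (ζ : ℝ)) ^ 2 / 24, min c (1 / 2), by positivity, by positivity, ?_⟩
  filter_upwards [hε, hrec, hn.eventually_ge_atTop 2,
    ((tendsto_rpow_atTop hc).comp hnR).eventually_ge_atTop 4] with k h1 h2 h3 h4
  have hk : (2 : ℝ) ≤ n k := by exact_mod_cast h3
  have hE : (n k : ℝ) ^ c ≤ Real.exp (M k).ε := by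
    rw [Real.rpow_def_of_pos (by linarith), mul_comm]
    exact Real.exp_le_exp.2 h1
  have h5 := Model.le_snr (M := M k) (min_le_right c (1 / 2)) h3 (h2.one_le_sqrt_mul h3)
    (le_trans h4 hE)
    ((Real.rpow_le_rpow_of_exponent_le (by linarith) (min_le_left _ _)).trans hE)
    (by rw [hMζ]; exact hζ1)
  rwa [hMζ] at h5

/-- A moment order depending only on the growth exponent c is enough: it makes the failure
probability O(n·n⁻⁴), and the weight n² + 1 leaves O(1/n). -/
lemma tendsto_mul_failProb (hn : Tendsto n atTop atTop) {C c : ℝ} (hC : 0 < C) (hc : 0 < c)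
    (h : ∀ᶠ k in atTop, 0 < (M k).signal ∧ C * (n k : ℝ) ^ c ≤ (M k).snr)
    {est : ∀ k, SignedGraph (n k) → Labels (n k)} (hest : ∀ k, IsSDPEstimator (est k)) :
    Tendsto (fun k => ((n k : ℝ) ^ 2 + 1) * (M k).failProb (est k)) atTop (𝓝 0) := by
  have hnR : Tendsto (fun k => (n k : ℝ)) atTop atTop := tendsto_natCast_atTop_atTop.comp hn
  -- Chosen so that the power 2^j of n^c is at least n⁴.
  obtain ⟨j, hj⟩ := pow_unbounded_of_one_lt (4 / c) (one_lt_two (α := ℝ))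
  have hj' : 4 ≤ c * (2 ^ j : ℕ) := by
    rw [div_lt_iff₀ hc] at hj
    push_cast
    linarith
  obtain ⟨K, hK⟩ : ∃ K : ℝ, K =
    (2 ^ j).factorial * 16 ^ 2 ^ j + 4 ^ 2 ^ j * (2 * 2 ^ j + 1).factorial * 64 ^ 2 ^ j := ⟨_, rfl⟩
  have hK0 : 0 ≤ K := by rw [hK]; positivity
  have hlim : Tendsto (fun k => 2 * K / C ^ 2 ^ j * (n k : ℝ)⁻¹) atTop (𝓝 0) := by
    simpa using (tendsto_inv_atTop_zero.comp hnR).const_mul (2 * K / C ^ 2 ^ j)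
  refine squeeze_zero' (Eventually.of_forall fun k =>
    mul_nonneg (by positivity) (Model.failProb_nonneg _ _)) ?_ hlim
  have hsnr : Tendsto (fun k => C * (n k : ℝ) ^ c) atTop atTop :=
    ((tendsto_rpow_atTop hc).comp hnR).const_mul_atTop hC
  filter_upwards [h, hsnr.eventually_ge_atTop 1, hn.eventually_ge_atTop 1] with k h1 h2 h3
  have hk : (1 : ℝ) ≤ n k := by exact_mod_cast h3
  have hf := (M k).failProb_le (hest k) h1.1 (h2.trans h1.2) j
  rw [← hK] at hf
  have hpow : C ^ 2 ^ j * (n k : ℝ) ^ 4 ≤ (M k).snr ^ 2 ^ j := by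
    calc C ^ 2 ^ j * (n k : ℝ) ^ 4 ≤ C ^ 2 ^ j * ((n k : ℝ) ^ c) ^ 2 ^ j := by
          gcongr
          rw [← Real.rpow_natCast ((n k : ℝ) ^ c), ← Real.rpow_mul (by linarith),
            ← Real.rpow_natCast (n k : ℝ) 4]
          exact Real.rpow_le_rpow_of_exponent_le hk (by exact_mod_cast hj')
      _ = (C * (n k : ℝ) ^ c) ^ 2 ^ j := (mul_pow _ _ _).symm
      _ ≤ _ := by gcongr; exact h1.2
  calc ((n k : ℝ) ^ 2 + 1) * (M k).failProb (est k)
      ≤ (2 * (n k : ℝ) ^ 2) * (n k * (K / (C ^ 2 ^ j * (n k : ℝ) ^ 4))) := by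
        refine mul_le_mul (by nlinarith) (hf.trans ?_) (Model.failProb_nonneg _ _) (by positivity)
        gcongr
    _ = _ := by field_simp

/-- An extended nonnegative sequence squeezed between `(1 ± d) u` for every `d > 0`. -/
lemma exists_eq_ofReal_mul_one_add {w : ℕ → ℝ≥0∞} {u : ℕ → ℝ} (hu : ∀ᶠ k in atTop, 0 < u k)
    (hlow : ∀ δ : ℝ, 0 < δ → ∀ᶠ k in atTop, ENNReal.ofReal ((1 - δ) * u k) ≤ w k)
    (hup : ∀ δ : ℝ, 0 < δ → ∀ᶠ k in atTop, w k ≤ ENNReal.ofReal ((1 + δ) * u k)) :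
    ∃ r : ℕ → ℝ, Tendsto r atTop (𝓝 0) ∧
      ∀ᶠ k in atTop, w k = ENNReal.ofReal (u k * (1 + r k)) := by
  refine ⟨fun k => (w k).toReal / u k - 1, ?_, ?_⟩
  · rw [Metric.tendsto_nhds]
    intro δ hδ
    filter_upwards [hu, hlow (δ / 2) (by positivity), hup (δ / 2) (by positivity)] with k h1 h2 h3
    have hw : w k ≠ ∞ := ne_top_of_le_ne_top ENNReal.ofReal_ne_top h3
    have h4 : (w k).toReal ≤ (1 + δ / 2) * u k :=
      ENNReal.toReal_le_of_le_ofReal (by positivity) h3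
    have h5 : (1 - δ / 2) * u k ≤ (w k).toReal := (ENNReal.ofReal_le_iff_le_toReal hw).1 h2
    rw [← div_le_iff₀ h1] at h4
    rw [← le_div_iff₀ h1] at h5
    rw [Real.dist_eq, sub_zero, abs_lt]
    constructor <;> linarith
  · filter_upwards [hu, hup 1 one_pos] with k h1 h3
    have hw : w k ≠ ∞ := ne_top_of_le_ne_top ENNReal.ofReal_ne_top h3
    rw [add_sub_cancel, mul_div_cancel₀ _ h1.ne', ENNReal.ofReal_toReal hw]

/-- The correction factor of the lower bounds is eventually close to one. -/
lemma eventually_le_correction {b x : ℕ → ℝ} (hb : Tendsto b atTop atTop)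
    (hx : Tendsto x atTop (𝓝 0)) {d : ℝ} (hd : 0 < d) :
    ∀ᶠ k in atTop, 1 - d ≤ 1 - 2 * (b k * Real.exp (-(d / 2 * b k))) - 4 / d ^ 2 * x k := by
  have h1 : Tendsto (fun k => b k * Real.exp (-(d / 2 * b k))) atTop (𝓝 0) := by
    have h2 := (Real.tendsto_pow_mul_exp_neg_atTop_nhds_zero 1).comp
      (hb.const_mul_atTop (half_pos hd))
    have h3 := h2.const_mul (2 / d)
    rw [mul_zero] at h3
    refine h3.congr fun k => ?_
    simp only [Function.comp, pow_one]
    field_simp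
  have h2 : Tendsto (fun k => 1 - 2 * (b k * Real.exp (-(d / 2 * b k))) - 4 / d ^ 2 * x k) atTop
      (𝓝 (1 - 2 * 0 - 4 / d ^ 2 * 0)) :=
    ((tendsto_const_nhds.sub (h1.const_mul 2))).sub (hx.const_mul _)
  exact h2.eventually (eventually_ge_nhds (by linarith))

end Sequence

end

end PrivCBM

/-! ### Assembly of the asymptotic theorem. -/

theorem mainTheorem5
    (ζ : unitInterval) (hζ0 : 0 < (ζ : ℝ)) (hζ1 : (ζ : ℝ) < 1 / 2)
    (n : ℕ → ℕ) (hn : Tendsto n atTop atTop)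
    (M : ∀ k, Model (n k)) (hMζ : ∀ k, (M k).ζ = ζ)
    (hham : ∀ᶠ k in atTop, 1 ≤ (M k).ham ∧ 2 * (M k).ham ≤ n k)
    (hε : ∃ c : ℝ, 0 < c ∧ ∀ᶠ k in atTop, c * Real.log (n k) ≤ (M k).ε)
    (a : ℕ → ℝ) (hrec : ∀ᶠ k in atTop, (M k).RecoveryCondition (a k))
    (est : ∀ k, SignedGraph (n k) → Labels (n k)) (hest : ∀ k, IsSDPEstimator (est k))
    (γ : ℕ → ℝ) (hγ : Tendsto γ atTop atTop)
    (hI : (fun k => (M k).infoTilde) =o[atTop] (fun k => Real.log (γ k))) :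
    -- the delay of `T_L` with threshold `b = log γ`,
    -- for the filtration of the privatized graphs and for that of the raw graphs
    (∃ r : ℕ → ℝ, Tendsto r atTop (𝓝 0) ∧ ∀ᶠ k in atTop,
      (M k).wadd (privateFiltration (n k)) ((M k).TL (est k) (Real.log (γ k))) =
        ENNReal.ofReal (Real.log (γ k) / (M k).infoTilde * (1 + r k))) ∧
    (∃ r : ℕ → ℝ, Tendsto r atTop (𝓝 0) ∧ ∀ᶠ k in atTop,
      (M k).wadd (rawFiltration (n k)) ((M k).TL (est k) (Real.log (γ k))) =
        ENNReal.ofReal (Real.log (γ k) / (M k).infoTilde * (1 + r k))) ∧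
    -- `Ĩ₀` is the Kullback-Leibler divergence of the privatized post- and pre-change laws
    (∀ k, InformationTheory.klDiv ((M k).privateLaw (M k).post) ((M k).privateLaw (M k).pre) =
      ENNReal.ofReal (M k).infoTilde) ∧
    -- `T_L` is a stopping rule with average run length at least `γ`, and no such rule
    -- applied to the privatized graphs has an asymptotically smaller delay
    (∀ᶠ k in atTop,
      IsStoppingTime (privateFiltration (n k)) ((M k).TL (est k) (Real.log (γ k))) ∧
      ENNReal.ofReal (γ k) ≤ (M k).arl ((M k).TL (est k) (Real.log (γ k)))) ∧
    (∀ δ : ℝ, 0 < δ → ∀ᶠ k in atTop, ∀ τ : SamplePath (n k) → ℕ∞,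
      IsStoppingTime (privateFiltration (n k)) τ → ENNReal.ofReal (γ k) ≤ (M k).arl τ →
        ENNReal.ofReal ((1 - δ) * (Real.log (γ k) / (M k).infoTilde)) ≤
          (M k).wadd (privateFiltration (n k)) τ) := by
  obtain ⟨C, c, hC, hc, hreg⟩ := eventually_le_snr hζ1 hn hMζ hε hrec
  have hfail := tendsto_mul_failProb hn hC hc hreg hest
  have hnR : Tendsto (fun k => (n k : ℝ)) atTop atTop := tendsto_natCast_atTop_atTop.comp hn
  have hsnr : Tendsto (fun k => C * (n k : ℝ) ^ c) atTop atTop :=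
    ((tendsto_rpow_atTop hc).comp hnR).const_mul_atTop hC
  have hb : Tendsto (fun k => Real.log (γ k)) atTop atTop := Real.tendsto_log_atTop.comp hγ
  have hx : Tendsto (fun k => (M k).infoTilde / Real.log (γ k)) atTop (𝓝 0) :=
    hI.tendsto_div_nhds_zero
  have hgood : ∀ᶠ k in atTop, 0 < (M k).signal ∧ 4 ≤ (M k).snr ∧
      (n k : ℝ) - 1 ≤ (disagree (M k).post (M k).pre).card ∧ 0 < Real.log (γ k) ∧
      0 < γ k ∧ 0 < Real.log (γ k) / (M k).infoTilde := by
    filter_upwards [hreg, hsnr.eventually_ge_atTop 4, hham, hb.eventually_gt_atTop 0,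
      hγ.eventually_gt_atTop 0] with k h1 h2 h3 h4 h5
    have h6 := card_disagree_ge (M k) h3.1 h3.2
    have h7 := h2.trans h1.2
    have h8 := Model.snr_le_infoTilde h1.1 h6
    exact ⟨h1.1, h7, h6, h4, h5, div_pos h4 (by linarith)⟩
  -- Ensures that the windows of the lower bound have length at least one.
  have hone : ∀ d : ℝ, 0 < d → d < 1 →
      ∀ᶠ k in atTop, 1 ≤ (1 - d) * (Real.log (γ k) / (M k).infoTilde) := by
    intro d hd hd1
    filter_upwards [hgood, hx.eventually (eventually_le_nhds (sub_pos.2 hd1))] with k h1 h2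
    obtain ⟨-, -, -, h3, -, h4⟩ := h1
    have h5 : (M k).infoTilde / Real.log (γ k) = (Real.log (γ k) / (M k).infoTilde)⁻¹ :=
      (inv_div _ _).symm
    rw [h5] at h2
    calc (1 : ℝ) = (Real.log (γ k) / (M k).infoTilde)⁻¹ * (Real.log (γ k) / (M k).infoTilde) :=
          (inv_mul_cancel₀ h4.ne').symm
      _ ≤ _ := by gcongr
  have hlower : ∀ δ : ℝ, 0 < δ → ∃ d : ℝ, 0 < d ∧ d < 1 ∧ ∀ᶠ k in atTop,
      0 ≤ 1 - 2 * (Real.log (γ k) * Real.exp (-(d / 2 * Real.log (γ k)))) -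
        4 / d ^ 2 * ((M k).infoTilde / Real.log (γ k)) ∧
      ENNReal.ofReal ((1 - δ) * (Real.log (γ k) / (M k).infoTilde)) ≤
      ENNReal.ofReal ((1 - d) * (Real.log (γ k) / (M k).infoTilde) *
        (1 - 2 * (Real.log (γ k) * Real.exp (-(d / 2 * Real.log (γ k)))) -
          4 / d ^ 2 * ((M k).infoTilde / Real.log (γ k)))) := by
    intro δ hδ
    -- One factor 1-d comes from the window length and one from the correction term; (1-d)² ≥ 1-δ
    -- when d ≤ δ/2.
    refine ⟨min (δ / 2) (1 / 2), by positivity, (min_le_right _ _).trans_lt (by norm_num), ?_⟩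
    have hd0 : 0 < min (δ / 2) (1 / 2) := by positivity
    have hd1 := min_le_left (δ / 2) (1 / 2)
    have hd2 := min_le_right (δ / 2) (1 / 2)
    generalize min (δ / 2) (1 / 2) = d at *
    filter_upwards [hgood, eventually_le_correction hb hx hd0] with k h1 h2
    refine ⟨by linarith, ENNReal.ofReal_le_ofReal ?_⟩
    have h3 := h1.2.2.2.2.2
    calc (1 - δ) * (Real.log (γ k) / (M k).infoTilde)
        ≤ ((1 - d) * (1 - d)) * (Real.log (γ k) / (M k).infoTilde) := by
          gcongr
          nlinarith
      _ = (1 - d) * (Real.log (γ k) / (M k).infoTilde) * (1 - d) := by ring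
      _ ≤ _ := mul_le_mul_of_nonneg_left h2 (mul_nonneg (by linarith) h3.le)
  have hlowTL : ∀ F : ∀ k, Filtration ℕ (inferInstance : MeasurableSpace (SamplePath (n k))),
      ∀ δ : ℝ, 0 < δ → ∀ᶠ k in atTop,
        ENNReal.ofReal ((1 - δ) * (Real.log (γ k) / (M k).infoTilde)) ≤
          (M k).wadd (F k) ((M k).TL (est k) (Real.log (γ k))) := by
    intro F δ hδ
    obtain ⟨d, hd, hd1, hev⟩ := hlower δ hδ
    filter_upwards [hev, hgood, hone d hd hd1] with k h1 h2 h3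
    exact h1.2.trans (Model.le_wadd_TL h2.1 h2.2.1 h2.2.2.1 (est k) h2.2.2.2.1 hd hd1 h3 h1.1 (F k))
  have hupTL : ∀ (β : ℕ → Type) [∀ k, MeasurableSpace (β k)] (f : ∀ k, Sample (n k) → β k)
      (hf : ∀ k, Measurable (f k)) (δ : ℝ), 0 < δ → ∀ᶠ k in atTop,
        (M k).wadd (filtrationOf (f k) (hf k)) ((M k).TL (est k) (Real.log (γ k))) ≤
          ENNReal.ofReal ((1 + δ) * (Real.log (γ k) / (M k).infoTilde)) := by
    intro β _ f hf δ hδ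
    -- With η = δ/2 the denominator tends to 1 and the whole factor to 1 + δ/2, which leaves room
    -- below 1 + δ.
    have hden : Tendsto (fun k => 1 - 2 / (δ / 2) * ((M k).infoTilde / Real.log (γ k)) -
        ((n k : ℝ) ^ 2 + 1) * (M k).failProb (est k)) atTop (𝓝 (1 - 2 / (δ / 2) * 0 - 0)) :=
      (tendsto_const_nhds.sub (hx.const_mul _)).sub hfail
    have hnum : Tendsto (fun k => 1 + δ / 2 + (M k).infoTilde / Real.log (γ k) *
        (((n k : ℝ) ^ 2 + 1) * (M k).failProb (est k))) atTop (𝓝 (1 + δ / 2 + 0 * 0)) :=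
      tendsto_const_nhds.add (hx.mul hfail)
    have htot := hx.add (hnum.div hden (by norm_num))
    filter_upwards [hgood, hden.eventually_const_lt (u := 0) (by norm_num),
      htot.eventually (eventually_le_nhds (b := 1 + δ) (by norm_num; linarith))] with k h1 h2 h3
    refine (Model.wadd_TL_le_of_snr h1.1 h1.2.1 h1.2.2.1 (est k) h1.2.2.2.1 (half_pos hδ) h2
      (hf k)).trans (ENNReal.ofReal_le_ofReal ?_)
    rw [mul_comm (1 + δ)]
    exact mul_le_mul_of_nonneg_left h3 h1.2.2.2.2.2.le
  have hu : ∀ᶠ k in atTop, 0 < Real.log (γ k) / (M k).infoTilde :=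
    hgood.mono fun k h => h.2.2.2.2.2
  refine ⟨exists_eq_ofReal_mul_one_add hu (hlowTL _) (hupTL _ (fun _ => Prod.snd) _),
    exists_eq_ofReal_mul_one_add hu (hlowTL _) (hupTL _ (fun _ => Prod.fst) _),
    fun k => (M k).klDiv_privateLaw, ?_, ?_⟩
  · filter_upwards [hgood] with k h
    refine ⟨(M k).isStoppingTime_TL (est k) _, ?_⟩
    have h1 := (M k).exp_le_arl_TL (est k) h.2.2.2.1
    rwa [Real.exp_log h.2.2.2.2.1] at h1
  · intro δ hδ
    obtain ⟨d, hd, hd1, hev⟩ := hlower δ hδ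
    filter_upwards [hev, hgood, hone d hd hd1] with k h1 h2 h3 τ hτ harl
    exact h1.2.trans (Model.le_wadd_of_arl h2.1 h2.2.1 h2.2.2.1 hτ h2.2.2.2.1 hd hd1 h3
      (by rwa [Real.exp_log h2.2.2.2.2.1]) h1.1)
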